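/- Let $n\ge 2$ and $m\ge 1$ be integers, let $\alpha_M>0$, $V,\tilde\kappa\in\mathbb R$, and let $(S,g)$ be a non-empty compact smooth Riemannian manifold of dimension $m$ without boundary, with Laplacian $\varDelta$. Put $$a_0=\frac{2n(n-1)}{\alpha_M},\qquad \bar V=\frac{\alpha_M}{n(n-1)}V,\qquad \bar\mu=\frac4{n^2}a_0\,\mu-\frac{(m-1)^2}4\quad(\mu\in\mathbb R).$$ Let $\mathcal H_0\subset L^2(S,\mathbb C)$ be the (finite dimensional) space spanned by the eigenspaces $E_\mu$ of $-\varDelta$ with $\bar\mu\le 0$, and let $M=-\frac4{n^2}a_0\varDelta-\frac{(m-1)^2}4$ on $\mathcal H_0$, so that $M=\bar\mu$ on $E_\mu$. Let $I_1=(0,r_0)$ with $r_0>0$, and $I_2=(0,\infty)$. Let $\mathcal H(I_i,1)=L^2(I_i,r\,dr)\otimes\mathcal H_0$, and let $\mathcal H_i(I_i)$ be the completion of $C_c^\infty(I_i)\otimes\mathcal H_0$ with respect to the norm $$\|\psi\|^2=\int_{I_i}\Big\{r\,\|\dot\psi\|^2-r^{-1}\langle M\psi,\psi\rangle+\epsilon_i\,r^3\|\psi\|^2\Big\}\,dr,\qquad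 \epsilon_1=0,\ \epsilon_2=1,$$ where $\|\cdot\|$ and $\langle\cdot,\cdot\rangle$ under the integral are those of $L^2(S)$; $\mathcal H_i(I_i)$ is continuously embedded in $\mathcal H(I_i,1)$. Let $$H_1\psi=-r^{-1}(r\dot\psi)'-r^{-2}M\psi-\frac{16}{n^2}\bar V r^2\psi+\frac{16}{n^2}\tilde\kappa\, r^{\frac{2(n-2)}n}\psi,\qquad H_2\psi=-r^{-1}(r\dot\psi)'-r^{-2}M\psi+\frac{16}{n^2}r^2\psi .$$ Consider the eigenvalue problems, for $\psi\in\mathcal H_i(I_i)$ and in the sense of distributions (that is, tested in $\mathcal H(I_i,1)$ against all elements of $C_c^\infty(I_i)\otimes\mathcal H_0$), $$H_1\psi=\bar\varLambda\,\frac{16}{n^2}\,r^2\psi\quad\text{on } I_1,\qquad\text{and, if }\tilde\kappa<0,\qquad H_2\psi=-\lambda\,\tilde\kappa\,\frac{16}{n^2}\,r^{\frac{2(n-2)}n}\psi\quad\text{on } I_2 .$$ Each of them has countably many solutions: there are sequences $(\bar\varLambda_j,\psi_j)_{j\in\mathbb N}$, respectively $(\lambda_j,\psi_j)_{j\in\mathbb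 N}$, of real eigenvalues and linearly independent eigenvectors $\psi_j\in\mathcal H_i(I_i)$ that exhaust all solutions, in the sense that for every real number the solutions of the problem with that number as eigenvalue lie in the (algebraic) span of the $\psi_j$ that belong to it, and $$\bar\varLambda_j\le\bar\varLambda_{j+1},\quad \lim_j\bar\varLambda_j=\infty,\qquad\text{respectively}\qquad \lambda_j\le\lambda_{j+1},\quad \lim_j\lambda_j=\infty .$$ The respective eigenvectors $(\psi_j)$ are complete in $\mathcal H_i(I_i)$ as well as in $\mathcal H(I_i,1)$, that is, their linear span is dense in both spaces. -/

import Mathlib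

open MeasureTheory Set Filter Topology
open scoped Manifold ContDiff ComplexConjugate

noncomputable section

/-! ## The compact Riemannian manifold `S`: volume, gradients, Laplacian, eigenspaces -/

namespace RiemGeom

variable {m : ℕ} {S : Type*} [TopologicalSpace S] [ChartedSpace (EuclideanSpace ℝ (Fin m)) S]
  [IsManifold (𝓡 m) ∞ S]

/-- A smooth Riemannian metric on the `m`-dimensional manifold `S`. -/
abbrev Metric (m : ℕ) (S : Type*) [TopologicalSpace S]
    [ChartedSpace (EuclideanSpace ℝ (Fin m)) S] [IsManifold (𝓡 m) ∞ S] :=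
  Bundle.ContMDiffRiemannianMetric (𝓡 m) ∞ (EuclideanSpace ℝ (Fin m))
    (fun x : S => TangentSpace (𝓡 m) x)

/-- The `i`-th standard basis vector of `ℝ^m`. -/
def basisVec (m : ℕ) (i : Fin m) : EuclideanSpace ℝ (Fin m) := EuclideanSpace.single i 1

/-- The coefficients `g_ij` of the metric in the chart around `x`, at the point with
coordinates `z`. -/
def chartGram (g : Metric m S) (x : S) (z : EuclideanSpace ℝ (Fin m)) :
    Matrix (Fin m) (Fin m) ℝ :=
  Matrix.of fun i j =>
    g.inner ((chartAt (EuclideanSpace ℝ (Fin m)) x).symm z)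
      (mfderiv (𝓡 m) (𝓡 m) (chartAt (EuclideanSpace ℝ (Fin m)) x).symm z (basisVec m i))
      (mfderiv (𝓡 m) (𝓡 m) (chartAt (EuclideanSpace ℝ (Fin m)) x).symm z (basisVec m j))

/-- The measure `√(det g_ij) dz` of the chart around `x`, carried over to `S`. -/
def chartVolume [MeasurableSpace S] (g : Metric m S) (x : S) : Measure S :=
  Measure.map (chartAt (EuclideanSpace ℝ (Fin m)) x).symm
    ((volume.restrict (chartAt (EuclideanSpace ℝ (Fin m)) x).target).withDensity
      fun z => ENNReal.ofReal (Real.sqrt (chartGram g x z).det))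

/-- The Riemannian volume. The chart measures agree on overlaps of charts, so that their supremum
is the measure which restricts to each of them on the domain of the chart. -/
def riemVolume [MeasurableSpace S] (g : Metric m S) : Measure S := ⨆ x : S, chartVolume g x

/-- The coefficients `g_ij` at `x` in the basis of `T_x S` that is given by the preferred chart
at `x`. -/
def gram (g : Metric m S) (x : S) : Matrix (Fin m) (Fin m) ℝ :=
  Matrix.of fun i j =>
    g.inner x (show TangentSpace (𝓡 m) x from basisVec m i)
      (show TangentSpace (𝓡 m) x from basisVec m j)

/-- The partial derivative `∂_i f` at `x` in the same basis. -/
def partialDeriv (f : S → ℂ) (x : S) (i : Fin m) : ℂ :=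
  mfderiv (𝓡 m) 𝓘(ℝ, ℂ) f x (show TangentSpace (𝓡 m) x from basisVec m i)

/-- `⟨Df, Dh⟩ = g^{ij} ∂_i f conj(∂_j h)`, the pairing of the gradients of two complex valued
functions. -/
def gradInner (g : Metric m S) (f h : S → ℂ) (x : S) : ℂ :=
  ∑ i, ∑ j, (((gram g x)⁻¹ i j : ℝ) : ℂ) * partialDeriv f x i * conj (partialDeriv h x j)

/-- `l` is the Laplacian `Δ f = div (grad f)` of `f`: the divergence being minus the adjoint of the
gradient, `∫ ⟨Df, Dh⟩ = - ∫ l conj(h)` for all smooth `h` (`S` is compact without boundary). -/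
def IsLaplacian [MeasurableSpace S] (g : Metric m S) (f l : S → ℂ) : Prop :=
  ∀ h : S → ℂ, ContMDiff (𝓡 m) 𝓘(ℝ, ℂ) ∞ h →
    ∫ x, gradInner g f h x ∂(riemVolume g) = - ∫ x, l x * conj (h x) ∂(riemVolume g)

/-- `L²(S, ℂ)`. -/
abbrev L2 [MeasurableSpace S] (g : Metric m S) := Lp ℂ 2 (riemVolume g)

/-- The eigenspace `E_μ ⊂ L²(S, ℂ)` of `-Δ`: all (classes of) smooth functions `f` such that
`-Δ f = μ f`. -/
def eigenspace [MeasurableSpace S] (g : Metric m S) (μ : ℝ) : Submodule ℂ (L2 g) :=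
  Submodule.span ℂ {η | ∃ f : S → ℂ, ContMDiff (𝓡 m) 𝓘(ℝ, ℂ) ∞ f ∧
    (η : S → ℂ) =ᵐ[riemVolume g] f ∧ IsLaplacian g f fun x => -(μ : ℂ) * f x}

lemma conj_gradInner (g : Metric m S) (f h : S → ℂ) (x : S) :
    conj (gradInner g f h x) = gradInner g h f x := by
  have hs : (gram g x).IsSymm := by
    ext i j
    exact g.symm x _ _
  have hs' : ((gram g x)⁻¹).IsSymm := by
    rw [Matrix.IsSymm, Matrix.transpose_nonsing_inv, hs]
  unfold gradInner
  simp only [map_sum, map_mul, Complex.conj_conj, Complex.conj_ofReal]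
  rw [Finset.sum_comm]
  refine Finset.sum_congr rfl fun i _ => Finset.sum_congr rfl fun j _ => ?_
  rw [hs'.apply i j]
  ring

/-- Eigenspaces for different eigenvalues are orthogonal. -/
lemma eigenspace_ortho [MeasurableSpace S] (g : Metric m S) {μ ν : ℝ} (hμν : μ ≠ ν)
    {η ζ : L2 g} (hη : η ∈ eigenspace g μ) (hζ : ζ ∈ eigenspace g ν) :
    inner ℂ η ζ = 0 := by
  have key : eigenspace g μ ⟂ eigenspace g ν := by
    unfold eigenspace
    rw [Submodule.isOrtho_span]
    rintro η ⟨f, hf, hηf, hμ⟩ ζ ⟨h, hh, hζh, hν⟩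
    rw [L2.inner_def]
    have e1 : ∫ x, inner ℂ (η x) (ζ x) ∂(riemVolume g)
        = ∫ x, h x * conj (f x) ∂(riemVolume g) := by
      refine integral_congr_ae ?_
      filter_upwards [hηf, hζh] with x h1 h2
      simp [h1, h2]
    rw [e1]
    have a := hμ h hh
    have b := hν f hf
    have c : conj (∫ x, gradInner g f h x ∂(riemVolume g))
        = ∫ x, gradInner g h f x ∂(riemVolume g) := by
      rw [← integral_conj]
      exact integral_congr_ae (Eventually.of_forall fun x => conj_gradInner g f h x)
    rw [← c, a] at b
    simp only [mul_assoc, integral_const_mul, map_neg, map_mul, Complex.conj_ofReal,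
      ← integral_conj, Complex.conj_conj] at b
    have d : ∫ x, conj (f x) * h x ∂(riemVolume g) = ∫ x, h x * conj (f x) ∂(riemVolume g) :=
      integral_congr_ae (Eventually.of_forall fun x => mul_comm _ _)
    rw [d] at b
    have e : ((μ : ℂ) - ν) * ∫ x, h x * conj (f x) ∂(riemVolume g) = 0 := by
      linear_combination b
    rcases mul_eq_zero.mp e with e | e
    · exact absurd (by exact_mod_cast sub_eq_zero.mp e) hμν
    · exact e
  exact Submodule.isOrtho_iff_inner_eq.mp key η hη ζ hζ

end RiemGeom

/-! ## A linear operator that is a given scalar on each member of an orthogonal family -/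

namespace SpectralOp

variable {F ι : Type*} [NormedAddCommGroup F] [InnerProductSpace ℂ F] [DecidableEq ι]
  (E : ι → Submodule ℂ F)

/-- The algebraic sum of a family of pairwise orthogonal subspaces is direct. -/
def decomp (hE : ∀ i j, i ≠ j → E i ⟂ E j) :
    (Π₀ i, E i) ≃ₗ[ℂ] (⨆ i, E i : Submodule ℂ F) :=
  (LinearEquiv.ofInjective (DFinsupp.lsum ℕ fun i => (E i).subtype)
    (iSupIndep.dfinsupp_lsum_injective
      (OrthogonalFamily.independent (OrthogonalFamily.of_pairwise fun i j h => hE i j h)))).trans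
    (LinearEquiv.ofEq _ _ (Submodule.iSup_eq_range_dfinsupp_lsum E).symm)

/-- The operator on `⨆ i, E i` that multiplies the elements of `E i` by `a i`. -/
def linOp (hE : ∀ i j, i ≠ j → E i ⟂ E j) (a : ι → ℝ) :
    (⨆ i, E i : Submodule ℂ F) →ₗ[ℂ] (⨆ i, E i : Submodule ℂ F) :=
  (decomp E hE).toLinearMap ∘ₗ
    (DFinsupp.mapRange.linearMap fun i => (a i : ℂ) • (LinearMap.id : E i →ₗ[ℂ] E i)) ∘ₗ
    (decomp E hE).symm.toLinearMap

lemma decomp_single (hE : ∀ i j, i ≠ j → E i ⟂ E j) (i : ι) (x : E i) :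
    ((decomp E hE (DFinsupp.single i x) : (⨆ i, E i : Submodule ℂ F)) : F) = x := by
  simp [decomp]

lemma linOp_apply_mem (hE : ∀ i j, i ≠ j → E i ⟂ E j) (a : ι → ℝ) (i : ι)
    (x : (⨆ i, E i : Submodule ℂ F)) (hx : (x : F) ∈ E i) :
    linOp E hE a x = (a i : ℂ) • x := by
  have h : x = decomp E hE (DFinsupp.single i ⟨x, hx⟩) := by
    apply Subtype.ext
    rw [decomp_single]
  have h2 : (decomp E hE).symm x = DFinsupp.single i ⟨x, hx⟩ := by
    rw [LinearEquiv.symm_apply_eq]; exact h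
  apply Subtype.ext
  simp only [linOp, LinearMap.comp_apply, LinearEquiv.coe_coe, h2]
  simp [decomp_single]

lemma exists_sum (hE : ∀ i j, i ≠ j → E i ⟂ E j) (a : ι → ℝ) (x : (⨆ i, E i : Submodule ℂ F)) :
    ∃ (s : Finset ι) (v : ∀ i, E i), (x : F) = ∑ i ∈ s, (v i : F) ∧
      ((linOp E hE a x : (⨆ i, E i : Submodule ℂ F)) : F) = ∑ i ∈ s, (a i : ℂ) • (v i : F) := by
  classical
  obtain ⟨f, rfl⟩ := (decomp E hE).surjective x
  refine ⟨f.support, fun i => f i, ?_, ?_⟩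
  · simp [decomp, DFinsupp.sumAddHom_apply, DFinsupp.sum]
  · have hf : decomp E hE f = ∑ i ∈ f.support, decomp E hE (DFinsupp.single i (f i)) := by
      rw [← map_sum]
      congr 1
      exact (DFinsupp.sum_single (f := f)).symm
    rw [hf, map_sum, AddSubmonoidClass.coe_finsetSum]
    refine Finset.sum_congr rfl fun i _ => ?_
    rw [linOp_apply_mem E hE a i _ (by rw [decomp_single]; exact (f i).2)]
    simp [decomp_single]

lemma linOp_bound (hE : ∀ i j, i ≠ j → E i ⟂ E j) (a : ι → ℝ) (c : ℝ) (hc : 0 ≤ c)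
    (ha : ∀ i, |a i| ≤ c) (x : (⨆ i, E i : Submodule ℂ F)) :
    ‖linOp E hE a x‖ ≤ c * ‖x‖ := by
  obtain ⟨s, v, h1, h2⟩ := exists_sum E hE a x
  have hO : OrthogonalFamily ℂ (fun i => E i) fun i => (E i).subtypeₗᵢ :=
    OrthogonalFamily.of_pairwise fun i j h => hE i j h
  have n1 : ‖∑ i ∈ s, (v i : F)‖ ^ 2 = ∑ i ∈ s, ‖(v i : F)‖ ^ 2 := hO.norm_sum v s
  have n2 : ‖∑ i ∈ s, (a i : ℂ) • (v i : F)‖ ^ 2 = ∑ i ∈ s, ‖(a i : ℂ) • (v i : F)‖ ^ 2 :=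
    hO.norm_sum (fun i => (a i : ℂ) • v i) s
  simp only [norm_smul] at n2
  have : ‖(linOp E hE a x : F)‖ ^ 2 ≤ (c * ‖(x : F)‖) ^ 2 := by
    rw [h1, h2, n2, mul_pow, n1, Finset.mul_sum]
    refine Finset.sum_le_sum fun i _ => ?_
    rw [mul_pow]
    gcongr
    simpa using ha i
  exact le_of_sq_le_sq this (by positivity)

lemma linOp_symm (hE : ∀ i j, i ≠ j → E i ⟂ E j) (a : ι → ℝ) (x y : (⨆ i, E i : Submodule ℂ F)) :
    inner ℂ (linOp E hE a x) y = inner ℂ x (linOp E hE a y) := by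
  obtain ⟨s, v, h1, h2⟩ := exists_sum E hE a x
  obtain ⟨t, w, k1, k2⟩ := exists_sum E hE a y
  rw [Submodule.coe_inner, Submodule.coe_inner, h1, h2, k1, k2]
  simp only [sum_inner, inner_sum]
  refine Finset.sum_congr rfl fun i _ => Finset.sum_congr rfl fun j _ => ?_
  rw [inner_smul_left, inner_smul_right, Complex.conj_ofReal]
  by_cases h : i = j
  · rw [h]
  · rw [Submodule.isOrtho_iff_inner_eq.mp (hE j i (Ne.symm h)) _ (v j).2 _ (w i).2]
    simp

lemma linOp_re_inner (hE : ∀ i j, i ≠ j → E i ⟂ E j) (a : ι → ℝ) (c : ℝ)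
    (ha : ∀ i, a i ≤ c) (x : (⨆ i, E i : Submodule ℂ F)) :
    (inner ℂ (linOp E hE a x) x).re ≤ c * ‖x‖ ^ 2 := by
  obtain ⟨s, v, h1, h2⟩ := exists_sum E hE a x
  have hO : OrthogonalFamily ℂ (fun i => E i) fun i => (E i).subtypeₗᵢ :=
    OrthogonalFamily.of_pairwise fun i j h => hE i j h
  have n1 : ‖∑ i ∈ s, (v i : F)‖ ^ 2 = ∑ i ∈ s, ‖(v i : F)‖ ^ 2 := hO.norm_sum v s
  have n2 : inner ℂ (∑ i ∈ s, (a i : ℂ) • (v i : F)) (∑ i ∈ s, (v i : F))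
      = ∑ i ∈ s, inner ℂ ((a i : ℂ) • (v i : F)) (v i : F) :=
    hO.inner_sum (fun i => (a i : ℂ) • v i) v s
  rw [Submodule.coe_inner, Submodule.coe_norm, h2]
  rw [h1, n1, n2, Finset.mul_sum, Complex.re_sum]
  refine Finset.sum_le_sum fun i _ => ?_
  rw [inner_smul_left, inner_self_eq_norm_sq_to_K]
  have := ha i
  have h3 : ((starRingEnd ℂ) (a i : ℂ) * (‖(v i : F)‖ : ℂ) ^ 2).re = a i * ‖(v i : F)‖ ^ 2 := by
    rw [Complex.conj_ofReal]; norm_cast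
  refine (le_of_eq h3).trans ?_
  gcongr

end SpectralOp

/-! ## Radial function spaces with values in a space `F` of functions on `S` -/

namespace Radial

variable {F : Type*} [NormedAddCommGroup F] [InnerProductSpace ℂ F]

/-- A bounded, symmetric, nonpositive operator. -/
structure AngularOp (F : Type*) [NormedAddCommGroup F] [InnerProductSpace ℂ F] where
  op : F →L[ℂ] F
  symm : ∀ x y : F, inner ℂ (op x) y = inner ℂ x (op y)
  nonpos : ∀ x : F, (inner ℂ (op x) x).re ≤ 0

/-- The operator `a A - b` as an `AngularOp`. -/
def AngularOp.affine (A : F →L[ℂ] F) (a b : ℝ) (hs : ∀ x y : F, inner ℂ (A x) y = inner ℂ x (A y))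
    (hn : ∀ x : F, a * (inner ℂ (A x) x).re ≤ b * ‖x‖ ^ 2) : AngularOp F where
  op := (a : ℂ) • A - (b : ℂ) • ContinuousLinearMap.id ℂ F
  symm x y := by
    simp only [sub_apply, smul_apply, ContinuousLinearMap.id_apply, inner_sub_left,
      inner_sub_right, inner_smul_left, inner_smul_right, Complex.conj_ofReal, hs]
  nonpos x := by
    have e : (inner ℂ x x : ℂ).re = ‖x‖ ^ 2 := by
      rw [inner_self_eq_norm_sq_to_K]; norm_cast
    have h := hn x
    simp only [sub_apply, smul_apply, ContinuousLinearMap.id_apply, inner_sub_left,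
      inner_smul_left, Complex.conj_ofReal, Complex.sub_re, Complex.re_ofReal_mul, e]
    linarith

/-- The two models: `I_1 = (0, r₀)` and `I_2 = (0, ∞)`. -/
inductive Model where
  | bounded (r₀ : ℝ) : Model
  | unbounded : Model

/-- The interval of the model. -/
def Model.interval : Model → Set ℝ
  | .bounded r₀ => Ioo 0 r₀
  | .unbounded => Ioi 0

/-- The coefficient of `∫ r³ |u|²` in the scalar product of the model. -/
def Model.weight : Model → ℝ
  | .bounded _ => 0
  | .unbounded => 1

lemma Model.interval_subset (M : Model) : M.interval ⊆ Ioi 0 := by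
  cases M with
  | bounded r₀ => exact Ioo_subset_Ioi_self
  | unbounded => exact subset_rfl

lemma Model.measurableSet_interval (M : Model) : MeasurableSet M.interval := by
  cases M with
  | bounded r₀ => exact measurableSet_Ioo
  | unbounded => exact measurableSet_Ioi

lemma Model.weight_nonneg (M : Model) : 0 ≤ M.weight := by
  cases M <;> simp [Model.weight]

/-- `C_c^∞(I, F)`, which is `C_c^∞(I) ⊗ F` when `F` is finite dimensional. -/
def testSubmodule (F : Type*) [NormedAddCommGroup F] [InnerProductSpace ℂ F] (M : Model) :
    Submodule ℂ (ℝ → F) where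
  carrier := {φ | ContDiff ℝ ∞ φ ∧ HasCompactSupport φ ∧ tsupport φ ⊆ M.interval}
  add_mem' := by
    rintro φ χ ⟨h1, h2, h3⟩ ⟨k1, k2, k3⟩
    exact ⟨h1.add k1, h2.add k2, (tsupport_add φ χ).trans (union_subset h3 k3)⟩
  zero_mem' := ⟨contDiff_const, HasCompactSupport.zero, by simp [tsupport]⟩
  smul_mem' := by
    rintro c φ ⟨h1, h2, h3⟩
    exact ⟨contDiff_const.smul h1, h2.smul_left (f := fun _ => c),
      (tsupport_smul_subset_right (fun _ => c) φ).trans h3⟩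

/-- `C_c^∞(I) ⊗ F` as a type that will carry the scalar product below. -/
def TestSpace (_T : AngularOp F) (M : Model) : Type _ := testSubmodule F M

variable {T : AngularOp F} {M : Model}

instance : AddCommGroup (TestSpace T M) := inferInstanceAs (AddCommGroup (testSubmodule F M))
instance : Module ℂ (TestSpace T M) := inferInstanceAs (Module ℂ (testSubmodule F M))

/-- The function underlying a test function. -/
def TestSpace.fn (φ : TestSpace T M) : ℝ → F := φ.1

@[simp] lemma TestSpace.fn_add (φ χ : TestSpace T M) (r : ℝ) :
    (φ + χ).fn r = φ.fn r + χ.fn r := rfl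

@[simp] lemma TestSpace.fn_smul (c : ℂ) (φ : TestSpace T M) (r : ℝ) :
    (c • φ).fn r = c • φ.fn r := rfl

lemma TestSpace.contDiff (φ : TestSpace T M) : ContDiff ℝ ∞ φ.fn := φ.2.1

lemma TestSpace.compact (φ : TestSpace T M) : HasCompactSupport φ.fn := φ.2.2.1

lemma TestSpace.tsupport_subset (φ : TestSpace T M) : tsupport φ.fn ⊆ M.interval := φ.2.2.2

lemma TestSpace.diff (φ : TestSpace T M) (r : ℝ) : DifferentiableAt ℝ φ.fn r :=
  (φ.contDiff.differentiable (by simp)) r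

lemma TestSpace.continuous_deriv (φ : TestSpace T M) : Continuous (deriv φ.fn) :=
  φ.contDiff.continuous_deriv (by simp)

lemma TestSpace.fn_zero_of (φ : TestSpace T M) {r : ℝ} (h : r ∉ tsupport φ.fn) : φ.fn r = 0 :=
  image_eq_zero_of_notMem_tsupport h

lemma TestSpace.deriv_zero_of (φ : TestSpace T M) {r : ℝ} (h : r ∉ tsupport φ.fn) :
    deriv φ.fn r = 0 := by
  by_contra hne
  exact h (support_deriv_subset hne)

lemma TestSpace.deriv_add (φ χ : TestSpace T M) (r : ℝ) :
    deriv (φ + χ).fn r = deriv φ.fn r + deriv χ.fn r :=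
  _root_.deriv_add (φ.diff r) (χ.diff r)

lemma TestSpace.deriv_smul (c : ℂ) (φ : TestSpace T M) (r : ℝ) :
    deriv (c • φ).fn r = c • deriv φ.fn r :=
  deriv_const_smul c (φ.diff r)

/-- A function that is continuous on `(0, ∞)` and vanishes outside of the support of a test
function is integrable. -/
lemma integrable_of_support {G : Type*} [NormedAddCommGroup G] (φ : TestSpace T M) (h : ℝ → G)
    (hc : ContinuousOn h (Ioi 0)) (h0 : ∀ r, r ∉ tsupport φ.fn → h r = 0) : Integrable h := by
  have h1 : IntegrableOn h (tsupport φ.fn) :=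
    (hc.mono (φ.tsupport_subset.trans M.interval_subset)).integrableOn_compact φ.compact
  refine (integrableOn_iff_integrable_of_support_subset ?_).mp h1
  intro r hr
  by_contra hne
  exact hr (h0 r hne)

/-- The density of the scalar product: `r ⟨φ', χ'⟩ - r⁻¹ ⟨T φ, χ⟩ [+ r³ ⟨φ, χ⟩]`. -/
def formDensity (φ χ : TestSpace T M) (r : ℝ) : ℂ :=
  (r : ℂ) * inner ℂ (deriv φ.fn r) (deriv χ.fn r)
    - ((r⁻¹ : ℝ) : ℂ) * inner ℂ (T.op (φ.fn r)) (χ.fn r)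
    + ((M.weight * r ^ 3 : ℝ) : ℂ) * inner ℂ (φ.fn r) (χ.fn r)

lemma integrable_formDensity (φ χ : TestSpace T M) : Integrable (formDensity φ χ) := by
  refine integrable_of_support φ _ ?_ ?_
  · have c1 := φ.continuous_deriv
    have c2 := χ.continuous_deriv
    have c3 : Continuous φ.fn := φ.contDiff.continuous
    have c4 : Continuous χ.fn := χ.contDiff.continuous
    have c5 : Continuous fun r => T.op (φ.fn r) := T.op.continuous.comp c3
    have c6 : ContinuousOn (fun r : ℝ => ((r⁻¹ : ℝ) : ℂ)) (Ioi 0) :=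
      Complex.continuous_ofReal.comp_continuousOn
        (continuousOn_inv₀.mono fun r hr => ne_of_gt hr)
    unfold formDensity
    refine ContinuousOn.add (ContinuousOn.sub ?_ (c6.mul ?_)) ?_
    · exact (Complex.continuous_ofReal.mul (c1.inner c2)).continuousOn
    · exact (c5.inner c4).continuousOn
    · exact ((Complex.continuous_ofReal.comp (by fun_prop)).mul (c3.inner c4)).continuousOn
  · intro r hr
    simp [formDensity, φ.fn_zero_of hr, φ.deriv_zero_of hr]

/-- The scalar product of `H_i(I_i)` on test functions (linear in the second entry). -/
abbrev testCore (T : AngularOp F) (M : Model) : PreInnerProductSpace.Core ℂ (TestSpace T M) where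
  inner φ χ := ∫ r in M.interval, formDensity φ χ r
  conj_inner_symm φ χ := by
    rw [← integral_conj]
    refine integral_congr_ae (Eventually.of_forall fun r => ?_)
    simp only [formDensity, map_add, map_sub, map_mul, Complex.conj_ofReal, inner_conj_symm]
    rw [T.symm]
  re_inner_nonneg φ := by
    rw [← integral_re (integrable_formDensity φ φ).integrableOn]
    refine setIntegral_nonneg M.measurableSet_interval fun r hr => ?_
    have hr0 : 0 < r := M.interval_subset hr
    simp only [formDensity, inner_self_eq_norm_sq_to_K, map_add, map_sub, RCLike.re_to_complex,
      Complex.re_ofReal_mul]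
    have e1 : (((‖deriv φ.fn r‖ : ℝ) : ℂ) ^ 2).re = ‖deriv φ.fn r‖ ^ 2 := by norm_cast
    have e2 : (((‖φ.fn r‖ : ℝ) : ℂ) ^ 2).re = ‖φ.fn r‖ ^ 2 := by norm_cast
    have e3 := mul_nonneg (inv_nonneg.mpr hr0.le) (neg_nonneg.mpr (T.nonpos (φ.fn r)))
    have e4 := M.weight_nonneg
    have e5 : 0 ≤ r * ‖deriv φ.fn r‖ ^ 2 := by positivity
    have e6 : 0 ≤ M.weight * r ^ 3 * ‖φ.fn r‖ ^ 2 := by positivity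
    erw [e1, e2]
    linarith
  add_left φ χ ξ := by
    rw [← integral_add (integrable_formDensity φ ξ).integrableOn
      (integrable_formDensity χ ξ).integrableOn]
    refine integral_congr_ae (Eventually.of_forall fun r => ?_)
    simp only [formDensity, TestSpace.fn_add, TestSpace.deriv_add, map_add, inner_add_left]
    ring
  smul_left φ χ c := by
    rw [← integral_const_mul]
    refine integral_congr_ae (Eventually.of_forall fun r => ?_)
    simp only [formDensity, TestSpace.fn_smul, TestSpace.deriv_smul, map_smul, inner_smul_left]
    ring

instance : SeminormedAddCommGroup (TestSpace T M) :=
  InnerProductSpace.Core.toSeminormedAddCommGroup (c := testCore T M)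
instance : InnerProductSpace ℂ (TestSpace T M) := InnerProductSpace.ofCore (testCore T M)

lemma TestSpace.inner_def (φ χ : TestSpace T M) :
    inner ℂ φ χ = ∫ r in M.interval, formDensity φ χ r := rfl

/-- The Hilbert space `H_i(I_i)`: the completion of `C_c^∞(I_i) ⊗ F`. -/
abbrev FormSpace (T : AngularOp F) (M : Model) := UniformSpace.Completion (TestSpace T M)

/-- The measure `r dr` on the interval. -/
def radialMeasure (M : Model) : Measure ℝ :=
  (volume.restrict M.interval).withDensity fun r => ENNReal.ofReal r

/-- The Hilbert space `H(I, 1) = L²(I, r dr) ⊗ F`, realized as the space of (classes of)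
`F`-valued square integrable functions. -/
abbrev WaveSpace (F : Type*) [NormedAddCommGroup F] [InnerProductSpace ℂ F] (M : Model) :=
  Lp F 2 (radialMeasure M)

lemma radialMeasure_eq (M : Model) : radialMeasure M
    = (volume.restrict M.interval).withDensity fun r => ((Real.toNNReal r : NNReal) : ENNReal) :=
  rfl

instance (M : Model) : IsFiniteMeasureOnCompacts (radialMeasure M) := by
  rw [radialMeasure_eq]
  have : IsLocallyFiniteMeasure ((volume.restrict M.interval).withDensity
      fun r => ((Real.toNNReal r : NNReal) : ENNReal)) :=
    IsLocallyFiniteMeasure.withDensity_coe continuous_real_toNNReal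
  infer_instance

lemma integral_radialMeasure {G : Type*} [NormedAddCommGroup G] [NormedSpace ℝ G] (M : Model)
    (f : ℝ → G) : ∫ r, f r ∂(radialMeasure M) = ∫ r in M.interval, r • f r := by
  rw [radialMeasure_eq, integral_withDensity_eq_integral_smul continuous_real_toNNReal.measurable]
  refine setIntegral_congr_fun M.measurableSet_interval fun r hr => ?_
  have hr0 : 0 < r := M.interval_subset hr
  simp [NNReal.smul_def, hr0.le]

lemma TestSpace.memLp (φ : TestSpace T M) : MemLp φ.fn 2 (radialMeasure M) :=
  φ.contDiff.continuous.memLp_of_hasCompactSupport φ.compact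

/-- The inclusion of the test functions into `H(I, 1)`. -/
def testIncl (T : AngularOp F) (M : Model) : TestSpace T M →ₗ[ℂ] WaveSpace F M where
  toFun φ := φ.memLp.toLp φ.fn
  map_add' _ _ := rfl
  map_smul' _ _ := rfl

lemma norm_sq_testIncl (φ : TestSpace T M) :
    ‖testIncl T M φ‖ ^ 2 = ∫ r in M.interval, r * ‖φ.fn r‖ ^ 2 := by
  have h1 : ‖testIncl T M φ‖ ^ 2 = ∫ r, ‖φ.fn r‖ ^ 2 ∂(radialMeasure M) := by
    have h := L2.inner_def (𝕜 := ℂ) (testIncl T M φ) (testIncl T M φ)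
    have h2 : ∫ r, inner ℂ (testIncl T M φ r) (testIncl T M φ r) ∂(radialMeasure M)
        = ∫ r, ((‖φ.fn r‖ ^ 2 : ℝ) : ℂ) ∂(radialMeasure M) := by
      refine integral_congr_ae ?_
      filter_upwards [φ.memLp.coeFn_toLp] with r hr
      have : testIncl T M φ r = φ.fn r := hr
      rw [this, inner_self_eq_norm_sq_to_K]
      norm_cast
    rw [h2, inner_self_eq_norm_sq_to_K] at h
    have h3 : ∫ r, ((‖φ.fn r‖ ^ 2 : ℝ) : ℂ) ∂(radialMeasure M)
        = ((∫ r, ‖φ.fn r‖ ^ 2 ∂(radialMeasure M) : ℝ) : ℂ) := integral_ofReal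
    rw [h3] at h
    refine Complex.ofReal_injective ?_
    rw [← h]
    norm_cast
  rw [h1, integral_radialMeasure]
  simp

lemma integrable_weight (φ : TestSpace T M) (w : ℝ → ℝ) (hw : Continuous w) :
    Integrable fun r => w r * ‖φ.fn r‖ ^ 2 := by
  refine integrable_of_support φ _ ?_ ?_
  · have := φ.contDiff.continuous
    exact (by fun_prop : Continuous fun r => w r * ‖φ.fn r‖ ^ 2).continuousOn
  · intro r hr
    simp [φ.fn_zero_of hr]

lemma integrable_deriv (φ : TestSpace T M) : Integrable fun r => r * ‖deriv φ.fn r‖ ^ 2 := by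
  refine integrable_of_support φ _ ?_ ?_
  · have := φ.continuous_deriv
    exact (by fun_prop : Continuous fun r => r * ‖deriv φ.fn r‖ ^ 2).continuousOn
  · intro r hr
    simp [φ.deriv_zero_of hr]

lemma norm_sq_ge (φ : TestSpace T M) :
    ∫ r in M.interval, (r * ‖deriv φ.fn r‖ ^ 2 + M.weight * r ^ 3 * ‖φ.fn r‖ ^ 2) ≤ ‖φ‖ ^ 2 := by
  have h : ‖φ‖ ^ 2 = ∫ r in M.interval, (formDensity φ φ r).re := by
    rw [← inner_self_eq_norm_sq (𝕜 := ℂ), TestSpace.inner_def,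
      ← integral_re (integrable_formDensity φ φ).integrableOn]
    rfl
  rw [h]
  refine setIntegral_mono_on ?_ ?_ M.measurableSet_interval fun r hr => ?_
  · refine ((integrable_deriv φ).add (integrable_weight φ _ ?_)).integrableOn
    fun_prop
  · exact (integrable_formDensity φ φ).re.integrableOn
  · have hr0 : 0 < r := M.interval_subset hr
    have e3 := mul_nonneg (inv_nonneg.mpr hr0.le) (neg_nonneg.mpr (T.nonpos (φ.fn r)))
    have e1 : (inner ℂ (deriv φ.fn r) (deriv φ.fn r) : ℂ).re = ‖deriv φ.fn r‖ ^ 2 := by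
      rw [inner_self_eq_norm_sq_to_K]; norm_cast
    have e2 : (inner ℂ (φ.fn r) (φ.fn r) : ℂ).re = ‖φ.fn r‖ ^ 2 := by
      rw [inner_self_eq_norm_sq_to_K]; norm_cast
    simp only [formDensity, Complex.add_re, Complex.sub_re, Complex.re_ofReal_mul, e1, e2]
    linarith

lemma integral_by_parts (φ : TestSpace T M) :
    ∫ r in M.interval, (r * ‖φ.fn r‖ ^ 2 + r ^ 2 * (inner ℂ (φ.fn r) (deriv φ.fn r)).re) = 0 := by
  rw [setIntegral_eq_integral_of_forall_compl_eq_zero]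
  · refine integral_eq_zero_of_hasDerivAt_of_integrable
      (f := fun r => r ^ 2 / 2 * ‖φ.fn r‖ ^ 2) ?_ ?_ (integrable_weight φ _ (by fun_prop))
    · intro r
      have h1 : HasDerivAt (fun r => inner ℂ (φ.fn r) (φ.fn r))
          (inner ℂ (φ.fn r) (deriv φ.fn r) + inner ℂ (deriv φ.fn r) (φ.fn r)) r :=
        (φ.diff r).hasDerivAt.inner ℂ (φ.diff r).hasDerivAt
      have h2 : HasDerivAt (fun r => ‖φ.fn r‖ ^ 2)
          (2 * (inner ℂ (φ.fn r) (deriv φ.fn r)).re) r := by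
        have h3 := Complex.reCLM.hasFDerivAt.comp_hasDerivAt r h1
        have h4 : (Complex.reCLM ∘ fun r => inner ℂ (φ.fn r) (φ.fn r))
            = fun r => ‖φ.fn r‖ ^ 2 := by
          funext r
          simp only [Function.comp_apply, Complex.reCLM_apply]
          rw [inner_self_eq_norm_sq_to_K]; norm_cast
        rw [h4] at h3
        have h5 : Complex.reCLM (inner ℂ (φ.fn r) (deriv φ.fn r) + inner ℂ (deriv φ.fn r) (φ.fn r))
            = 2 * (inner ℂ (φ.fn r) (deriv φ.fn r)).re := by
          rw [Complex.reCLM_apply, Complex.add_re, ← inner_conj_symm (deriv φ.fn r) (φ.fn r),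
            Complex.conj_re]
          ring
        rw [h5] at h3
        exact h3
      have h5 : HasDerivAt (fun r : ℝ => r ^ 2 / 2) r r := by
        have := (hasDerivAt_pow 2 r).div_const 2
        have e : ((2 : ℕ) : ℝ) * r ^ (2 - 1) / 2 = r := by norm_num
        rwa [e] at this
      have h6 := h5.mul h2
      have e : r * ‖φ.fn r‖ ^ 2 + r ^ 2 / 2 * (2 * (inner ℂ (φ.fn r) (deriv φ.fn r)).re)
          = r * ‖φ.fn r‖ ^ 2 + r ^ 2 * (inner ℂ (φ.fn r) (deriv φ.fn r)).re := by ring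
      rw [e] at h6
      exact h6
    · refine (integrable_weight φ _ continuous_id).add (integrable_of_support φ _ ?_ ?_)
      · have c1 := φ.continuous_deriv
        have c2 := φ.contDiff.continuous
        exact ((continuous_id.pow 2).mul
          (Complex.continuous_re.comp (c2.inner c1))).continuousOn
      · intro r hr
        simp [φ.fn_zero_of hr]
  · intro r hr
    have : φ.fn r = 0 := φ.fn_zero_of fun h => hr (φ.tsupport_subset h)
    simp [this]

lemma young_bound (M : Model) : ∃ K : ℝ, 0 ≤ K ∧ ∀ r ∈ M.interval, ∀ a b : ℝ, 0 ≤ a → 0 ≤ b →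
    r ^ 2 * (a * b) ≤ 1 / 2 * (r * a ^ 2) + K * (r * b ^ 2 + M.weight * r ^ 3 * a ^ 2) := by
  cases M with
  | bounded r₀ =>
    refine ⟨r₀ ^ 2 / 2, by positivity, ?_⟩
    rintro r ⟨h0, h1⟩ a b ha hb
    simp only [Model.weight]
    have h2 : r ^ 2 ≤ r₀ ^ 2 := by gcongr
    have h3 := mul_nonneg (mul_nonneg h0.le (sq_nonneg b)) (sub_nonneg.mpr h2)
    have h4 := mul_nonneg h0.le (sq_nonneg (a - r * b))
    nlinarith
  | unbounded =>
    refine ⟨1 / 2, by positivity, ?_⟩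
    intro r h0 a b ha hb
    have h0' : 0 < r := h0
    simp only [Model.weight]
    have h4 := mul_nonneg h0'.le (sq_nonneg (r * a - b))
    have h5 := mul_nonneg h0'.le (sq_nonneg a)
    nlinarith

lemma testIncl_bound (T : AngularOp F) (M : Model) :
    ∃ C : ℝ, ∀ φ : TestSpace T M, ‖testIncl T M φ‖ ≤ C * ‖φ‖ := by
  obtain ⟨K, hK, h⟩ := young_bound M
  refine ⟨Real.sqrt (2 * K), fun φ => ?_⟩
  have i1 : IntegrableOn (fun r => r * ‖φ.fn r‖ ^ 2) M.interval :=
    (integrable_weight φ _ continuous_id).integrableOn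
  have i2 : IntegrableOn (fun r => r * ‖deriv φ.fn r‖ ^ 2 + M.weight * r ^ 3 * ‖φ.fn r‖ ^ 2)
      M.interval :=
    ((integrable_deriv φ).add (integrable_weight φ _ (by fun_prop))).integrableOn
  have key : ∫ r in M.interval, (1 / 2 * (r * ‖φ.fn r‖ ^ 2)
      - K * (r * ‖deriv φ.fn r‖ ^ 2 + M.weight * r ^ 3 * ‖φ.fn r‖ ^ 2)) ≤ 0 := by
    rw [← integral_by_parts φ]
    refine setIntegral_mono_on ((i1.const_mul _).sub (i2.const_mul _)) ?_
      M.measurableSet_interval fun r hr => ?_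
    · refine i1.add (Integrable.integrableOn (integrable_of_support φ _ ?_ ?_))
      · have c1 := φ.continuous_deriv
        have c2 := φ.contDiff.continuous
        exact ((continuous_id.pow 2).mul
          (Complex.continuous_re.comp (c2.inner c1))).continuousOn
      · intro r hr
        simp [φ.fn_zero_of hr]
    · have h1 := h r hr ‖φ.fn r‖ ‖deriv φ.fn r‖ (norm_nonneg _) (norm_nonneg _)
      have h2 : -(‖φ.fn r‖ * ‖deriv φ.fn r‖) ≤ (inner ℂ (φ.fn r) (deriv φ.fn r)).re :=
        (abs_le.mp ((Complex.abs_re_le_norm _).trans (norm_inner_le_norm _ _))).1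
      have h3 := mul_le_mul_of_nonneg_left h2 (sq_nonneg r)
      linarith
  rw [integral_sub (i1.const_mul _) (i2.const_mul _), integral_const_mul, integral_const_mul,
    ← norm_sq_testIncl] at key
  have h1 := mul_le_mul_of_nonneg_left (norm_sq_ge φ) hK
  have h2 : ‖testIncl T M φ‖ ^ 2 ≤ (Real.sqrt (2 * K) * ‖φ‖) ^ 2 := by
    rw [mul_pow, Real.sq_sqrt (by positivity)]
    linarith
  exact le_of_sq_le_sq h2 (by positivity)

lemma uniformContinuous_testIncl (T : AngularOp F) (M : Model) :
    UniformContinuous (testIncl T M) := by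
  obtain ⟨C, hC⟩ := testIncl_bound T M
  exact ((testIncl T M).mkContinuous C hC).uniformContinuous

/-- The embedding of `H_i(I_i)` into `H(I_i, 1)`: the continuous extension of the inclusion of the
test functions. -/
def embed (T : AngularOp F) (M : Model) : FormSpace T M → WaveSpace F M :=
  UniformSpace.Completion.extension (testIncl T M)

lemma embed_coe (T : AngularOp F) (M : Model) (φ : TestSpace T M) :
    embed T M (φ : FormSpace T M) = testIncl T M φ :=
  UniformSpace.Completion.extension_coe (uniformContinuous_testIncl T M) φ

/-- The operator `-r⁻¹ (r φ')' - r⁻² T φ + q φ` on test functions. -/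
def hamiltonian (q : ℝ → ℝ) (φ : TestSpace T M) (r : ℝ) : F :=
  -(r⁻¹ • deriv (fun s => s • deriv φ.fn s) r) - (r ^ 2)⁻¹ • T.op (φ.fn r) + q r • φ.fn r

/-- `ψ ∈ H_i(I_i)` solves `H ψ = Λ w ψ` in the sense of distributions, `H` being the operator
`hamiltonian q`: `⟨H φ, ψ⟩ = Λ ⟨w φ, ψ⟩` in `H(I_i, 1)` for all test functions `φ`. -/
def IsEigenpair (q w : ℝ → ℝ) (Λ : ℝ) (ψ : FormSpace T M) : Prop :=
  ∀ φ : TestSpace T M,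
    ∫ r, inner ℂ (hamiltonian q φ r) (embed T M ψ r) ∂(radialMeasure M)
      = (Λ : ℂ) * ∫ r, inner ℂ (w r • φ.fn r) (embed T M ψ r) ∂(radialMeasure M)

end Radial

/-! ## The Hamiltonians -/

namespace Cosmo

open RiemGeom Radial

/-- The data of the model: the dimension `n ≥ 2` of space, the coupling constant `α_M > 0`, the
constant potential `V` and the curvature `κ` of the spatial cross-sections. -/
structure Params where
  n : ℕ
  two_le_n : 2 ≤ n
  αM : ℝ
  αM_pos : 0 < αM
  V : ℝ
  κ : ℝ

/-- `a_0 = 2 n (n - 1) / α_M`. -/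
def Params.a0 (P : Params) : ℝ := 2 * P.n * (P.n - 1) / P.αM

/-- `V̄ = α_M V / (n (n - 1))`. -/
def Params.Vbar (P : Params) : ℝ := P.αM / (P.n * (P.n - 1)) * P.V

/-- `μ̄ = (4 / n²) a_0 μ - (m - 1)² / 4`. -/
def Params.muBar (P : Params) (m : ℕ) (μ : ℝ) : ℝ :=
  4 / (P.n : ℝ) ^ 2 * P.a0 * μ - ((m : ℝ) - 1) ^ 2 / 4

lemma Params.a0_pos (P : Params) : 0 < P.a0 := by
  have h : (2 : ℝ) ≤ P.n := by exact_mod_cast P.two_le_n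
  have := P.αM_pos
  have h2 : 0 < (P.n : ℝ) - 1 := by linarith
  unfold Params.a0
  positivity

/-- `4 a_0 / n²`. -/
def Params.k (P : Params) : ℝ := 4 / (P.n : ℝ) ^ 2 * P.a0

lemma Params.k_pos (P : Params) : 0 < P.k := by
  have h : (2 : ℝ) ≤ P.n := by exact_mod_cast P.two_le_n
  have := P.a0_pos
  unfold Params.k
  positivity

/-- The numbers `μ ≥ 0` with `μ̄ ≤ 0` (the eigenvalues of `-Δ` are nonnegative). -/
abbrev LowEig (P : Params) (m : ℕ) := {μ : ℝ // 0 ≤ μ ∧ P.muBar m μ ≤ 0}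

variable {m : ℕ} {S : Type*} [TopologicalSpace S] [ChartedSpace (EuclideanSpace ℝ (Fin m)) S]
  [IsManifold (𝓡 m) ∞ S] [MeasurableSpace S]

/-- The subspace `H_0 ⊂ L²(S, ℂ)` that is spanned by the eigenspaces `E_μ` of `-Δ` with
`μ̄ ≤ 0`. -/
abbrev H0 (P : Params) (g : Metric m S) : Submodule ℂ (L2 g) :=
  ⨆ μ : LowEig P m, eigenspace g μ.1

lemma ortho (P : Params) (g : Metric m S) (μ ν : LowEig P m) (h : μ ≠ ν) :
    eigenspace g μ.1 ⟂ eigenspace g ν.1 :=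
  Submodule.isOrtho_iff_inner_eq.mpr fun _ hη _ hζ =>
    eigenspace_ortho g (fun e => h (Subtype.ext e)) hη hζ

lemma LowEig.le {P : Params} {m : ℕ} (μ : LowEig P m) :
    μ.1 ≤ ((m : ℝ) - 1) ^ 2 / 4 / P.k := by
  rw [le_div_iff₀ P.k_pos]
  have := μ.2.2
  unfold Params.muBar at this
  unfold Params.k
  linarith

/-- The operator `-Δ` on `H_0`: it is multiplication by `μ` on each `E_μ`. -/
def negLaplacian (P : Params) (g : Metric m S) : H0 P g →L[ℂ] H0 P g :=
  (SpectralOp.linOp (fun μ : LowEig P m => eigenspace g μ.1) (ortho P g) fun μ => μ.1).mkContinuous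
    (((m : ℝ) - 1) ^ 2 / 4 / P.k)
    (SpectralOp.linOp_bound _ _ _ _ (by have := P.k_pos; positivity)
      fun μ => by rw [abs_of_nonneg μ.2.1]; exact μ.le)

lemma negLaplacian_apply (P : Params) (g : Metric m S) (μ : LowEig P m) (η : H0 P g)
    (hη : (η : L2 g) ∈ eigenspace g μ.1) : negLaplacian P g η = (μ.1 : ℂ) • η :=
  SpectralOp.linOp_apply_mem (fun μ : LowEig P m => eigenspace g μ.1) (ortho P g) _ μ η hη

/-- The operator `-(4 / n²) a_0 Δ - (m - 1)² / 4` on `H_0`: it is multiplication by `μ̄ ≤ 0` on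
each `E_μ`. -/
def angularOp (P : Params) (g : Metric m S) : AngularOp (H0 P g) :=
  AngularOp.affine (negLaplacian P g) (4 / (P.n : ℝ) ^ 2 * P.a0) (((m : ℝ) - 1) ^ 2 / 4)
    (fun x y => SpectralOp.linOp_symm _ (ortho P g) _ x y)
    (fun x => by
      have h : (inner ℂ (negLaplacian P g x) x).re ≤ ((m : ℝ) - 1) ^ 2 / 4 / P.k * ‖x‖ ^ 2 :=
        SpectralOp.linOp_re_inner _ (ortho P g) _ _ (fun μ => μ.le) x
      have hk := P.k_pos
      have h2 := mul_le_mul_of_nonneg_left h hk.le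
      have h3 : P.k * (((m : ℝ) - 1) ^ 2 / 4 / P.k * ‖x‖ ^ 2)
          = ((m : ℝ) - 1) ^ 2 / 4 * ‖x‖ ^ 2 := by
        field_simp
      rw [h3] at h2
      exact h2)

/-- The potential of `H_1`: `-(16 / n²) V̄ r² + (16 / n²) κ r^(2(n-2)/n)`. -/
def Params.q1 (P : Params) (r : ℝ) : ℝ :=
  -(16 / (P.n : ℝ) ^ 2 * P.Vbar * r ^ 2)
    + 16 / (P.n : ℝ) ^ 2 * P.κ * r ^ (2 * ((P.n : ℝ) - 2) / P.n)

/-- The right-hand side of the first eigenvalue problem: `(16 / n²) r²`. -/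
def Params.w1 (P : Params) (r : ℝ) : ℝ := 16 / (P.n : ℝ) ^ 2 * r ^ 2

/-- The potential of `H_2`: `(16 / n²) r²`. -/
def Params.q2 (P : Params) (r : ℝ) : ℝ := 16 / (P.n : ℝ) ^ 2 * r ^ 2

/-- The right-hand side of the second eigenvalue problem: `-κ (16 / n²) r^(2(n-2)/n)`. -/
def Params.w2 (P : Params) (r : ℝ) : ℝ :=
  -P.κ * (16 / (P.n : ℝ) ^ 2) * r ^ (2 * ((P.n : ℝ) - 2) / P.n)

end Cosmo
end

/-! Both problems are generalized eigenvalue problems `S ψ = Λ K ψ` in the Hilbert space `V`, the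
completion of the test functions. Integration by parts shows that `⟨H φ, ψ⟩` in `L²(r dr)` is the
scalar product of `V` plus zero order terms. Each zero order term, like the right-hand side, is a
constant times `∫ r p² ⟨φ, ψ⟩` for a multiplier `p`, hence is represented on `V` by the operator `A*
A`, where `A : V → L²(r dr)` is multiplication by `p`. Since test functions are dense in `V`, the
distributional equation is exactly an operator equation (`isEigenpair_iff`).

After a shift of the eigenvalue, `S` is self-adjoint and bounded below by a positive constant, while
`K` is positive, injective and compact. With `R = S^(-1/2)` the pencil becomes the ordinary
eigenvalue problem for the compact positive injective operator `R K R`. Its orthonormal eigenbasis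
is carried back by `R`, and the reciprocals of its eigenvalues tend to infinity
(`Pencil.exists_eigenbasis`). Completeness in `V` follows since `R` is onto, and completeness in
`L²(r dr)` since `V` has dense image there.

Compactness (`isCompactOperator_mulOp`): on functions that vanish at the points of a fine partition
of `(0, R]`, a one dimensional Poincaré inequality makes the integral over `(0, R]` small. The rest
is controlled by the `r³` term of the norm, because `r ^ ((n - 2) / n)` is of lower order than `r`;
on the bounded interval there is no rest. Point evaluations are continuous on `V` and finitely many
of them impose finitely many conditions, provided the angular space is finite dimensional.

Coercivity: for `H_1`, the inequality `∫ r |φ|² ≤ ε ‖φ‖² + (4 ε)⁻¹ ∫ r³ |φ|²` shows that both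
potentials are dominated, up to a small part of the norm, by the weight `r²` of the right-hand side,
so that a shift of the eigenvalue suffices whatever the signs of `V̄` and `κ`. For `H_2` the
potential is a positive multiple of the `r²` in the form, and no shift is needed.

Finally `H_0` must be shown to be nonzero and finite dimensional (`finiteDimensional_H0`). It
contains the constants. Its elements have Dirichlet energy at most `c` times the squared norm. The
manifold is covered by finitely many charts and each is cut into small cubes; if all cube averages
vanish, then the squared norm is at most `ε` times the energy. For `ε c ≤ 1/2` this forces the
function to vanish, so finitely many averages determine an element of `H_0`. -/

open MeasureTheory Set Filter Topology
open scoped Manifold ContDiff ComplexConjugate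

noncomputable section

/-! ## Compact pencils on a Hilbert space -/

namespace Pencil

/-- A family of real numbers with finite sublevel sets can be enumerated in increasing order. -/
lemma exists_equiv_nat_monotone {ι : Type*} [Infinite ι] (f : ι → ℝ)
    (hf : ∀ c, {i | f i ≤ c}.Finite) : ∃ e : ℕ ≃ ι, Monotone (f ∘ e) := by
  have hcount : Countable ι := by
    have h : (⋃ n : ℕ, {i | f i ≤ n}) = univ := by
      ext i
      simpa using exists_nat_ge (f i)
    exact countable_univ_iff.mp (h ▸ countable_iUnion fun n => (hf n).countable)
  obtain ⟨g, hg⟩ := exists_injective_nat ι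
  -- Ties are broken by the injection `g` into `ℕ`. In this lexicographic order every initial
  -- segment lies in a sublevel set of `f` and is finite, and an infinite linear order with finite
  -- initial segments is isomorphic to `ℕ`.
  let _ : LinearOrder ι := LinearOrder.lift' (fun i => toLex (f i, g i)) fun i j h => by
    have := congrArg (fun p => (ofLex p).2) h
    exact hg this
  have hmono : ∀ i j : ι, i ≤ j → f i ≤ f j := by
    intro i j h
    have h' : toLex (f i, g i) ≤ toLex (f j, g j) := h
    rw [Prod.Lex.toLex_le_toLex] at h'
    rcases h' with h' | h'
    · exact h'.le
    · exact h'.1.le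
  have hIic : ∀ j : ι, (Iic j).Finite := fun j => (hf (f j)).subset fun i hi => hmono i j hi
  let _ : LocallyFiniteOrder ι :=
    LocallyFiniteOrder.ofFiniteIcc fun a b => (hIic b).subset fun x hx => hx.2
  obtain ⟨i₀⟩ : Nonempty ι := inferInstance
  obtain ⟨b, -, hb⟩ := (hIic i₀).toFinset.exists_min_image id ⟨i₀, by simp⟩
  let _ : OrderBot ι := 
    { bot := b
      bot_le := fun a => by
        by_cases h : a ≤ i₀
        · exact hb a (by simpa using h)
        · exact (hb i₀ (by simp)).trans (not_le.mp h).le }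
  have _ : NoMaxOrder ι := ⟨fun a => by
    obtain ⟨x, hx⟩ := (hIic a).infinite_compl.nonempty
    exact ⟨x, not_le.mp hx⟩⟩
  let _ : SuccOrder ι := LinearLocallyFiniteOrder.succOrder ι
  let _ : PredOrder ι := LinearLocallyFiniteOrder.predOrder ι
  refine ⟨(orderIsoNatOfLinearSuccPredArch (ι := ι)).symm.toEquiv, fun i j h => hmono _ _ ?_⟩
  exact (orderIsoNatOfLinearSuccPredArch (ι := ι)).symm.monotone h

variable {V W G : Type*} [NormedAddCommGroup V] [InnerProductSpace ℂ V] [CompleteSpace V]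
  [NormedAddCommGroup W] [InnerProductSpace ℂ W] [CompleteSpace W]
  [NormedAddCommGroup G] [NormedSpace ℂ G] [FiniteDimensional ℂ G]

/-- An operator that is arbitrarily small on subspaces of finite codimension is compact. -/
lemma isCompactOperator_of_small (J : V →L[ℂ] W)
    (h : ∀ ε > 0, ∃ (n : ℕ) (E : Fin n → V →L[ℂ] G), ∀ v, (∀ k, E k v = 0) → ‖J v‖ ≤ ε * ‖v‖) :
    IsCompactOperator J := by
  have hcl : IsClosed {f : V →L[ℂ] W | IsCompactOperator f} := isClosed_setOfPred_isCompactOperator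
  have hmem : J ∈ closure {f : V →L[ℂ] W | IsCompactOperator f} := by
    rw [Metric.mem_closure_iff]
    intro ε hε
    obtain ⟨n, E, hE⟩ := h (ε / 2) (by positivity)
    let E' : V →L[ℂ] (Fin n → G) := ContinuousLinearMap.pi E
    -- On the common kernel `U` of the conditions `J` has norm at most `ε / 2`, and `Uᗮ` is finite
    -- dimensional because the conditions are injective on it. So `J` composed with the projection
    -- onto `Uᗮ` is compact and within `ε` of `J`, and compact operators are closed in norm.
    let U : Submodule ℂ V := E'.toLinearMap.ker
    have hUc : IsClosed (U : Set V) := E'.isClosed_ker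
    have _ : CompleteSpace U := hUc.completeSpace_coe
    have _ : FiniteDimensional ℂ Uᗮ := by
      refine FiniteDimensional.of_injective (E'.toLinearMap ∘ₗ Uᗮ.subtype) ?_
      rw [← LinearMap.ker_eq_bot, LinearMap.ker_eq_bot']
      intro x hx
      have h1 : (x : V) ∈ U := hx
      have h2 : (x : V) ∈ U ⊓ Uᗮ := ⟨h1, x.2⟩
      rw [Submodule.inf_orthogonal_eq_bot] at h2
      exact Subtype.ext ((Submodule.mem_bot ℂ).mp h2)
    have _ : ProperSpace Uᗮ := FiniteDimensional.proper ℂ _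
    refine ⟨(J ∘L Uᗮ.subtypeL) ∘L Uᗮ.orthogonalProjectionOnto, ?_, ?_⟩
    · exact (isCompactOperator_of_locallyCompactSpace_rng (J ∘L Uᗮ.subtypeL)).comp_clm
        Uᗮ.orthogonalProjectionOnto
    · rw [dist_eq_norm]
      refine lt_of_le_of_lt (ContinuousLinearMap.opNorm_le_bound _ (by positivity) ?_)
        (half_lt_self hε)
      intro v
      have e : (J - (J ∘L Uᗮ.subtypeL) ∘L Uᗮ.orthogonalProjectionOnto) v
          = J (U.orthogonalProjectionOnto v) := by
        have h1 := U.starProjection_add_starProjection_orthogonal v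
        have h2 := congrArg J h1
        rw [map_add] at h2
        simp only [sub_apply, ContinuousLinearMap.comp_apply, Submodule.subtypeL_apply]
        rw [sub_eq_iff_eq_add]
        exact h2.symm
      rw [e]
      refine (hE _ fun k => ?_).trans ?_
      · have : ((U.orthogonalProjectionOnto v : U) : V) ∈ U := Subtype.mem _
        exact congrFun (show E' _ = 0 from this) k
      · gcongr
        exact U.norm_orthogonalProjectionOnto_apply_le v
  rwa [hcl.closure_eq] at hmem

/-- The orthonormal eigenvectors of a compact operator for eigenvalues away from `0` are finite in
number. -/
lemma finite_orthonormal_eigenvectors {V ι : Type*} [NormedAddCommGroup V]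
    [InnerProductSpace ℂ V] {T : V →L[ℂ] V} (hT : IsCompactOperator T) {b : ι → V}
    (hb : Orthonormal ℂ b) {μ : ι → ℂ} (hμ : ∀ i, T (b i) = μ i • b i) {ε : ℝ}
    (hε : 0 < ε) : {i | ε ≤ ‖μ i‖}.Finite := by
  by_contra hinf
  have hinf : {i | ε ≤ ‖μ i‖}.Infinite := hinf
  let s := hinf.natEmbedding
  have hK := hT.isCompact_closure_image_closedBall 1
  have hx : ∀ n, T (b (s n)) ∈ closure (T '' Metric.closedBall 0 1) := fun n =>
    subset_closure ⟨b (s n), by simp [hb.1], rfl⟩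
  obtain ⟨a, -, φ, hφ, ha⟩ := hK.tendsto_subseq hx
  have hc := ha.cauchySeq
  rw [Metric.cauchySeq_iff'] at hc
  obtain ⟨N, hN⟩ := hc ε hε
  have h1 := hN (N + 1) (by omega)
  have hne : (s (φ (N + 1)) : ι) ≠ s (φ N) := fun h => by
    have h2 := hφ.injective (s.injective (Subtype.ext h))
    omega
  simp only [Function.comp_apply, dist_eq_norm, hμ] at h1
  -- By Pythagoras, images of different basis vectors are at distance at least `ε`, so that no
  -- subsequence of them is Cauchy.
  have h2 : ‖μ (s (φ (N + 1))) • b (s (φ (N + 1))) - μ (s (φ N)) • b (s (φ N))‖ ^ 2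
      = ‖μ (s (φ (N + 1)))‖ ^ 2 + ‖μ (s (φ N))‖ ^ 2 := by
    rw [@norm_sub_sq ℂ]
    rw [inner_smul_left, inner_smul_right, hb.2 hne]
    simp [norm_smul, hb.1]
  have h3 : ε ^ 2 ≤ ‖μ (s (φ (N + 1)))‖ ^ 2 := by
    have := (s (φ (N + 1))).2
    have this : ε ≤ ‖μ (s (φ (N + 1)))‖ := this
    gcongr
  have h4 := pow_lt_pow_left₀ h1 (norm_nonneg _) two_ne_zero
  have h5 := sq_nonneg ‖μ (s (φ N))‖
  linarith

open Module.End in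
/-- The spectral theorem for an injective positive compact operator, with the eigenvalues in
decreasing order. -/
lemma exists_orthonormal_eigenbasis (hV : ¬ FiniteDimensional ℂ V) {T : V →L[ℂ] V}
    (hT : T.IsPositive) (hTc : IsCompactOperator T) (hTi : Function.Injective T) :
    ∃ (Λ : ℕ → ℝ) (b : ℕ → V), Orthonormal ℂ b ∧ (∀ j, b j = (Λ j : ℂ) • T (b j)) ∧
      (∀ (l : ℝ) (v : V), v = (l : ℂ) • T v → v ∈ Submodule.span ℂ (b '' {j | Λ j = l})) ∧
      Monotone Λ ∧ Tendsto Λ atTop atTop ∧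
      (Submodule.span ℂ (range b)).topologicalClosure = ⊤ := by
  let E : ℂ → Submodule ℂ V := fun μ => eigenspace (T : Module.End ℂ V) μ
  have hE : ∀ {μ v}, v ∈ E μ ↔ T v = μ • v := fun {μ v} => mem_eigenspace_iff
  have hfin : ∀ μ : {μ : ℂ // μ ≠ 0}, FiniteDimensional ℂ (E μ) := fun μ =>
    ContinuousLinearMap.finite_dimensional_eigenspace hTc μ.1 μ.2
  -- The index set runs over all nonzero complex numbers; those that are not eigenvalues contribute
  -- an empty fibre. Eigenvalues are recognized as positive reals only afterwards.
  let ι := Σ μ : {μ : ℂ // μ ≠ 0}, Fin (Module.finrank ℂ (E μ))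
  let β : ∀ μ : {μ : ℂ // μ ≠ 0}, OrthonormalBasis (Fin (Module.finrank ℂ (E μ))) ℂ (E μ) :=
    fun μ => stdOrthonormalBasis ℂ (E μ)
  let b : ι → V := fun i => β i.1 i.2
  have hbE : ∀ i : ι, T (b i) = (i.1 : ℂ) • b i := fun i => hE.mp (β i.1 i.2).2
  have hb : Orthonormal ℂ b := by
    have h1 := hT.isSymmetric.orthogonalFamily_eigenspaces
    have h2 := h1.comp (γ := {μ : ℂ // μ ≠ 0}) Subtype.val_injective
    exact h2.orthonormal_sigma_orthonormal fun μ => (β μ).orthonormal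
  have hspan : ∀ μ : {μ : ℂ // μ ≠ 0}, E μ ≤ Submodule.span ℂ (b '' {i | i.1 = μ}) := by
    intro μ v hv
    have h1 : (⟨v, hv⟩ : E μ) ∈ Submodule.span ℂ (range (β μ)) := by
      have := (β μ).toBasis.span_eq
      rw [OrthonormalBasis.coe_toBasis] at this
      rw [this]
      trivial
    have h2 := Submodule.mem_map_of_mem (f := (E μ).subtype) h1
    rw [Submodule.map_span] at h2
    refine Submodule.span_mono ?_ h2
    rintro _ ⟨_, ⟨k, rfl⟩, rfl⟩
    exact ⟨⟨μ, k⟩, rfl, rfl⟩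
  have hpos : ∀ i : ι, 0 < (i.1 : ℂ).re ∧ ((i.1 : ℂ).re : ℂ) = i.1 := by
    intro i
    have hne : b i ≠ 0 := hb.ne_zero i
    have hev : HasEigenvalue (T : Module.End ℂ V) i.1 :=
      hasEigenvalue_of_hasEigenvector ⟨hE.mpr (hbE i), hne⟩
    have h1 := hT.isSymmetric.conj_eigenvalue_eq_self hev
    have h2 : ((i.1 : ℂ).re : ℂ) = i.1 := Complex.conj_eq_iff_re.mp h1
    refine ⟨?_, h2⟩
    have h3 := hT.re_inner_nonneg_right (b i)
    rw [hbE i, inner_smul_right, inner_self_eq_norm_sq_to_K, hb.1] at h3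
    have h4 : 0 ≤ (i.1 : ℂ).re := by simpa using h3
    refine lt_of_le_of_ne h4 fun h => i.1.2 ?_
    rw [← h2, ← h]
    simp
  have hdense : (Submodule.span ℂ (range b)).topologicalClosure = ⊤ := by
    rw [Submodule.topologicalClosure_eq_top_iff, eq_bot_iff,
      ← ContinuousLinearMap.orthogonalComplement_iSup_eigenspaces_eq_bot hTc hT.isSymmetric]
    refine Submodule.orthogonal_le (iSup_le fun μ => ?_)
    -- Injectivity excludes the eigenvalue `0`, so the eigenvectors collected in `b` already span
    -- all eigenspaces.
    by_cases h : μ = 0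
    · intro v hv
      have h1 : T v = μ • v := hE.mp hv
      rw [h, zero_smul] at h1
      rw [hTi (h1.trans (map_zero T).symm)]
      exact Submodule.zero_mem _
    · exact (hspan ⟨μ, h⟩).trans (Submodule.span_mono (image_subset_range _ _))
  have hinf : Infinite ι := by
    by_contra h
    have h : Finite ι := not_infinite_iff_finite.mp h
    have _ : FiniteDimensional ℂ (Submodule.span ℂ (range b)) :=
      FiniteDimensional.span_of_finite ℂ (finite_range b)
    have h1 : (Submodule.span ℂ (range b)).topologicalClosure = Submodule.span ℂ (range b) :=
      IsClosed.submodule_topologicalClosure_eq (Submodule.closed_of_finiteDimensional _)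
    rw [hdense] at h1
    refine hV (Module.finite_def.mpr ?_)
    rw [h1]
    exact Submodule.fg_span (finite_range b)
  -- The reciprocals are enumerated: `μ⁻¹ ≤ c` with `c > 0` means `μ ≥ c⁻¹`, which compactness
  -- allows for only finitely many orthonormal eigenvectors.
  obtain ⟨e, he⟩ := exists_equiv_nat_monotone (fun i : ι => (i.1 : ℂ).re⁻¹) fun c => by
    rcases le_or_gt c 0 with hc | hc
    · refine finite_empty.subset fun i hi => ?_
      have h1 : (i.1 : ℂ).re⁻¹ ≤ c := hi
      have h2 := inv_pos.mpr (hpos i).1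
      linarith
    · refine (finite_orthonormal_eigenvectors hTc hb hbE (inv_pos.mpr hc)).subset fun i hi => ?_
      have h1 : (i.1 : ℂ).re⁻¹ ≤ c := hi
      have h2 := inv_le_of_inv_le₀ (hpos i).1 h1
      exact h2.trans (Complex.re_le_norm _)
  refine ⟨fun j => (e j).1.1.re⁻¹, b ∘ e, hb.comp e e.injective, fun j => ?_, ?_, he, ?_, ?_⟩
  · simp only [Function.comp_apply, hbE, smul_smul, Complex.ofReal_inv, (hpos (e j)).2]
    rw [inv_mul_cancel₀ (e j).1.2, one_smul]
  · intro l v hv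
    by_cases hl : l = 0
    · rw [hl, Complex.ofReal_zero, zero_smul] at hv
      rw [hv]
      exact Submodule.zero_mem _
    · have hl' : ((l : ℂ))⁻¹ ≠ 0 := inv_ne_zero (by exact_mod_cast hl)
      have h1 : v ∈ E (l : ℂ)⁻¹ := by
        rw [hE]
        conv_rhs => rw [hv]
        rw [smul_smul, inv_mul_cancel₀ (by exact_mod_cast hl), one_smul]
      refine Submodule.span_mono ?_ (hspan ⟨_, hl'⟩ h1)
      rintro _ ⟨i, hi, rfl⟩
      refine ⟨e.symm i, ?_, by simp⟩
      have hi : i.1 = ⟨_, hl'⟩ := hi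
      have h2 : (i.1 : ℂ) = ((l⁻¹ : ℝ) : ℂ) := by rw [hi]; simp
      change ((e (e.symm i)).1 : ℂ).re⁻¹ = l
      rw [e.apply_symm_apply, h2, Complex.ofReal_re, inv_inv]
  · refine tendsto_atTop_atTop_of_monotone he fun c => ?_
    by_contra! hcon
    -- Passing from `c` to `max c 1` keeps the threshold `(max c 1)⁻¹` positive for every `c`.
    have hsub : (univ : Set ℕ) ⊆ e ⁻¹' {i | (max c 1)⁻¹ ≤ ‖(i.1 : ℂ)‖} := by
      intro j _
      have h1 : ((e j).1 : ℂ).re⁻¹ < max c 1 := (hcon j).trans_le (le_max_left _ _)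
      have h2 := inv_le_of_inv_le₀ (hpos (e j)).1 h1.le
      exact h2.trans (Complex.re_le_norm _)
    exact infinite_univ (((finite_orthonormal_eigenvectors hTc hb hbE
      (inv_pos.mpr (lt_max_of_lt_right one_pos))).preimage e.injective.injOn).subset hsub)
  · rw [range_comp, e.range_eq_univ, image_univ, hdense]

/-- The spectral theorem for the pencil `S v = Λ K v`. -/
theorem exists_eigenbasis (hV : ¬ FiniteDimensional ℂ V) (S K : V →L[ℂ] V)
    (hS : IsSelfAdjoint S) {c : ℝ} (hc : 0 < c) (hSc : ∀ v, c * ‖v‖ ^ 2 ≤ (inner ℂ (S v) v).re)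
    (hK : K.IsPositive) (hKc : IsCompactOperator K) (hKi : Function.Injective K) :
    ∃ (Λ : ℕ → ℝ) (ψ : ℕ → V), (∀ j, ψ j ≠ 0 ∧ S (ψ j) = (Λ j : ℂ) • K (ψ j)) ∧
      LinearIndependent ℂ ψ ∧
      (∀ (l : ℝ) (χ : V), S χ = (l : ℂ) • K χ → χ ∈ Submodule.span ℂ (ψ '' {j | Λ j = l})) ∧
      Monotone Λ ∧ Tendsto Λ atTop atTop ∧
      (Submodule.span ℂ (range ψ)).topologicalClosure = ⊤ := by
  have hle : algebraMap ℝ (V →L[ℂ] V) c ≤ S := by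
    rw [ContinuousLinearMap.le_def, ContinuousLinearMap.isPositive_def]
    refine ⟨?_, fun v => ?_⟩
    · refine ContinuousLinearMap.isSelfAdjoint_iff_isSymmetric.mp (hS.sub ?_)
      exact IsSelfAdjoint.algebraMap _ (IsSelfAdjoint.all c)
    · have := hSc v
      have e : (inner ℂ v v : ℂ).re = ‖v‖ ^ 2 := inner_self_eq_norm_sq (𝕜 := ℂ) v
      have e2 : (algebraMap ℝ (V →L[ℂ] V) c) v = (c : ℂ) • v := by
        rw [Algebra.algebraMap_eq_smul_one]
        simp
      rw [ContinuousLinearMap.reApplyInnerSelf_apply, sub_apply, e2, inner_sub_left,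
        inner_smul_left]
      simp only [Complex.conj_ofReal, map_sub, RCLike.re_to_complex, Complex.re_ofReal_mul, e]
      linarith
  have hpos : IsStrictlyPositive S := by
    refine IsStrictlyPositive.of_le ?_ hle
    refine IsStrictlyPositive.iff_of_unital.mpr ⟨?_, (IsUnit.mk0 c hc.ne').map _⟩
    rw [Algebra.algebraMap_eq_smul_one]
    exact smul_nonneg hc.le zero_le_one
  -- Here `u` is the square root of `S`, invertible because `S ≥ c > 0`; its inverse is `R =
  -- S^(-1/2)`.
  obtain ⟨u, hu⟩ := hpos.isUnit_cfcSqrt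
  have husa : IsSelfAdjoint (u : V →L[ℂ] V) := by
    rw [hu]
    exact (CFC.sqrt_nonneg S).isSelfAdjoint
  have huS : (u : V →L[ℂ] V) * u = S := by
    rw [hu]
    exact CFC.sqrt_mul_sqrt_self S hpos.nonneg
  let R : V →L[ℂ] V := ↑u⁻¹
  have hRu : ∀ v, R ((u : V →L[ℂ] V) v) = v := fun v => by
    change ((↑u⁻¹ : V →L[ℂ] V) * u) v = v
    rw [Units.inv_mul]
    rfl
  have huR : ∀ v, (u : V →L[ℂ] V) (R v) = v := fun v => by
    change ((u : V →L[ℂ] V) * ↑u⁻¹) v = v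
    rw [Units.mul_inv]
    rfl
  have hRi : Function.Injective R := Function.LeftInverse.injective huR
  have hRsa : IsSelfAdjoint R := by
    have h : star u = u := Units.ext husa
    have h2 : star u⁻¹ = u⁻¹ := by rw [star_inv, h]
    exact congrArg Units.val h2
  let T : V →L[ℂ] V := R ∘L K ∘L R
  have hTpos : T.IsPositive := by
    have := hK.conj_adjoint R
    rwa [ContinuousLinearMap.isSelfAdjoint_iff'.mp hRsa] at this
  have hTc : IsCompactOperator T := (hKc.comp_clm R).clm_comp R
  have hTi : Function.Injective T := hRi.comp (hKi.comp hRi)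
  -- Substituting `R v` for the unknown and applying `R` to the equation turns the pencil into the
  -- eigenvalue equation of `R K R`.
  have key : ∀ (l : ℝ) (v : V), S (R v) = (l : ℂ) • K (R v) ↔ v = (l : ℂ) • T v := by
    intro l v
    rw [← huS, mul_apply_eq_comp, huR]
    constructor
    · intro h
      have := congrArg R h
      rwa [hRu, map_smul] at this
    · intro h
      apply hRi
      rw [hRu, map_smul]
      exact h
  obtain ⟨Λ, b, hb, h1, h2, h3, h4, h5⟩ := exists_orthonormal_eigenbasis hV hTpos hTc hTi
  refine ⟨Λ, fun j => R (b j), fun j => ⟨?_, (key _ _).mpr (h1 j)⟩, ?_, ?_, h3, h4, ?_⟩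
  · exact fun h => hb.ne_zero j (hRi (h.trans (map_zero R).symm))
  · exact hb.linearIndependent.map' R.toLinearMap (LinearMap.ker_eq_bot.mpr hRi)
  · intro l χ hχ
    rw [← hRu χ] at hχ
    have h6 := h2 l _ ((key _ _).mp hχ)
    have h7 := Submodule.mem_map_of_mem (f := R.toLinearMap) h6
    rw [Submodule.map_span, image_image] at h7
    have h8 : R.toLinearMap ((u : V →L[ℂ] V) χ) = χ := hRu χ
    rw [h8] at h7
    exact h7
  -- The `R (b j)` are not orthonormal in general; completeness survives because `R` is continuous
  -- and onto.
  · have hd : DenseRange R := (Function.RightInverse.surjective hRu).denseRange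
    have h6 := hd.topologicalClosure_map_submodule h5
    rw [Submodule.map_span, ← range_comp] at h6
    exact h6

end Pencil

/-! ## Charts of a Riemannian manifold -/

namespace RiemGeom

variable {m : ℕ} {S : Type*} [TopologicalSpace S] [ChartedSpace (EuclideanSpace ℝ (Fin m)) S]

lemma contMDiff_const_smul {f : S → ℂ} (hf : ContMDiff (𝓡 m) 𝓘(ℝ, ℂ) ∞ f) (c : ℂ) :
    ContMDiff (𝓡 m) 𝓘(ℝ, ℂ) ∞ (c • f) :=
  ((contDiff_const.mul contDiff_id).contMDiff (f := fun w : ℂ => c * w)).comp hf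

variable [IsManifold (𝓡 m) ∞ S]

/-- The model space `ℝ^m`. -/
abbrev Eu (m : ℕ) := EuclideanSpace ℝ (Fin m)

/-- The standard basis of `ℝ^m`. -/
abbrev stdBasis (m : ℕ) : Module.Basis (Fin m) ℝ (Eu m) := (EuclideanSpace.basisFun (Fin m) ℝ).toBasis

lemma stdBasis_apply (i : Fin m) : stdBasis m i = basisVec m i := by
  simp [stdBasis, basisVec]

/-- The differential of the inverse of the chart around `x`. -/
def chartDeriv (x : S) (z : Eu m) : Eu m →L[ℝ] Eu m :=
  mfderiv (𝓡 m) (𝓡 m) (chartAt (Eu m) x).symm z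

/-- The metric at `y` as a bilinear form on `ℝ^m`. -/
def metricForm (g : Metric m S) (y : S) : LinearMap.BilinForm ℝ (Eu m) :=
  LinearMap.mk₂ ℝ (fun v w : Eu m => g.inner y (show TangentSpace (𝓡 m) y from v)
      (show TangentSpace (𝓡 m) y from w))
    (fun u v w => by
      have := congrArg (fun L => L w) ((g.inner y).map_add u v)
      exact this)
    (fun c v w => by
      have := congrArg (fun L => L w) ((g.inner y).map_smul c v)
      exact this)
    (fun u v w => (g.inner y u).map_add v w)
    (fun c v w => (g.inner y v).map_smul c w)

lemma metricForm_pos (g : Metric m S) (y : S) {v : Eu m} (hv : v ≠ 0) :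
    0 < metricForm g y v v := g.pos y v hv

lemma metricForm_symm (g : Metric m S) (y : S) (v w : Eu m) :
    metricForm g y v w = metricForm g y w v := g.symm y v w

lemma mdifferentiableAt_chart_symm (x : S) {z : Eu m} (hz : z ∈ (chartAt (Eu m) x).target) :
    MDifferentiableAt (𝓡 m) (𝓡 m) (chartAt (Eu m) x).symm z :=
  (mdifferentiable_chart (I := 𝓡 m) x).mdifferentiableAt_symm hz

lemma chartDeriv_injective (x : S) {z : Eu m} (hz : z ∈ (chartAt (Eu m) x).target) :
    Function.Injective (chartDeriv x z) :=
  (mdifferentiable_chart (I := 𝓡 m) x).symm.mfderiv_injective hz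

/-- The matrix of the differential of the inverse of the chart. -/
def chartJac (x : S) (z : Eu m) : Matrix (Fin m) (Fin m) ℝ :=
  LinearMap.toMatrix (stdBasis m) (stdBasis m) (chartDeriv x z : Eu m →ₗ[ℝ] Eu m)

lemma gram_eq (g : Metric m S) (y : S) :
    gram g y = LinearMap.BilinForm.toMatrix (stdBasis m) (metricForm g y) := by
  ext i j
  rw [LinearMap.BilinForm.toMatrix_apply, stdBasis_apply, stdBasis_apply]
  rfl

lemma chartGram_eq_toMatrix (g : Metric m S) (x : S) (z : Eu m) :
    chartGram g x z = LinearMap.BilinForm.toMatrix (stdBasis m)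
      ((metricForm g ((chartAt (Eu m) x).symm z)).comp (chartDeriv x z : Eu m →ₗ[ℝ] Eu m)
        (chartDeriv x z : Eu m →ₗ[ℝ] Eu m)) := by
  ext i j
  rw [LinearMap.BilinForm.toMatrix_apply, stdBasis_apply, stdBasis_apply]
  rfl

/-- The matrix `gram` at a point refers to the preferred chart at that very point, which may jump
from point to point. This congruence passes to one fixed chart, in which continuity and integration
make sense. -/
lemma chartGram_eq (g : Metric m S) (x : S) (z : Eu m) :
    chartGram g x z
      = (chartJac x z).transpose * gram g ((chartAt (Eu m) x).symm z) * chartJac x z := by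
  rw [chartGram_eq_toMatrix, LinearMap.BilinForm.toMatrix_comp (stdBasis m) (stdBasis m), gram_eq]
  rfl

lemma posDef_toMatrix {B : LinearMap.BilinForm ℝ (Eu m)} (hs : ∀ v w, B v w = B w v)
    (hp : ∀ v, v ≠ 0 → 0 < B v v) : (LinearMap.BilinForm.toMatrix (stdBasis m) B).PosDef := by
  refine Matrix.PosDef.of_dotProduct_mulVec_pos ?_ fun v hv => ?_
  · ext i j
    simpa [LinearMap.BilinForm.toMatrix_apply] using hs _ _
  · have h1 := LinearMap.BilinForm.apply_eq_dotProduct_toMatrix_mulVec (stdBasis m) B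
      ((stdBasis m).equivFun.symm v) ((stdBasis m).equivFun.symm v)
    have h2 : ⇑((stdBasis m).repr ((stdBasis m).equivFun.symm v)) = v :=
      (stdBasis m).equivFun.apply_symm_apply v
    rw [h2] at h1
    simp only [star_trivial]
    rw [← h1]
    exact hp _ (by simpa using hv)

lemma posDef_chartGram (g : Metric m S) (x : S) {z : Eu m} (hz : z ∈ (chartAt (Eu m) x).target) :
    (chartGram g x z).PosDef := by
  rw [chartGram_eq_toMatrix]
  refine posDef_toMatrix (fun v w => metricForm_symm g _ _ _) fun v hv => metricForm_pos g _ ?_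
  intro h
  exact hv (chartDeriv_injective x hz (h.trans (map_zero _).symm))

/-- The tangent map of the inverse chart carries the constant coordinate fields to continuous
sections of the tangent bundle, and the metric is a continuous section of bilinear forms that can be
evaluated on them. -/
lemma continuousOn_chartGram_apply (g : Metric m S) (x : S) (i j : Fin m) :
    ContinuousOn (fun z => chartGram g x z i j) (chartAt (Eu m) x).target := by
  have hT : IsOpen (chartAt (Eu m) x).target := (chartAt (Eu m) x).open_target
  have h1 : ContMDiffOn (𝓡 m) (𝓡 m) ∞ (chartAt (Eu m) x).symm (chartAt (Eu m) x).target :=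
    contMDiffOn_chart_symm
  have h2 := h1.contMDiffOn_tangentMapWithin (m := 0) (by simp) hT.uniqueMDiffOn
  have h3 : ∀ k : Fin m, ContMDiffOn (𝓡 m) (𝓡 m).tangent 0
      (fun z : Eu m => (⟨(chartAt (Eu m) x).symm z, chartDeriv x z (basisVec m k)⟩ :
        TangentBundle (𝓡 m) S)) (chartAt (Eu m) x).target := by
    intro k
    have h4 : ContMDiff (𝓡 m) (𝓡 m).tangent 0
        (fun z : Eu m => (⟨z, basisVec m k⟩ : TangentBundle (𝓡 m) (Eu m))) := by
      intro z
      exact contMDiffAt_vectorSpace_iff_contDiffAt.mpr contDiffAt_const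
    have h5 := h2.comp h4.contMDiffOn (s := (chartAt (Eu m) x).target) (fun z hz => hz)
    refine h5.congr fun z hz => ?_
    simp only [Function.comp_apply, tangentMapWithin]
    rw [mfderivWithin_of_isOpen hT hz]
    rfl
  have h6 : ContMDiffOn (𝓡 m) ((𝓡 m).prod 𝓘(ℝ)) 0
      (fun z : Eu m => Bundle.TotalSpace.mk' ℝ (E := Bundle.Trivial S ℝ)
        ((chartAt (Eu m) x).symm z) (g.inner ((chartAt (Eu m) x).symm z)
          (chartDeriv x z (basisVec m i)) (chartDeriv x z (basisVec m j))))
      (chartAt (Eu m) x).target := by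
    refine ContMDiffOn.clm_bundle_apply₂ (F₁ := Eu m) (F₂ := Eu m) ?_ (h3 i) (h3 j)
    exact (g.contMDiff.of_le (by simp)).comp_contMDiffOn (h1.of_le (by simp))
  intro z hz
  have h7 := h6 z hz
  simp only [Bundle.contMDiffWithinAt_totalSpace] at h7
  exact h7.2.continuousWithinAt

lemma continuousOn_chartGram (g : Metric m S) (x : S) :
    ContinuousOn (chartGram g x) (chartAt (Eu m) x).target :=
  continuousOn_pi.mpr fun i => continuousOn_pi.mpr fun j => continuousOn_chartGram_apply g x i j

lemma continuousOn_det_chartGram (g : Metric m S) (x : S) :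
    ContinuousOn (fun z => (chartGram g x z).det) (chartAt (Eu m) x).target :=
  (continuous_id.matrix_det).comp_continuousOn (continuousOn_chartGram g x)

lemma continuousOn_inv_chartGram (g : Metric m S) (x : S) (i j : Fin m) :
    ContinuousOn (fun z => (chartGram g x z)⁻¹ i j) (chartAt (Eu m) x).target := by
  have h : ∀ z, (chartGram g x z)⁻¹ i j
      = ((chartGram g x z).det)⁻¹ * (chartGram g x z).adjugate i j := fun z => by
    rw [Matrix.inv_def, Ring.inverse_eq_inv', Matrix.smul_apply, smul_eq_mul]
  simp only [h]
  refine ContinuousOn.mul ((continuousOn_det_chartGram g x).inv₀ fun z hz =>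
    (posDef_chartGram g x hz).det_pos.ne') ?_
  exact (continuous_id.matrix_adjugate.matrix_elem i j).comp_continuousOn
    (continuousOn_chartGram g x)

/-- The partial derivatives of a function in a chart. -/
def chartPartial (f : S → ℂ) (x : S) (z : Eu m) (i : Fin m) : ℂ :=
  fderiv ℝ (f ∘ (chartAt (Eu m) x).symm) z (basisVec m i)

lemma chartPartial_eq {f : S → ℂ} (x : S) {z : Eu m} (hz : z ∈ (chartAt (Eu m) x).target)
    (hf : MDifferentiableAt (𝓡 m) 𝓘(ℝ, ℂ) f ((chartAt (Eu m) x).symm z)) (i : Fin m) :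
    chartPartial f x z i
      = ∑ k, (chartJac x z k i : ℂ) * partialDeriv f ((chartAt (Eu m) x).symm z) k := by
  have h1 := mfderiv_comp z hf (mdifferentiableAt_chart_symm x hz)
  rw [mfderiv_eq_fderiv] at h1
  have h2 : chartPartial f x z i = (mfderiv (𝓡 m) 𝓘(ℝ, ℂ) f ((chartAt (Eu m) x).symm z) :
      Eu m →L[ℝ] ℂ) (chartDeriv x z (basisVec m i)) :=
    congrArg (fun L : Eu m →L[ℝ] ℂ => L (basisVec m i)) h1
  have h3 : chartDeriv x z (basisVec m i) = ∑ k, chartJac x z k i • basisVec m k := by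
    rw [← (stdBasis m).sum_repr (chartDeriv x z (basisVec m i))]
    refine Finset.sum_congr rfl fun k _ => ?_
    rw [chartJac, LinearMap.toMatrix_apply, stdBasis_apply, stdBasis_apply]
    rfl
  have h4 : ∀ L : Eu m →L[ℝ] ℂ, L (∑ k, chartJac x z k i • basisVec m k)
      = ∑ k, (chartJac x z k i : ℂ) * L (basisVec m k) := fun L => by
    rw [map_sum]
    exact Finset.sum_congr rfl fun k _ => by rw [map_smul, Complex.real_smul]
  rw [h2, h3]
  exact h4 _

/-- With `J` the matrix of the differential, partial derivatives transform by `J` and the Gram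
matrix becomes `G = Jᵀ g J`. Hence `J G⁻¹ Jᵀ = g⁻¹`, and the pairing of gradients is independent of
the chart. -/
lemma gradInner_chart (g : Metric m S) {f h : S → ℂ} (x : S) {z : Eu m}
    (hz : z ∈ (chartAt (Eu m) x).target)
    (hf : MDifferentiableAt (𝓡 m) 𝓘(ℝ, ℂ) f ((chartAt (Eu m) x).symm z))
    (hh : MDifferentiableAt (𝓡 m) 𝓘(ℝ, ℂ) h ((chartAt (Eu m) x).symm z)) :
    gradInner g f h ((chartAt (Eu m) x).symm z)
      = ∑ i, ∑ j, (((chartGram g x z)⁻¹ i j : ℝ) : ℂ) * chartPartial f x z i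
          * conj (chartPartial h x z j) := by
  have key : ∀ (N : Matrix (Fin m) (Fin m) ℝ) (p q : Fin m → ℂ),
      ∑ i, ∑ j, ((N i j : ℝ) : ℂ) * p i * q j = dotProduct p ((N.map Complex.ofReal).mulVec q) := by
    intro N p q
    simp only [dotProduct, Matrix.mulVec, Matrix.map_apply, Finset.mul_sum]
    exact Finset.sum_congr rfl fun i _ => Finset.sum_congr rfl fun j _ => by ring
  set y := (chartAt (Eu m) x).symm z
  set J := chartJac x z with hJ
  have e1 : chartPartial f x z = Matrix.vecMul (partialDeriv f y) (J.map Complex.ofReal) := by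
    funext i
    rw [chartPartial_eq x hz hf]
    simp [Matrix.vecMul, dotProduct, mul_comm, J, y]
  have e2 : (fun j => conj (chartPartial h x z j))
      = (J.transpose.map Complex.ofReal).mulVec fun j => conj (partialDeriv h y j) := by
    funext i
    rw [chartPartial_eq x hz hh]
    simp [Matrix.mulVec, dotProduct, J, y]
  have hdet : IsUnit (chartGram g x z).det := (posDef_chartGram g x hz).det_pos.ne'.isUnit
  have hG : chartGram g x z = J.transpose * gram g y * J := chartGram_eq g x z
  have hJd : IsUnit J.det := by
    rw [hG, Matrix.det_mul] at hdet
    exact isUnit_of_mul_isUnit_right hdet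
  have hJt : IsUnit J.transpose.det := by rwa [Matrix.det_transpose]
  have e3 : J * (chartGram g x z)⁻¹ * J.transpose = (gram g y)⁻¹ := by
    rw [hG, Matrix.mul_inv_rev, Matrix.mul_inv_rev, ← Matrix.mul_assoc, ← Matrix.mul_assoc,
      Matrix.mul_nonsing_inv _ hJd, Matrix.one_mul, Matrix.mul_assoc,
      Matrix.nonsing_inv_mul _ hJt, Matrix.mul_one]
  rw [key _ _ fun j => conj (chartPartial h x z j), e1, e2, gradInner,
    key _ _ fun j => conj (partialDeriv h y j), ← e3]
  have e4 : (J * (chartGram g x z)⁻¹ * J.transpose).map Complex.ofReal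
      = J.map Complex.ofReal * ((chartGram g x z)⁻¹).map Complex.ofReal
        * J.transpose.map Complex.ofReal := by
    have h1 := Matrix.map_mul (L := J * (chartGram g x z)⁻¹) (M := J.transpose)
      (f := Complex.ofRealHom)
    have h2 := Matrix.map_mul (L := J) (M := (chartGram g x z)⁻¹) (f := Complex.ofRealHom)
    rw [h2] at h1
    exact h1
  rw [e4, ← Matrix.mulVec_mulVec, ← Matrix.mulVec_mulVec, Matrix.dotProduct_mulVec]

lemma contDiffOn_chart {f : S → ℂ} (hf : ContMDiff (𝓡 m) 𝓘(ℝ, ℂ) ∞ f) (x : S) :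
    ContDiffOn ℝ ∞ (f ∘ (chartAt (Eu m) x).symm) (chartAt (Eu m) x).target :=
  contMDiffOn_iff_contDiffOn.mp
    (hf.comp_contMDiffOn (contMDiffOn_chart_symm (I := 𝓡 m) (n := ∞) (x := x)))

lemma continuousOn_chartPartial {f : S → ℂ} (hf : ContMDiff (𝓡 m) 𝓘(ℝ, ℂ) ∞ f) (x : S)
    (i : Fin m) : ContinuousOn (fun z => chartPartial f x z i) (chartAt (Eu m) x).target :=
  ((contDiffOn_chart hf x).continuousOn_fderiv_of_isOpen (chartAt (Eu m) x).open_target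
    (by simp)).clm_apply continuousOn_const

lemma continuous_gradInner (g : Metric m S) {f h : S → ℂ} (hf : ContMDiff (𝓡 m) 𝓘(ℝ, ℂ) ∞ f)
    (hh : ContMDiff (𝓡 m) 𝓘(ℝ, ℂ) ∞ h) : Continuous (gradInner g f h) := by
  rw [continuous_iff_continuousAt]
  intro x
  have h1 : ContinuousOn (fun z => ∑ i, ∑ j, (((chartGram g x z)⁻¹ i j : ℝ) : ℂ)
      * chartPartial f x z i * conj (chartPartial h x z j)) (chartAt (Eu m) x).target :=
    continuousOn_finsetSum _ fun i _ => continuousOn_finsetSum _ fun j _ =>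
      ((Complex.continuous_ofReal.comp_continuousOn (continuousOn_inv_chartGram g x i j)).mul
        (continuousOn_chartPartial hf x i)).mul
        (Complex.continuous_conj.comp_continuousOn (continuousOn_chartPartial hh x j))
  have h2 := h1.comp (chartAt (Eu m) x).continuousOn (chartAt (Eu m) x).mapsTo
  have h3 : ContinuousOn (gradInner g f h) (chartAt (Eu m) x).source := by
    refine h2.congr fun y hy => ?_
    have hz := (chartAt (Eu m) x).map_source hy
    have h4 := gradInner_chart g x hz ((hf _).mdifferentiableAt (by simp))
      ((hh _).mdifferentiableAt (by simp))
    rw [(chartAt (Eu m) x).left_inv hy] at h4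
    exact h4
  exact h3.continuousAt ((chartAt (Eu m) x).open_source.mem_nhds (mem_chart_source _ x))

/-- The Cauchy-Schwarz inequality for a positive definite matrix and its inverse. -/
lemma sq_le_inv_mul (G : Matrix (Fin m) (Fin m) ℝ) (hG : G.PosDef) (a : Fin m → ℝ) (j : Fin m) :
    a j ^ 2 ≤ dotProduct a (G⁻¹.mulVec a) * G j j := by
  have hdet : IsUnit G.det := hG.det_pos.ne'.isUnit
  have hpos := hG.inv.posSemidef
  have hjj : 0 < G j j := hG.diag_pos
  have hsym : G.transpose = G := by
    have := hG.isHermitian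
    rwa [Matrix.IsHermitian, Matrix.conjTranspose_eq_transpose_of_trivial] at this
  -- This value minimizes the quadratic form of `G⁻¹` at `a - t G e_j`, that is `⟨a, G⁻¹ a⟩ - 2 t
  -- a_j + t² G_jj`; nonnegativity at the minimum is the claim.
  set t := a j / G j j
  have h1 := hpos.dotProduct_mulVec_nonneg (a - t • G.mulVec (Pi.single j 1))
  have e1 : G⁻¹.mulVec (G.mulVec (Pi.single j 1)) = Pi.single j 1 := by
    rw [Matrix.mulVec_mulVec, Matrix.nonsing_inv_mul _ hdet, Matrix.one_mulVec]
  have e2 : dotProduct (G.mulVec (Pi.single j 1)) (G⁻¹.mulVec a) = a j := by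
    rw [Matrix.dotProduct_mulVec, ← Matrix.mulVec_transpose, Matrix.transpose_nonsing_inv, hsym,
      e1, single_one_dotProduct]
  have e3 : dotProduct (G.mulVec (Pi.single j 1)) (Pi.single j 1) = G j j := by
    rw [dotProduct_single_one, Matrix.mulVec_single_one]
    rfl
  have e5 : dotProduct a (Pi.single j 1) = a j := dotProduct_single_one _ _
  simp only [star_trivial, Matrix.mulVec_sub, Matrix.mulVec_smul, e1, sub_dotProduct,
    dotProduct_sub, smul_dotProduct, dotProduct_smul, e2, e3, e5, smul_eq_mul] at h1
  have e4 : t * G j j = a j := by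
    simp only [t]
    field_simp
  have h2 : t * a j ≤ dotProduct a (G⁻¹.mulVec a) := by
    rw [e4] at h1
    linarith
  calc a j ^ 2 = t * a j * G j j := by rw [mul_right_comm, e4]; ring
    _ ≤ _ := by gcongr

lemma re_gradInner_chart (g : Metric m S) {f : S → ℂ} (x : S) {z : Eu m}
    (hz : z ∈ (chartAt (Eu m) x).target)
    (hf : MDifferentiableAt (𝓡 m) 𝓘(ℝ, ℂ) f ((chartAt (Eu m) x).symm z)) :
    (gradInner g f f ((chartAt (Eu m) x).symm z)).re
      = dotProduct (fun i => (chartPartial f x z i).re)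
          ((chartGram g x z)⁻¹.mulVec fun i => (chartPartial f x z i).re)
        + dotProduct (fun i => (chartPartial f x z i).im)
          ((chartGram g x z)⁻¹.mulVec fun i => (chartPartial f x z i).im) := by
  rw [gradInner_chart g x hz hf hf]
  simp only [Complex.re_sum, dotProduct, Matrix.mulVec, Finset.mul_sum, ← Finset.sum_add_distrib]
  refine Finset.sum_congr rfl fun i _ => Finset.sum_congr rfl fun k _ => ?_
  simp
  ring

/-- The Cauchy-Schwarz inequality applied to real and imaginary parts. It lets the Riemannian energy
control Euclidean derivatives in a chart. -/
lemma normSq_chartPartial_le (g : Metric m S) {f : S → ℂ} (x : S) {z : Eu m}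
    (hz : z ∈ (chartAt (Eu m) x).target)
    (hf : MDifferentiableAt (𝓡 m) 𝓘(ℝ, ℂ) f ((chartAt (Eu m) x).symm z)) (j : Fin m) :
    ‖chartPartial f x z j‖ ^ 2
      ≤ (gradInner g f f ((chartAt (Eu m) x).symm z)).re * chartGram g x z j j := by
  have hG := posDef_chartGram g x hz
  have h1 := sq_le_inv_mul _ hG (fun i => (chartPartial f x z i).re) j
  have h2 := sq_le_inv_mul _ hG (fun i => (chartPartial f x z i).im) j
  rw [re_gradInner_chart g x hz hf, ← Complex.normSq_eq_norm_sq, Complex.normSq_apply, add_mul]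
  linarith

lemma re_gradInner_nonneg (g : Metric m S) {f : S → ℂ} (hf : ContMDiff (𝓡 m) 𝓘(ℝ, ℂ) ∞ f)
    (y : S) : 0 ≤ (gradInner g f f y).re := by
  have hz := mem_chart_target (Eu m) y
  have h1 := re_gradInner_chart g y hz ((hf _).mdifferentiableAt (by simp))
  rw [(chartAt (Eu m) y).left_inv (mem_chart_source _ y)] at h1
  rw [h1]
  have hpos := (posDef_chartGram g y hz).inv.posSemidef
  exact add_nonneg (by simpa using hpos.dotProduct_mulVec_nonneg _)
    (by simpa using hpos.dotProduct_mulVec_nonneg _)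

lemma differentiableAt_chart {f : S → ℂ} (hf : ContMDiff (𝓡 m) 𝓘(ℝ, ℂ) ∞ f) (x : S) {z : Eu m}
    (hz : z ∈ (chartAt (Eu m) x).target) :
    DifferentiableAt ℝ (f ∘ (chartAt (Eu m) x).symm) z :=
  ((contDiffOn_chart hf x).contDiffAt ((chartAt (Eu m) x).open_target.mem_nhds hz)).differentiableAt
    (by simp)

lemma gradInner_eq_chart (g : Metric m S) {f h : S → ℂ} (hf : ContMDiff (𝓡 m) 𝓘(ℝ, ℂ) ∞ f)
    (hh : ContMDiff (𝓡 m) 𝓘(ℝ, ℂ) ∞ h) (y : S) :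
    gradInner g f h y = ∑ i, ∑ j, (((chartGram g y (chartAt (Eu m) y y))⁻¹ i j : ℝ) : ℂ)
      * chartPartial f y (chartAt (Eu m) y y) i
      * conj (chartPartial h y (chartAt (Eu m) y y) j) := by
  have h1 := gradInner_chart g y (mem_chart_target (Eu m) y)
    ((hf _).mdifferentiableAt (by simp)) ((hh _).mdifferentiableAt (by simp))
  rwa [(chartAt (Eu m) y).left_inv (mem_chart_source _ y)] at h1

lemma gradInner_add_left (g : Metric m S) {f f' h : S → ℂ}
    (hf : ContMDiff (𝓡 m) 𝓘(ℝ, ℂ) ∞ f) (hf' : ContMDiff (𝓡 m) 𝓘(ℝ, ℂ) ∞ f')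
    (hh : ContMDiff (𝓡 m) 𝓘(ℝ, ℂ) ∞ h) (y : S) :
    gradInner g (f + f') h y = gradInner g f h y + gradInner g f' h y := by
  have e : ∀ i, chartPartial (f + f') y (chartAt (Eu m) y y) i
      = chartPartial f y (chartAt (Eu m) y y) i + chartPartial f' y (chartAt (Eu m) y y) i :=
    fun i => by
      have h1 := fderiv_add (differentiableAt_chart hf y (mem_chart_target (Eu m) y))
        (differentiableAt_chart hf' y (mem_chart_target (Eu m) y))
      exact congrArg (fun L : Eu m →L[ℝ] ℂ => L (basisVec m i)) h1
  rw [gradInner_eq_chart g (hf.add hf') hh, gradInner_eq_chart g hf hh,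
    gradInner_eq_chart g hf' hh, ← Finset.sum_add_distrib]
  refine Finset.sum_congr rfl fun i _ => ?_
  rw [← Finset.sum_add_distrib]
  refine Finset.sum_congr rfl fun j _ => ?_
  rw [e]
  ring

lemma gradInner_smul_left (g : Metric m S) {f h : S → ℂ} (hf : ContMDiff (𝓡 m) 𝓘(ℝ, ℂ) ∞ f)
    (hh : ContMDiff (𝓡 m) 𝓘(ℝ, ℂ) ∞ h) (c : ℂ) (y : S) :
    gradInner g (c • f) h y = c * gradInner g f h y := by
  have e : ∀ i, chartPartial (c • f) y (chartAt (Eu m) y y) i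
      = c * chartPartial f y (chartAt (Eu m) y y) i := fun i => by
    have h1 := fderiv_const_smul (differentiableAt_chart hf y (mem_chart_target (Eu m) y)) c
    exact congrArg (fun L : Eu m →L[ℝ] ℂ => L (basisVec m i)) h1
  rw [gradInner_eq_chart g (contMDiff_const_smul hf c) hh, gradInner_eq_chart g hf hh,
    Finset.mul_sum]
  refine Finset.sum_congr rfl fun i _ => ?_
  rw [Finset.mul_sum]
  refine Finset.sum_congr rfl fun j _ => ?_
  rw [e]
  ring

end RiemGeom

/-! ## The Riemannian volume -/

namespace RiemGeom

variable {m : ℕ} {S : Type*} [TopologicalSpace S] [ChartedSpace (EuclideanSpace ℝ (Fin m)) S]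

lemma measurableSet_chart_preimage [MeasurableSpace S] [BorelSpace S] (x : S)
    {A : Set S} (hA : MeasurableSet A) :
    MeasurableSet ((chartAt (Eu m) x).target ∩ (chartAt (Eu m) x).symm ⁻¹' A) := by
  have h1 := (continuousOn_iff_continuous_domRestrict.mp
    (chartAt (Eu m) x).continuousOn_symm).measurable hA
  have h2 := (chartAt (Eu m) x).open_target.measurableSet.subtype_image h1
  convert h2 using 1
  ext z
  simp [and_comm]

/-- A compact manifold is covered by finitely many compact sets in domains of charts. -/
lemma exists_compact_cover [CompactSpace S] : ∃ (t : Finset S) (K : S → Set S),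
    (∀ y, IsCompact (K y)) ∧ (∀ y, K y ⊆ (chartAt (Eu m) y).source) ∧ ⋃ y ∈ t, K y = univ := by
  have _ : LocallyCompactSpace S := ChartedSpace.locallyCompactSpace (Eu m) S
  choose K hK1 hK2 hK3 using fun y : S => exists_compact_subset
    (chartAt (Eu m) y).open_source (mem_chart_source (Eu m) y)
  obtain ⟨t, ht⟩ := CompactSpace.elim_nhds_subcover (fun y => interior (K y))
    fun y => isOpen_interior.mem_nhds (hK2 y)
  refine ⟨t, K, hK1, hK3, eq_univ_of_univ_subset ?_⟩
  rw [← top_eq_univ, ← ht]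
  exact iUnion₂_mono fun y _ => interior_subset

variable [IsManifold (𝓡 m) ∞ S]

/-- The density of the Riemannian volume in a chart. -/
def density (g : Metric m S) (x : S) (z : Eu m) : ℝ := Real.sqrt (chartGram g x z).det

lemma continuousOn_density (g : Metric m S) (x : S) :
    ContinuousOn (density g x) (chartAt (Eu m) x).target :=
  (continuousOn_det_chartGram g x).sqrt

lemma density_pos (g : Metric m S) (x : S) {z : Eu m} (hz : z ∈ (chartAt (Eu m) x).target) :
    0 < density g x z := Real.sqrt_pos.mpr (posDef_chartGram g x hz).det_pos

/-- By the chain rule the two Gram matrices are congruent through the derivative of the transition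
map; determinants and square roots give the Jacobian factor of the change of variables formula. -/
lemma density_transition (g : Metric m S) (x x' : S) {z : Eu m}
    (hz : z ∈ ((chartAt (Eu m) x).symm.trans (chartAt (Eu m) x')).source) :
    HasFDerivAt (chartAt (Eu m) x' ∘ (chartAt (Eu m) x).symm)
      (fderiv ℝ (chartAt (Eu m) x' ∘ (chartAt (Eu m) x).symm) z) z ∧
    density g x z = |(fderiv ℝ (chartAt (Eu m) x' ∘ (chartAt (Eu m) x).symm) z).det| *
      density g x' (chartAt (Eu m) x' ((chartAt (Eu m) x).symm z)) := by
  set c := chartAt (Eu m) x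
  set c' := chartAt (Eu m) x'
  have hz1 : z ∈ c.target := hz.1
  have hz2 : c.symm z ∈ c'.source := hz.2
  have hz3 : c' (c.symm z) ∈ c'.target := c'.map_source hz2
  have h1 : MDifferentiableAt (𝓡 m) (𝓡 m) (c' ∘ c.symm) z :=
    ((mdifferentiable_chart (I := 𝓡 m) x').mdifferentiableAt hz2).comp z
      (mdifferentiableAt_chart_symm x hz1)
  have h2 : HasFDerivAt (c' ∘ c.symm) (fderiv ℝ (c' ∘ c.symm) z) z :=
    h1.differentiableAt.hasFDerivAt
  refine ⟨h2, ?_⟩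
  have h3 : MDifferentiableAt (𝓡 m) (𝓡 m) c'.symm ((c' ∘ c.symm) z) :=
    mdifferentiableAt_chart_symm x' hz3
  have h4 := mfderiv_comp z h3 h1
  have h5 : c.symm =ᶠ[𝓝 z] c'.symm ∘ (c' ∘ c.symm) := by
    filter_upwards [(c.symm.trans c').open_source.mem_nhds hz] with w hw
    exact (c'.left_inv hw.2).symm
  have h6 : chartDeriv x z = (chartDeriv x' (c' (c.symm z))).comp (fderiv ℝ (c' ∘ c.symm) z) := by
    rw [← mfderiv_eq_fderiv]
    exact h5.mfderiv_eq.trans h4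
  have h7 : chartJac x z = chartJac x' (c' (c.symm z)) * LinearMap.toMatrix (stdBasis m)
      (stdBasis m) (fderiv ℝ (c' ∘ c.symm) z : Eu m →ₗ[ℝ] Eu m) := by
    rw [chartJac, chartJac, ← LinearMap.toMatrix_comp, h6]
    rfl
  have h8 : c'.symm (c' (c.symm z)) = c.symm z := c'.left_inv hz2
  have h9 : (chartGram g x z).det = (fderiv ℝ (c' ∘ c.symm) z).det ^ 2
      * (chartGram g x' (c' (c.symm z))).det := by
    have e1 := chartGram_eq g x' (c' (c.symm z))
    have e2 := chartGram_eq g x z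
    rw [show (chartAt (Eu m) x').symm (c' (c.symm z)) = c.symm z from h8] at e1
    rw [e1, e2, h7]
    simp only [Matrix.det_mul, Matrix.det_transpose, LinearMap.det_toMatrix]
    rw [ContinuousLinearMap.det]
    ring
  rw [density, h9, Real.sqrt_mul (sq_nonneg _), Real.sqrt_sq_eq_abs]
  rfl

lemma aemeasurable_density (g : Metric m S) (x : S) :
    AEMeasurable (fun z => ENNReal.ofReal (density g x z))
      (volume.restrict (chartAt (Eu m) x).target) :=
  ((continuousOn_density g x).aemeasurable
    (chartAt (Eu m) x).open_target.measurableSet).ennreal_ofReal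

variable [MeasurableSpace S]

lemma chartVolume_le_riemVolume (g : Metric m S) (x : S) : chartVolume g x ≤ riemVolume g :=
  le_iSup (fun x => chartVolume g x) x

variable [BorelSpace S]

lemma lintegral_chartVolume (g : Metric m S) (x : S) {f : S → ENNReal} (hf : Measurable f) :
    ∫⁻ y, f y ∂(chartVolume g x) = ∫⁻ z in (chartAt (Eu m) x).target,
      ENNReal.ofReal (density g x z) * f ((chartAt (Eu m) x).symm z) := by
  have h1 : AEMeasurable (chartAt (Eu m) x).symm (volume.restrict (chartAt (Eu m) x).target) :=
    (chartAt (Eu m) x).continuousOn_symm.aemeasurable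
      (chartAt (Eu m) x).open_target.measurableSet
  rw [chartVolume, lintegral_map' hf.aemeasurable
    (h1.mono_ac (withDensity_absolutelyContinuous _ _))]
  exact lintegral_withDensity_eq_lintegral_mul₀ (aemeasurable_density g x)
    (hf.comp_aemeasurable h1)

lemma chartVolume_apply (g : Metric m S) (x : S) {A : Set S} (hA : MeasurableSet A) :
    chartVolume g x A = ∫⁻ z in (chartAt (Eu m) x).target ∩ (chartAt (Eu m) x).symm ⁻¹' A,
      ENNReal.ofReal (density g x z) := by
  rw [← lintegral_indicator_one hA, lintegral_chartVolume g x (measurable_one.indicator hA),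
    ← lintegral_indicator (chartAt (Eu m) x).open_target.measurableSet,
    ← lintegral_indicator (measurableSet_chart_preimage x hA)]
  congr 1 with z
  by_cases h1 : z ∈ (chartAt (Eu m) x).target <;>
    by_cases h2 : (chartAt (Eu m) x).symm z ∈ A <;> simp [indicator, h1, h2]

/-- The chart measures agree on overlaps of charts. -/
lemma chartVolume_congr (g : Metric m S) (x x' : S) {A : Set S} (hA : MeasurableSet A)
    (h : A ⊆ (chartAt (Eu m) x).source) (h' : A ⊆ (chartAt (Eu m) x').source) :
    chartVolume g x A = chartVolume g x' A := by
  rw [chartVolume_apply g x hA, chartVolume_apply g x' hA]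
  set c := chartAt (Eu m) x
  set c' := chartAt (Eu m) x'
  set B := c.target ∩ c.symm ⁻¹' A
  have hB : MeasurableSet B := measurableSet_chart_preimage x hA
  have hsub : ∀ z ∈ B, z ∈ (c.symm.trans c').source := fun z hz => ⟨hz.1, h' hz.2⟩
  have himg : (c' ∘ c.symm) '' B = c'.target ∩ c'.symm ⁻¹' A := by
    ext w
    constructor
    · rintro ⟨z, hz, rfl⟩
      refine ⟨c'.map_source (h' hz.2), ?_⟩
      change c'.symm (c' (c.symm z)) ∈ A
      rw [c'.left_inv (h' hz.2)]
      exact hz.2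
    · rintro ⟨hw, hw'⟩
      refine ⟨c (c'.symm w), ⟨c.map_source (h hw'), ?_⟩, ?_⟩
      · change c.symm (c (c'.symm w)) ∈ A
        rw [c.left_inv (h hw')]
        exact hw'
      · change c' (c.symm (c (c'.symm w))) = w
        rw [c.left_inv (h hw'), c'.right_inv hw]
  have hinj : InjOn (c' ∘ c.symm) B := by
    intro z hz w hw e
    exact (c.symm.trans c').injOn (hsub z hz) (hsub w hw) e
  rw [← himg, lintegral_image_eq_lintegral_abs_det_fderiv_mul volume hB
    (fun z hz => (density_transition g x x' (hsub z hz)).1.hasFDerivWithinAt) hinj]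
  refine setLIntegral_congr_fun hB fun z hz => ?_
  rw [(density_transition g x x' (hsub z hz)).2, ENNReal.ofReal_mul (abs_nonneg _)]
  rfl

/-- Each part of a set inside some `K y` can be measured in the chart around `y`, because chart
measures agree on overlaps. The bound does not depend on `x`, hence also holds for the supremum that
defines the volume. -/
lemma chartVolume_le (g : Metric m S) (x : S) (t : Finset S) (K : S → Set S)
    (hK : ∀ y ∈ t, MeasurableSet (K y)) (hKs : ∀ y ∈ t, K y ⊆ (chartAt (Eu m) y).source)
    (hcov : ⋃ y ∈ t, K y = univ) :
    chartVolume g x ≤ ∑ y ∈ t, (chartVolume g y).restrict (K y) := by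
  refine Measure.le_iff.mpr fun A hA => ?_
  rw [Measure.finsetSum_apply]
  have hs : MeasurableSet (chartAt (Eu m) x).source := (chartAt (Eu m) x).open_source.measurableSet
  have e1 : chartVolume g x A = chartVolume g x (A ∩ (chartAt (Eu m) x).source) := by
    rw [chartVolume_apply g x hA, chartVolume_apply g x (hA.inter hs)]
    congr 2
    ext z
    constructor
    · rintro ⟨h1, h2⟩
      exact ⟨h1, h2, (chartAt (Eu m) x).map_target h1⟩
    · rintro ⟨h1, h2, h3⟩
      exact ⟨h1, h2⟩
  have e2 : A ∩ (chartAt (Eu m) x).source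
      ⊆ ⋃ y ∈ t, (A ∩ (chartAt (Eu m) x).source) ∩ K y := by
    rw [← inter_iUnion₂, hcov, inter_univ]
  rw [e1]
  refine (measure_mono e2).trans ((measure_biUnion_finset_le t _).trans
    (Finset.sum_le_sum fun y hy => ?_))
  rw [chartVolume_congr g x y ((hA.inter hs).inter (hK y hy))
    (fun w hw => hw.1.2) (fun w hw => hKs y hy hw.2), Measure.restrict_apply hA]
  exact measure_mono fun w hw => ⟨hw.1.1, hw.2⟩

lemma riemVolume_le (g : Metric m S) (t : Finset S) (K : S → Set S)
    (hK : ∀ y ∈ t, MeasurableSet (K y)) (hKs : ∀ y ∈ t, K y ⊆ (chartAt (Eu m) y).source)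
    (hcov : ⋃ y ∈ t, K y = univ) :
    riemVolume g ≤ ∑ y ∈ t, (chartVolume g y).restrict (K y) :=
  iSup_le fun x => chartVolume_le g x t K hK hKs hcov

/-- The volume is dominated by finitely many pieces, each with bounded density on a compact subset
of `ℝ^m`. -/
lemma isFiniteMeasure_riemVolume [CompactSpace S] [T2Space S] (g : Metric m S) :
    IsFiniteMeasure (riemVolume g) := by
  obtain ⟨t, K, hK, hKs, hcov⟩ := exists_compact_cover (m := m) (S := S)
  refine ⟨lt_of_le_of_lt (riemVolume_le g t K (fun y _ => (hK y).measurableSet)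
    (fun y _ => hKs y) hcov univ) ?_⟩
  rw [Measure.finsetSum_apply]
  refine ENNReal.sum_lt_top.mpr fun y _ => ?_
  rw [Measure.restrict_apply_univ, chartVolume_apply g y (hK y).measurableSet]
  have h1 : (chartAt (Eu m) y).target ∩ (chartAt (Eu m) y).symm ⁻¹' K y
      = chartAt (Eu m) y '' K y := by
    rw [(chartAt (Eu m) y).image_eq_target_inter_inv_preimage (hKs y)]
  have h2 : IsCompact (chartAt (Eu m) y '' K y) :=
    (hK y).image_of_continuousOn ((chartAt (Eu m) y).continuousOn.mono (hKs y))
  rw [h1]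
  have h3 : ContinuousOn (density g y) (chartAt (Eu m) y '' K y) :=
    (continuousOn_density g y).mono (by rw [← h1]; exact inter_subset_left)
  obtain ⟨C, hC⟩ := h2.exists_bound_of_continuousOn h3
  refine lt_of_le_of_lt (setLIntegral_mono (g := fun _ => ENNReal.ofReal C) measurable_const
    fun z hz => ENNReal.ofReal_le_ofReal ((le_abs_self _).trans (hC z hz))) ?_
  rw [setLIntegral_const]
  exact ENNReal.mul_lt_top ENNReal.ofReal_lt_top h2.measure_lt_top

/-- In any single chart the density is positive on a nonempty open set. -/
lemma riemVolume_ne_zero [Nonempty S] (g : Metric m S) : riemVolume g ≠ 0 := by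
  obtain ⟨x⟩ := ‹Nonempty S›
  intro h
  have h1 : chartVolume g x univ ≤ 0 := by
    have := chartVolume_le_riemVolume g x univ
    rwa [h] at this
  rw [chartVolume_apply g x MeasurableSet.univ, preimage_univ, inter_univ, nonpos_iff_eq_zero,
    setLIntegral_eq_zero_iff' (chartAt (Eu m) x).open_target.measurableSet
      (aemeasurable_density g x)] at h1
  have h2 : volume (chartAt (Eu m) x).target = 0 := by
    rw [measure_eq_zero_iff_ae_notMem]
    filter_upwards [h1] with z hz hz'
    have := ENNReal.ofReal_pos.mpr (density_pos g x hz')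
    rw [hz hz'] at this
    exact lt_irrefl _ this
  exact ((chartAt (Eu m) x).open_target.measure_pos volume
    ⟨_, mem_chart_target (Eu m) x⟩).ne' h2

end RiemGeom

/-! ## The Poincaré inequality on convex sets -/

namespace RiemGeom

/-- Cauchy-Schwarz against the constant `1`. -/
lemma sq_lintegral_le {α : Type*} [MeasurableSpace α] (μ : Measure α) {f : α → ENNReal}
    (hf : AEMeasurable f μ) : (∫⁻ a, f a ∂μ) ^ 2 ≤ μ univ * ∫⁻ a, f a ^ 2 ∂μ := by
  have h := ENNReal.lintegral_mul_le_Lp_mul_Lq μ Real.HolderConjugate.two_two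
    (aemeasurable_const (b := (1 : ENNReal))) hf
  have e : ∀ a : ENNReal, (a ^ (1 / 2 : ℝ)) ^ 2 = a := fun a => by
    rw [← ENNReal.rpow_natCast, ← ENNReal.rpow_mul]
    simp
  have h2 := pow_le_pow_left' h 2
  rw [mul_pow, e, e] at h2
  simpa using h2

variable {E : Type*} [NormedAddCommGroup E] [NormedSpace ℝ E]

/-- The difference is the integral of the derivative along the segment, which stays in `Q`;
Cauchy-Schwarz in `t` moves the square inside, and `d` bounds the length of the segment. -/
lemma enorm_sub_sq_le {u : E → ℂ} {U Q : Set E} (hU : IsOpen U) (hu : ContDiffOn ℝ 1 u U)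
    (hQ : Convex ℝ Q) (hQU : Q ⊆ U) {d : ℝ} (hd : ∀ x ∈ Q, ∀ y ∈ Q, ‖x - y‖ ≤ d) {x y : E}
    (hx : x ∈ Q) (hy : y ∈ Q) :
    ‖u x - u y‖ₑ ^ 2 ≤ ENNReal.ofReal (d ^ 2)
      * ∫⁻ t in Icc (0 : ℝ) 1, ‖fderiv ℝ u ((1 - t) • x + t • y)‖ₑ ^ 2 := by
  have hmem : ∀ t ∈ Icc (0 : ℝ) 1, (1 - t) • x + t • y ∈ Q := fun t ht =>
    hQ hx hy (by linarith [ht.2]) ht.1 (by ring)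
  have hcont : ContinuousOn (fun t : ℝ => fderiv ℝ u ((1 - t) • x + t • y)) (Icc 0 1) :=
    (hu.continuousOn_fderiv_of_isOpen hU le_rfl).comp (by fun_prop)
      fun t ht => hQU (hmem t ht)
  have hcont2 : ContinuousOn (fun t : ℝ => fderiv ℝ u ((1 - t) • x + t • y) (y - x)) (Icc 0 1) :=
    hcont.clm_apply continuousOn_const
  have hder : ∀ t ∈ uIcc (0 : ℝ) 1, HasDerivAt (fun t : ℝ => u ((1 - t) • x + t • y))
      (fderiv ℝ u ((1 - t) • x + t • y) (y - x)) t := by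
    intro t ht
    rw [uIcc_of_le zero_le_one] at ht
    have h1 : HasDerivAt (fun t : ℝ => (1 - t) • x + t • y) (y - x) t := by
      have h2 := (((hasDerivAt_id t).const_sub 1).smul_const x).add
        ((hasDerivAt_id t).smul_const y)
      have e : (-1 : ℝ) • x + (1 : ℝ) • y = y - x := by rw [neg_one_smul, one_smul]; abel
      rw [e] at h2
      exact h2
    have h3 : DifferentiableAt ℝ u ((1 - t) • x + t • y) :=
      (hu.contDiffAt (hU.mem_nhds (hQU (hmem t ht)))).differentiableAt one_ne_zero
    exact h3.hasFDerivAt.comp_hasDerivAt t h1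
  have hint := intervalIntegral.integral_eq_sub_of_hasDerivAt hder
    (hcont2.intervalIntegrable_of_Icc zero_le_one)
  simp only [sub_self, zero_smul, one_smul, zero_add, sub_zero, add_zero] at hint
  have h1 : ‖u x - u y‖ₑ
      ≤ ∫⁻ t in Icc (0 : ℝ) 1, ‖fderiv ℝ u ((1 - t) • x + t • y) (y - x)‖ₑ := by
    rw [← enorm_neg, neg_sub, ← hint, intervalIntegral.integral_of_le zero_le_one,
      ← integral_Icc_eq_integral_Ioc]
    exact enorm_integral_le_lintegral_enorm _
  calc ‖u x - u y‖ₑ ^ 2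
      ≤ (∫⁻ t in Icc (0 : ℝ) 1, ‖fderiv ℝ u ((1 - t) • x + t • y) (y - x)‖ₑ) ^ 2 := by gcongr
    _ ≤ ∫⁻ t in Icc (0 : ℝ) 1, ‖fderiv ℝ u ((1 - t) • x + t • y) (y - x)‖ₑ ^ 2 := by
        refine (sq_lintegral_le _ (hcont2.enorm.aemeasurable measurableSet_Icc)).trans ?_
        simp
    _ ≤ ∫⁻ t in Icc (0 : ℝ) 1, ENNReal.ofReal (d ^ 2)
          * ‖fderiv ℝ u ((1 - t) • x + t • y)‖ₑ ^ 2 := by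
        refine lintegral_mono fun t => ?_
        have h2 : ‖y - x‖ ≤ d := hd y hy x hx
        have h3 : ‖y - x‖ₑ ≤ ENNReal.ofReal d := by
          rw [← ofReal_norm]
          exact ENNReal.ofReal_le_ofReal h2
        have h4 := (fderiv ℝ u ((1 - t) • x + t • y)).le_opENorm (y - x)
        rw [ENNReal.ofReal_pow ((norm_nonneg _).trans h2), ← mul_pow]
        refine pow_le_pow_left' (h4.trans ?_) 2
        rw [mul_comm]
        gcongr
    _ = _ := lintegral_const_mul' _ _ ENNReal.ofReal_ne_top

variable [FiniteDimensional ℝ E] [MeasurableSpace E] [BorelSpace E] (μ : Measure E)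
  [μ.IsAddHaarMeasure]

/-- For fixed `x` and `t`, the map `y ↦ (1 - t) x + t y` sends `Q` into itself and scales the
measure by `t ^ dim`, which is at least `2⁻¹ ^ dim`. -/
lemma setLIntegral_comp_segment_le {h : E → ENNReal} (hh : Measurable h) {Q : Set E}
    (hQ : Convex ℝ Q) (hQm : MeasurableSet Q) {x : E} (hx : x ∈ Q) {t : ℝ} (ht : 1 / 2 ≤ t)
    (ht1 : t ≤ 1) :
    ∫⁻ y in Q, h ((1 - t) • x + t • y) ∂μ ≤ 2 ^ (Module.finrank ℝ E) * ∫⁻ y in Q, h y ∂μ := by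
  have ht0 : 0 < t := by linarith
  have hm : Measurable (Q.indicator h) := hh.indicator hQm
  calc ∫⁻ y in Q, h ((1 - t) • x + t • y) ∂μ
      ≤ ∫⁻ y, Q.indicator h ((1 - t) • x + t • y) ∂μ := by
        rw [← lintegral_indicator hQm]
        refine lintegral_mono fun y => ?_
        by_cases hy : y ∈ Q
        · have : (1 - t) • x + t • y ∈ Q := hQ hx hy (by linarith) ht0.le (by ring)
          simp [indicator, hy, this]
        · simp [indicator, hy]
    _ = ∫⁻ w, Q.indicator h ((1 - t) • x + w) ∂(Measure.map (t • ·) μ) := by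
        exact (lintegral_map (f := fun w => Q.indicator h ((1 - t) • x + w))
          (hm.comp (measurable_const_add _)) (measurable_const_smul t)).symm
    _ = ENNReal.ofReal |(t ^ Module.finrank ℝ E)⁻¹| * ∫⁻ y in Q, h y ∂μ := by
        rw [Measure.map_addHaar_smul μ ht0.ne', lintegral_smul_measure,
          lintegral_add_left_eq_self (fun w => Q.indicator h w), lintegral_indicator hQm]
        rfl
    _ ≤ _ := by
        gcongr
        rw [abs_of_nonneg (by positivity), ← inv_pow, ENNReal.ofReal_pow (by positivity)]
        refine pow_le_pow_left' ?_ _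
        rw [← ENNReal.ofReal_ofNat]
        refine ENNReal.ofReal_le_ofReal ?_
        rw [inv_le_comm₀ ht0 two_pos]
        linarith

/-- By Tonelli `t` may be fixed first. For `t ≥ 1/2` the substitution is made in `y`, for `t ≤ 1/2`
in `x`, so that the scaling factor never degenerates. -/
lemma lintegral_segment_le {h : E → ENNReal} (hh : Measurable h) {Q : Set E}
    (hQ : Convex ℝ Q) (hQm : MeasurableSet Q) :
    ∫⁻ x in Q, ∫⁻ y in Q, (∫⁻ t in Icc (0 : ℝ) 1, h ((1 - t) • x + t • y)) ∂μ ∂μ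
      ≤ μ Q * (2 ^ (Module.finrank ℝ E) * ∫⁻ y in Q, h y ∂μ) := by
  have hm : Measurable fun p : (E × E) × ℝ => h ((1 - p.2) • p.1.1 + p.2 • p.1.2) :=
    hh.comp (by fun_prop)
  have h1 : ∫⁻ x in Q, ∫⁻ y in Q, (∫⁻ t in Icc (0 : ℝ) 1, h ((1 - t) • x + t • y)) ∂μ ∂μ
      = ∫⁻ t in Icc (0 : ℝ) 1, ∫⁻ x in Q, ∫⁻ y in Q, h ((1 - t) • x + t • y) ∂μ ∂μ := by
    have h2 : ∀ x, ∫⁻ y in Q, (∫⁻ t in Icc (0 : ℝ) 1, h ((1 - t) • x + t • y)) ∂μ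
        = ∫⁻ t in Icc (0 : ℝ) 1, ∫⁻ y in Q, h ((1 - t) • x + t • y) ∂μ := fun x =>
      lintegral_lintegral_swap
        (f := fun y t => h ((1 - t) • x + t • y)) (hh.comp (by fun_prop)).aemeasurable
    simp only [h2]
    refine lintegral_lintegral_swap
      (f := fun x t => ∫⁻ y in Q, h ((1 - t) • x + t • y) ∂μ) (Measurable.aemeasurable ?_)
    exact Measurable.lintegral_prod_right'
      (f := fun p : (E × ℝ) × E => h ((1 - p.1.2) • p.1.1 + p.1.2 • p.2)) (hh.comp (by fun_prop))
  rw [h1]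
  set D := μ Q * (2 ^ (Module.finrank ℝ E) * ∫⁻ y in Q, h y ∂μ) with hD
  have h3 : ∀ t ∈ Icc (0 : ℝ) 1,
      ∫⁻ x in Q, ∫⁻ y in Q, h ((1 - t) • x + t • y) ∂μ ∂μ ≤ D := by
    intro t ht
    have hconst : D = ∫⁻ _ in Q, (2 ^ (Module.finrank ℝ E) * ∫⁻ y in Q, h y ∂μ) ∂μ := by
      rw [setLIntegral_const, mul_comm]
    rcases le_total (1 / 2) t with h4 | h4
    · rw [hconst]
      exact setLIntegral_mono measurable_const fun x hx =>
        setLIntegral_comp_segment_le μ hh hQ hQm hx h4 ht.2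
    · rw [lintegral_lintegral_swap (f := fun x y => h ((1 - t) • x + t • y))
        (hh.comp (by fun_prop)).aemeasurable, hconst]
      refine setLIntegral_mono measurable_const fun y hy => ?_
      have h5 := setLIntegral_comp_segment_le μ hh hQ hQm hy (t := 1 - t) (by linarith)
        (by linarith [ht.1])
      simpa [add_comm] using h5
  refine (setLIntegral_mono measurable_const h3).trans ?_
  simp

/-- The Poincaré inequality on a convex set. -/
lemma poincare_convex {u : E → ℂ} {U Q : Set E} (hU : IsOpen U) (hu : ContDiffOn ℝ 1 u U)
    (hQ : Convex ℝ Q) (hQm : MeasurableSet Q) (hQU : Q ⊆ U) {d : ℝ}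
    (hd : ∀ x ∈ Q, ∀ y ∈ Q, ‖x - y‖ ≤ d) (hμQ : μ Q ≠ ⊤) (hint : IntegrableOn u Q μ)
    (h0 : ∫ z in Q, u z ∂μ = 0) :
    ∫⁻ z in Q, ‖u z‖ₑ ^ 2 ∂μ
      ≤ ENNReal.ofReal (d ^ 2) * 2 ^ (Module.finrank ℝ E) * ∫⁻ z in Q, ‖fderiv ℝ u z‖ₑ ^ 2 ∂μ := by
  rcases eq_or_ne (μ Q) 0 with hz | hz
  · rw [setLIntegral_measure_zero _ _ hz]
    exact zero_le
  have hum : AEMeasurable u (μ.restrict Q) := hint.aemeasurable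
  have hfd : Measurable fun z => ‖fderiv ℝ u z‖ₑ ^ 2 := (measurable_fderiv ℝ u).enorm.pow_const 2
  -- Since `u` has average zero, `μ(Q) u(x)` is the integral of `u(x) - u(y)` over `y ∈ Q`;
  -- Cauchy-Schwarz costs one more factor `μ(Q)`. The common factor `μ(Q)²` is cancelled at the end.
  have h1 : ∀ x, μ Q ^ 2 * ‖u x‖ₑ ^ 2 ≤ μ Q * ∫⁻ y in Q, ‖u x - u y‖ₑ ^ 2 ∂μ := by
    intro x
    have e1 : ∫ y in Q, (u x - u y) ∂μ = (μ Q).toReal • u x := by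
      have h2 : IntegrableOn (fun _ => u x) Q μ := integrableOn_const hμQ (by simp)
      rw [integral_sub h2 hint, h0, sub_zero, setIntegral_const]
      rfl
    have e2 : μ Q * ‖u x‖ₑ ≤ ∫⁻ y in Q, ‖u x - u y‖ₑ ∂μ := by
      have := enorm_integral_le_lintegral_enorm (μ := μ.restrict Q) fun y => u x - u y
      rw [e1, enorm_smul] at this
      refine le_trans (le_of_eq ?_) this
      rw [Real.enorm_of_nonneg ENNReal.toReal_nonneg, ENNReal.ofReal_toReal hμQ]
    rw [← mul_pow]
    refine (pow_le_pow_left' e2 2).trans ((sq_lintegral_le _ ?_).trans ?_)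
    · exact (hum.const_sub (u x)).enorm
    · rw [Measure.restrict_apply_univ]
  have h2 : μ Q ^ 2 * ∫⁻ x in Q, ‖u x‖ₑ ^ 2 ∂μ ≤ μ Q ^ 2 * (ENNReal.ofReal (d ^ 2)
      * 2 ^ (Module.finrank ℝ E) * ∫⁻ z in Q, ‖fderiv ℝ u z‖ₑ ^ 2 ∂μ) := by
    calc μ Q ^ 2 * ∫⁻ x in Q, ‖u x‖ₑ ^ 2 ∂μ
        = ∫⁻ x in Q, μ Q ^ 2 * ‖u x‖ₑ ^ 2 ∂μ :=
          (lintegral_const_mul' _ _ (ENNReal.pow_ne_top hμQ)).symm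
      _ ≤ ∫⁻ x in Q, μ Q * ∫⁻ y in Q, ENNReal.ofReal (d ^ 2)
            * (∫⁻ t in Icc (0 : ℝ) 1, ‖fderiv ℝ u ((1 - t) • x + t • y)‖ₑ ^ 2) ∂μ ∂μ := by
          refine setLIntegral_mono' hQm fun x hx => (h1 x).trans ?_
          gcongr 1
          exact setLIntegral_mono' hQm fun y hy => enorm_sub_sq_le hU hu hQ hQU hd hx hy
      _ = μ Q * (ENNReal.ofReal (d ^ 2) * ∫⁻ x in Q, ∫⁻ y in Q,
            (∫⁻ t in Icc (0 : ℝ) 1, ‖fderiv ℝ u ((1 - t) • x + t • y)‖ₑ ^ 2) ∂μ ∂μ) := by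
          rw [lintegral_const_mul' _ _ hμQ, ← lintegral_const_mul' _ _ ENNReal.ofReal_ne_top]
          refine congrArg _ (lintegral_congr fun x => ?_)
          exact lintegral_const_mul' _ _ ENNReal.ofReal_ne_top
      _ ≤ μ Q * (ENNReal.ofReal (d ^ 2) * (μ Q * (2 ^ (Module.finrank ℝ E)
            * ∫⁻ z in Q, ‖fderiv ℝ u z‖ₑ ^ 2 ∂μ))) := by
          gcongr
          exact lintegral_segment_le μ hfd hQ hQm
      _ = _ := by ring
  exact (ENNReal.mul_le_mul_iff_right (pow_ne_zero 2 hz) (ENNReal.pow_ne_top hμQ)).mp h2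

end RiemGeom

/-! ## A Poincaré inequality with finitely many constraints -/

namespace RiemGeom

/-- The half-open cube of side `δ` with index `k`. -/
def cube {m : ℕ} (δ : ℝ) (k : Fin m → ℤ) : Set (Eu m) := {z | ∀ j, ⌊z j / δ⌋ = k j}

lemma mem_cube_iff {m : ℕ} {δ : ℝ} (hδ : 0 < δ) {k : Fin m → ℤ} {z : Eu m} :
    z ∈ cube δ k ↔ ∀ j, k j * δ ≤ z j ∧ z j < (k j + 1) * δ := by
  simp only [cube, mem_ofPred_eq, Int.floor_eq_iff]
  refine forall_congr' fun j => ?_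
  rw [le_div_iff₀ hδ, div_lt_iff₀ hδ]

lemma convex_cube {m : ℕ} {δ : ℝ} (hδ : 0 < δ) (k : Fin m → ℤ) : Convex ℝ (cube δ k) := by
  intro z hz w hw a b ha hb hab
  rw [mem_cube_iff hδ] at *
  intro j
  have h := (convex_Ico (k j * δ) ((k j + 1) * δ)) (hz j) (hw j) ha hb hab
  simpa using h

lemma measurableSet_cube {m : ℕ} (δ : ℝ) (k : Fin m → ℤ) : MeasurableSet (cube δ k) := by
  have h : cube δ k = ⋂ j, (fun z : Eu m => ⌊z j / δ⌋) ⁻¹' {k j} := by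
    ext z
    simp [cube]
  rw [h]
  refine MeasurableSet.iInter fun j => ?_
  have h2 : Measurable fun z : Eu m => z j / δ := by fun_prop
  exact h2.floor (measurableSet_singleton _)

lemma norm_sub_le_of_mem_cube {m : ℕ} {δ : ℝ} (hδ : 0 < δ) {k : Fin m → ℤ} {z w : Eu m}
    (hz : z ∈ cube δ k) (hw : w ∈ cube δ k) : ‖z - w‖ ≤ Real.sqrt m * δ := by
  rw [mem_cube_iff hδ] at hz hw
  rw [EuclideanSpace.norm_eq, ← Real.sqrt_sq hδ.le, ← Real.sqrt_mul (Nat.cast_nonneg m)]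
  refine Real.sqrt_le_sqrt ?_
  have h : ∀ j ∈ Finset.univ, ‖(z - w) j‖ ^ 2 ≤ δ ^ 2 := fun j _ => by
    have h1 := hz j
    have h2 := hw j
    have h3 : |(z - w) j| ≤ δ := by
      rw [PiLp.sub_apply, abs_le]
      constructor <;> linarith
    rw [Real.norm_eq_abs]
    gcongr
  refine (Finset.sum_le_sum h).trans ?_
  simp

lemma disjoint_cube {m : ℕ} (δ : ℝ) {k l : Fin m → ℤ} (h : k ≠ l) :
    Disjoint (cube δ k) (cube δ l) := by
  rw [Set.disjoint_left]
  intro z hz hw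
  exact h (funext fun j => (hz j).symm.trans (hw j))

/-- Only finitely many cubes meet a bounded set. -/
lemma finite_cubes {m : ℕ} {δ : ℝ} (hδ : 0 < δ) {K : Set (Eu m)} (hK : Bornology.IsBounded K) :
    {k : Fin m → ℤ | (cube δ k ∩ K).Nonempty}.Finite := by
  obtain ⟨R, hR⟩ := hK.exists_norm_le
  refine (finite_Icc (fun _ : Fin m => ⌊-R / δ⌋) (fun _ : Fin m => ⌊R / δ⌋)).subset ?_
  rintro k ⟨z, hz, hzK⟩
  have h1 : ∀ j, |z j| ≤ R := fun j => (PiLp.norm_apply_le z j).trans (hR z hzK)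
  refine ⟨fun j => ?_, fun j => ?_⟩ <;> rw [← hz j] <;> refine Int.floor_mono ?_ <;> gcongr
  · exact (abs_le.mp (h1 j)).1
  · exact (abs_le.mp (h1 j)).2

lemma norm_sq_le_sum {m : ℕ} (L : Eu m →L[ℝ] ℂ) : ‖L‖ ^ 2 ≤ ∑ j, ‖L (basisVec m j)‖ ^ 2 := by
  have h0 : 0 ≤ ∑ j, ‖L (basisVec m j)‖ ^ 2 := by positivity
  rw [← Real.sq_sqrt h0]
  refine pow_le_pow_left₀ (norm_nonneg _) (L.opNorm_le_bound (Real.sqrt_nonneg _) fun v => ?_) 2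
  have h1 : L v = ∑ j, v j • L (basisVec m j) := by
    have h2 := (stdBasis m).sum_repr v
    conv_lhs => rw [← h2]
    rw [map_sum]
    refine Finset.sum_congr rfl fun j _ => ?_
    rw [map_smul, stdBasis_apply]
    rfl
  have h3 : ‖L v‖ ≤ ∑ j, ‖L (basisVec m j)‖ * ‖v j‖ := by
    rw [h1]
    refine (norm_sum_le _ _).trans (le_of_eq (Finset.sum_congr rfl fun j _ => ?_))
    rw [norm_smul, mul_comm]
  refine h3.trans ((Real.sum_mul_le_sqrt_mul_sqrt _ _ _).trans ?_)
  rw [EuclideanSpace.norm_eq]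

variable {m : ℕ} {S : Type*} [TopologicalSpace S] [ChartedSpace (EuclideanSpace ℝ (Fin m)) S]
  [IsManifold (𝓡 m) ∞ S]

/-- The energy density of a function. -/
def energy (g : Metric m S) (f : S → ℂ) (y : S) : ENNReal :=
  ENNReal.ofReal (gradInner g f f y).re

/-- The squared operator norm is at most the sum of the squared partial derivatives; the `j`-th is
bounded by the energy times `g_jj`, and the `g_jj` add up to the trace. -/
lemma enorm_fderiv_sq_le (g : Metric m S) {f : S → ℂ} (hf : ContMDiff (𝓡 m) 𝓘(ℝ, ℂ) ∞ f) (x : S)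
    {z : Eu m} (hz : z ∈ (chartAt (Eu m) x).target) :
    ‖fderiv ℝ (f ∘ (chartAt (Eu m) x).symm) z‖ₑ ^ 2
      ≤ ENNReal.ofReal (chartGram g x z).trace * energy g f ((chartAt (Eu m) x).symm z) := by
  have h0 : 0 ≤ (chartGram g x z).trace := (posDef_chartGram g x hz).posSemidef.trace_nonneg
  rw [energy, ← ENNReal.ofReal_mul h0, ← ofReal_norm, ← ENNReal.ofReal_pow (norm_nonneg _)]
  refine ENNReal.ofReal_le_ofReal ((norm_sq_le_sum _).trans ?_)
  rw [Matrix.trace, Finset.sum_mul]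
  refine Finset.sum_le_sum fun j _ => ?_
  rw [mul_comm]
  exact normSq_chartPartial_le g x hz ((hf _).mdifferentiableAt (by simp)) j

variable [MeasurableSpace S] [BorelSpace S]

lemma measurable_energy (g : Metric m S) {f : S → ℂ} (hf : ContMDiff (𝓡 m) 𝓘(ℝ, ℂ) ∞ f) :
    Measurable (energy g f) :=
  (Complex.continuous_re.comp (continuous_gradInner g hf hf)).measurable.ennreal_ofReal

/-- A Poincaré inequality on a compact subset of the domain of a chart, with an arbitrarily small
constant, for functions whose averages over finitely many cubes vanish. -/
lemma poincare_chart (g : Metric m S) (x : S) {K : Set S} (hK : IsCompact K) (hKm : MeasurableSet K)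
    (hKs : K ⊆ (chartAt (Eu m) x).source) {ε : ℝ} (hε : 0 < ε) :
    ∃ (δ : ℝ) (κ : Finset (Fin m → ℤ)),
      (∀ f : S → ℂ, ContMDiff (𝓡 m) 𝓘(ℝ, ℂ) ∞ f → ∀ k ∈ κ,
        IntegrableOn (f ∘ (chartAt (Eu m) x).symm) (cube δ k)) ∧
      ∀ f : S → ℂ, ContMDiff (𝓡 m) 𝓘(ℝ, ℂ) ∞ f →
        (∀ k ∈ κ, ∫ z in cube δ k, (f ∘ (chartAt (Eu m) x).symm) z = 0) →
        ∫⁻ y in K, ‖f y‖ₑ ^ 2 ∂(chartVolume g x)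
          ≤ ENNReal.ofReal ε * ∫⁻ y, energy g f y ∂(riemVolume g) := by
  set c := chartAt (Eu m) x
  have hK' : IsCompact (c '' K) := hK.image_of_continuousOn (c.continuousOn.mono hKs)
  have hK't : c '' K ⊆ c.target := (image_mono hKs).trans c.image_source_eq_target.subset
  -- Cubes that meet the image of `K` may protrude from it. The thickening `N` leaves room for them
  -- inside the chart, and on the compact set `N` the density, its inverse and the trace are
  -- bounded.
  obtain ⟨δ₁, hδ₁, hsub⟩ := hK'.exists_cthickening_subset_open c.open_target hK't
  set N := Metric.cthickening δ₁ (c '' K)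
  have hN : IsCompact N := hK'.cthickening
  have hNm : MeasurableSet N := hN.measurableSet
  obtain ⟨b, hb⟩ := hN.exists_bound_of_continuousOn ((continuousOn_density g x).mono hsub)
  obtain ⟨T, hT⟩ := hN.exists_bound_of_continuousOn (f := fun z => (chartGram g x z).trace)
    ((continuous_id.matrix_trace.comp_continuousOn (continuousOn_chartGram g x)).mono hsub)
  obtain ⟨a, ha⟩ := hN.exists_bound_of_continuousOn (f := fun z => (density g x z)⁻¹)
    (((continuousOn_density g x).inv₀ fun z hz => (density_pos g x hz).ne').mono hsub)
  set B := ENNReal.ofReal b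
  set A := ENNReal.ofReal a
  set TT := ENNReal.ofReal T
  -- the side of the cubes
  obtain ⟨δ, hδ, hδ1, hδ2⟩ : ∃ δ : ℝ, 0 < δ ∧ Real.sqrt m * δ ≤ δ₁ ∧
      |b| * ((Real.sqrt m * δ) ^ 2 * 2 ^ m * (|T| * |a|)) ≤ ε := by
    have h1 : Tendsto (fun δ : ℝ => Real.sqrt m * δ) (𝓝[>] 0) (𝓝 (Real.sqrt m * 0)) :=
      ((continuous_const.mul continuous_id).tendsto 0).mono_left nhdsWithin_le_nhds
    have h2 : Tendsto (fun δ : ℝ => |b| * ((Real.sqrt m * δ) ^ 2 * 2 ^ m * (|T| * |a|)))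
        (𝓝[>] 0) (𝓝 (|b| * ((Real.sqrt m * 0) ^ 2 * 2 ^ m * (|T| * |a|)))) :=
      (Continuous.tendsto (by fun_prop) 0).mono_left nhdsWithin_le_nhds
    simp only [mul_zero] at h1 h2
    norm_num at h2
    obtain ⟨δ, h3, h4, h5⟩ := ((eventually_mem_nhdsWithin).and ((h1.eventually_le_const hδ₁).and
      (h2.eventually_le_const hε))).exists
    exact ⟨δ, h3, h4, h5⟩
  set κ := (finite_cubes hδ hK'.isBounded).toFinset
  have hκN : ∀ k ∈ κ, cube δ k ⊆ N := by
    intro k hk z hz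
    obtain ⟨w, hw, hwK⟩ := (finite_cubes hδ hK'.isBounded).mem_toFinset.mp hk
    refine Metric.mem_cthickening_of_dist_le z w δ₁ _ hwK ?_
    rw [dist_eq_norm]
    exact (norm_sub_le_of_mem_cube hδ hz hw).trans hδ1
  have hintN : ∀ f : S → ℂ, ContMDiff (𝓡 m) 𝓘(ℝ, ℂ) ∞ f → IntegrableOn (f ∘ c.symm) N :=
    fun f hf => ((contDiffOn_chart hf x).continuousOn.mono hsub).integrableOn_compact hN
  refine ⟨δ, κ, fun f hf k hk => (hintN f hf).mono_set (hκN k hk), fun f hf h0 => ?_⟩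
  set u := f ∘ c.symm
  have hfm : Measurable fun y => ‖f y‖ₑ ^ 2 := hf.continuous.measurable.enorm.pow_const 2
  have hK'm : MeasurableSet (c '' K) := hK'.measurableSet
  calc ∫⁻ y in K, ‖f y‖ₑ ^ 2 ∂(chartVolume g x)
      = ∫⁻ z in c.target, ENNReal.ofReal (density g x z)
          * K.indicator (fun y => ‖f y‖ₑ ^ 2) (c.symm z) := by
        rw [← lintegral_indicator hKm, lintegral_chartVolume g x (hfm.indicator hKm)]
    _ ≤ ∫⁻ z in c '' K, B * ‖u z‖ₑ ^ 2 := by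
        rw [← lintegral_indicator c.open_target.measurableSet, ← lintegral_indicator hK'm]
        refine lintegral_mono fun z => ?_
        by_cases h1 : z ∈ c.target
        · by_cases h2 : c.symm z ∈ K
          · have h3 : z ∈ c '' K := ⟨_, h2, c.right_inv h1⟩
            simp only [indicator, h1, h2, h3, if_true]
            refine mul_le_mul_left (ENNReal.ofReal_le_ofReal ?_) _
            exact (le_abs_self _).trans (hb z (Metric.self_subset_cthickening _ h3))
          · simp [indicator, h2]
        · simp [indicator, h1]
    _ = B * ∫⁻ z in c '' K, ‖u z‖ₑ ^ 2 := lintegral_const_mul' _ _ ENNReal.ofReal_ne_top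
    _ ≤ B * ∑ k ∈ κ, ∫⁻ z in cube δ k, ‖u z‖ₑ ^ 2 := by
        gcongr
        have h1 : c '' K ⊆ ⋃ k ∈ κ, cube δ k := by
          intro z hz
          simp only [mem_iUnion]
          have h2 : z ∈ cube δ fun j => ⌊z j / δ⌋ := fun j => rfl
          exact ⟨_, (finite_cubes hδ hK'.isBounded).mem_toFinset.mpr ⟨z, h2, hz⟩, h2⟩
        refine (lintegral_mono_set h1).trans (le_of_eq ?_)
        exact lintegral_biUnion_finset (fun k _ l _ hkl => disjoint_cube δ hkl)
          (fun k _ => measurableSet_cube δ k) _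
    _ ≤ B * ∑ k ∈ κ, (ENNReal.ofReal ((Real.sqrt m * δ) ^ 2) * 2 ^ m
          * ∫⁻ z in cube δ k, ‖fderiv ℝ u z‖ₑ ^ 2) := by
        gcongr with k hk
        have h1 := poincare_convex volume c.open_target ((contDiffOn_chart hf x).of_le (by simp))
          (convex_cube hδ k) (measurableSet_cube δ k) ((hκN k hk).trans hsub)
          (fun z hz w hw => norm_sub_le_of_mem_cube hδ hz hw)
          ((measure_mono (hκN k hk)).trans_lt hN.measure_lt_top).ne
          ((hintN f hf).mono_set (hκN k hk)) (h0 k hk)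
        rwa [finrank_euclideanSpace_fin] at h1
    _ = B * (ENNReal.ofReal ((Real.sqrt m * δ) ^ 2) * 2 ^ m
          * ∫⁻ z in ⋃ k ∈ κ, cube δ k, ‖fderiv ℝ u z‖ₑ ^ 2) := by
        rw [← Finset.mul_sum, lintegral_biUnion_finset (fun k _ l _ hkl => disjoint_cube δ hkl)
          (fun k _ => measurableSet_cube δ k)]
    _ ≤ B * (ENNReal.ofReal ((Real.sqrt m * δ) ^ 2) * 2 ^ m
          * ∫⁻ z in N, (TT * A) * (ENNReal.ofReal (density g x z) * energy g f (c.symm z))) := by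
        gcongr B * (_ * ?_)
        refine (lintegral_mono_set (iUnion₂_subset hκN)).trans
          (setLIntegral_mono' hNm fun z hz => ?_)
        refine (enorm_fderiv_sq_le g hf x (hsub hz)).trans ?_
        have h1 : ENNReal.ofReal (chartGram g x z).trace ≤ TT :=
          ENNReal.ofReal_le_ofReal ((le_abs_self _).trans (hT z hz))
        -- Lebesgue measure is converted back into Riemannian volume by means of the lower bound of
        -- the density on `N`.
        have h2 : 1 ≤ A * ENNReal.ofReal (density g x z) := by
          have h3 := density_pos g x (hsub hz)
          have h4 : (density g x z)⁻¹ ≤ a := (le_abs_self _).trans (ha z hz)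
          have h5 : 0 ≤ a := (inv_pos.mpr h3).le.trans h4
          rw [← ENNReal.ofReal_mul h5, ← ENNReal.ofReal_one]
          refine ENNReal.ofReal_le_ofReal ?_
          rwa [← inv_le_iff_one_le_mul₀ h3]
        calc _ ≤ TT * energy g f (c.symm z) := by gcongr
          _ ≤ TT * (A * ENNReal.ofReal (density g x z) * energy g f (c.symm z)) := by
              gcongr
              exact le_mul_of_one_le_left zero_le h2
          _ = _ := by ring
    _ = B * (ENNReal.ofReal ((Real.sqrt m * δ) ^ 2) * 2 ^ m * (TT * A
          * ∫⁻ z in N, ENNReal.ofReal (density g x z) * energy g f (c.symm z))) := by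
        rw [lintegral_const_mul' _ _ (ENNReal.mul_ne_top ENNReal.ofReal_ne_top
          ENNReal.ofReal_ne_top)]
    _ ≤ B * (ENNReal.ofReal ((Real.sqrt m * δ) ^ 2) * 2 ^ m * (TT * A
          * ∫⁻ y, energy g f y ∂(riemVolume g))) := by
        gcongr
        refine (lintegral_mono_set hsub).trans ?_
        rw [← lintegral_chartVolume g x (measurable_energy g hf)]
        exact lintegral_mono' (chartVolume_le_riemVolume g x) le_rfl
    _ = B * (ENNReal.ofReal ((Real.sqrt m * δ) ^ 2) * 2 ^ m * (TT * A))
          * ∫⁻ y, energy g f y ∂(riemVolume g) := by ring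
    _ ≤ _ := by
        gcongr
        refine le_trans ?_ (ENNReal.ofReal_le_ofReal hδ2)
        have e : (2 : ENNReal) ^ m = ENNReal.ofReal (2 ^ m) := by
          rw [ENNReal.ofReal_pow zero_le_two]
          simp
        rw [ENNReal.ofReal_mul (abs_nonneg b), ENNReal.ofReal_mul (by positivity),
          ENNReal.ofReal_mul (by positivity), ENNReal.ofReal_mul (abs_nonneg T), e]
        gcongr <;> exact ENNReal.ofReal_le_ofReal (le_abs_self _)

/-- A Poincaré inequality on a compact manifold, with an arbitrarily small constant, for functions
that satisfy finitely many linear conditions. -/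
lemma poincare_finite [CompactSpace S] [T2Space S] (g : Metric m S) {ε : ℝ} (hε : 0 < ε) :
    ∃ (s : Finset (S × (Fin m → ℤ))) (δ : S → ℝ),
      (∀ f : S → ℂ, ContMDiff (𝓡 m) 𝓘(ℝ, ℂ) ∞ f → ∀ p ∈ s,
        IntegrableOn (f ∘ (chartAt (Eu m) p.1).symm) (cube (δ p.1) p.2)) ∧
      ∀ f : S → ℂ, ContMDiff (𝓡 m) 𝓘(ℝ, ℂ) ∞ f →
        (∀ p ∈ s, ∫ z in cube (δ p.1) p.2, (f ∘ (chartAt (Eu m) p.1).symm) z = 0) →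
        ∫⁻ y, ‖f y‖ₑ ^ 2 ∂(riemVolume g)
          ≤ ENNReal.ofReal ε * ∫⁻ y, energy g f y ∂(riemVolume g) := by
  classical
  obtain ⟨t, K, hK, hKs, hcov⟩ := exists_compact_cover (m := m) (S := S)
  -- The constant is shared among the charts; adding `1` avoids division by zero for an empty cover.
  have hε' : 0 < ε / (t.card + 1) := by positivity
  choose δ κ h1 h2 using fun x => poincare_chart g x (hK x) (hK x).measurableSet (hKs x) hε'
  have hmem : ∀ x ∈ t, ∀ k ∈ κ x, (x, k) ∈ t.biUnion fun x => (κ x).image fun k => (x, k) :=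
    fun x hx k hk => Finset.mem_biUnion.mpr ⟨x, hx, Finset.mem_image_of_mem _ hk⟩
  refine ⟨t.biUnion fun x => (κ x).image fun k => (x, k), δ, ?_, fun f hf h0 => ?_⟩
  · intro f hf p hp
    obtain ⟨x, -, hp⟩ := Finset.mem_biUnion.mp hp
    obtain ⟨k, hk, rfl⟩ := Finset.mem_image.mp hp
    exact h1 x f hf k hk
  · calc ∫⁻ y, ‖f y‖ₑ ^ 2 ∂(riemVolume g)
        ≤ ∫⁻ y, ‖f y‖ₑ ^ 2 ∂(∑ x ∈ t, (chartVolume g x).restrict (K x)) :=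
          lintegral_mono' (riemVolume_le g t K (fun x _ => (hK x).measurableSet)
            (fun x _ => hKs x) hcov) le_rfl
      _ = ∑ x ∈ t, ∫⁻ y in K x, ‖f y‖ₑ ^ 2 ∂(chartVolume g x) := lintegral_finsetSum_measure _ _ _
      _ ≤ ∑ _x ∈ t, ENNReal.ofReal (ε / (t.card + 1)) * ∫⁻ y, energy g f y ∂(riemVolume g) :=
          Finset.sum_le_sum fun x hx => h2 x f hf fun k hk => h0 (x, k) (hmem x hx k hk)
      _ = ENNReal.ofReal (t.card * (ε / (t.card + 1))) * ∫⁻ y, energy g f y ∂(riemVolume g) := by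
          rw [Finset.sum_const, nsmul_eq_mul, ENNReal.ofReal_mul (Nat.cast_nonneg _),
            ENNReal.ofReal_natCast, mul_assoc]
      _ ≤ _ := by
          gcongr
          rw [mul_div_assoc', div_le_iff₀ (by positivity)]
          nlinarith

end RiemGeom

/-! ## The low eigenspaces of the Laplacian span a finite dimensional space -/

namespace Cosmo

open RiemGeom

lemma lintegral_enorm_sq {α : Type*} [MeasurableSpace α] {μ : Measure α} {η : Lp ℂ 2 μ} {f : α → ℂ}
    (h : (η : α → ℂ) =ᵐ[μ] f) :
    ∫⁻ x, ‖f x‖ₑ ^ 2 ∂(μ) = ENNReal.ofReal (‖η‖ ^ 2) := by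
  have h1 : ∫⁻ x, ‖f x‖ₑ ^ 2 ∂(μ) = ∫⁻ x, ‖η x‖ₑ ^ 2 ∂(μ) := by
    refine lintegral_congr_ae ?_
    filter_upwards [h] with x hx
    rw [hx]
  rw [h1, Lp.norm_def, ENNReal.ofReal_pow ENNReal.toReal_nonneg,
    ENNReal.ofReal_toReal (Lp.eLpNorm_ne_top η)]
  have h2 := eLpNorm_nnreal_pow_eq_lintegral (f := (η : α → ℂ)) (μ := μ)
    (p := (2 : NNReal)) two_ne_zero
  simp only [NNReal.coe_ofNat, ENNReal.coe_ofNat, ENNReal.rpow_ofNat] at h2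
  exact h2.symm

variable {m : ℕ} {S : Type*} [TopologicalSpace S] [CompactSpace S]
  [ChartedSpace (EuclideanSpace ℝ (Fin m)) S] [MeasurableSpace S] [BorelSpace S]

lemma integrable_of_continuous {G : Type*} [NormedAddCommGroup G] [SecondCountableTopology G]
    {μ : Measure S} [IsFiniteMeasure μ] {f : S → G} (hf : Continuous f) : Integrable f μ := by
  obtain ⟨C, hC⟩ := (isCompact_range hf).isBounded.exists_norm_le
  let _ : MeasurableSpace G := borel G
  have _ : BorelSpace G := ⟨rfl⟩
  exact Integrable.of_bound hf.measurable.aestronglyMeasurable C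
    (Eventually.of_forall fun x => hC _ (mem_range_self x))

variable [IsManifold (𝓡 m) ∞ S] [T2Space S]

/-- The triples `(η, ζ, f)` such that `f` is a smooth function in the class `η ∈ L²(S)` and `ζ` is
the class of `-Δ f`. -/
def laplaceGraph (g : Metric m S) : Submodule ℂ ((L2 g × L2 g) × (S → ℂ)) where
  carrier := {p | ContMDiff (𝓡 m) 𝓘(ℝ, ℂ) ∞ p.2 ∧ (p.1.1 : S → ℂ) =ᵐ[riemVolume g] p.2 ∧
    ∃ l : S → ℂ, ContMDiff (𝓡 m) 𝓘(ℝ, ℂ) ∞ l ∧ (p.1.2 : S → ℂ) =ᵐ[riemVolume g] l ∧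
      ∀ h : S → ℂ, ContMDiff (𝓡 m) 𝓘(ℝ, ℂ) ∞ h →
        ∫ x, gradInner g p.2 h x ∂(riemVolume g) = ∫ x, l x * conj (h x) ∂(riemVolume g)}
  add_mem' := by
    rintro ⟨⟨η, ζ⟩, f⟩ ⟨⟨η', ζ'⟩, f'⟩ ⟨hf, hη, l, hl, hζ, h⟩ ⟨hf', hη', l', hl', hζ', h'⟩
    have _ := isFiniteMeasure_riemVolume g
    refine ⟨hf.add hf', ?_, l + l', hl.add hl', ?_, fun k hk => ?_⟩
    · filter_upwards [Lp.coeFn_add η η', hη, hη'] with x h1 h2 h3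
      exact h1.trans (congrArg₂ (· + ·) h2 h3)
    · filter_upwards [Lp.coeFn_add ζ ζ', hζ, hζ'] with x h1 h2 h3
      exact h1.trans (congrArg₂ (· + ·) h2 h3)
    · have e1 : ∀ x, gradInner g (f + f') k x = gradInner g f k x + gradInner g f' k x :=
        gradInner_add_left g hf hf' hk
      have hkc : Continuous fun x => conj (k x) := Complex.continuous_conj.comp hk.continuous
      have i1 : Integrable (fun x => l x * conj (k x)) (riemVolume g) :=
        integrable_of_continuous (hl.continuous.mul hkc)
      have i2 : Integrable (fun x => l' x * conj (k x)) (riemVolume g) :=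
        integrable_of_continuous (hl'.continuous.mul hkc)
      change ∫ x, gradInner g (f + f') k x ∂(riemVolume g) = _
      simp only [e1, Pi.add_apply, add_mul]
      rw [integral_add i1 i2, integral_add (integrable_of_continuous (continuous_gradInner g hf hk))
        (integrable_of_continuous (continuous_gradInner g hf' hk)), ← h k hk, ← h' k hk]
  zero_mem' := by
    refine ⟨contMDiff_const (c := (0 : ℂ)), Lp.coeFn_zero _ _ _, 0, contMDiff_const (c := (0 : ℂ)),
      Lp.coeFn_zero _ _ _, fun h hh => ?_⟩
    have e : ∀ x, gradInner g (0 : S → ℂ) h x = 0 := fun x => by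
      have := gradInner_smul_left g (contMDiff_const (c := (0 : ℂ)) : ContMDiff (𝓡 m) 𝓘(ℝ, ℂ) ∞
        (0 : S → ℂ)) hh 0 x
      rwa [zero_smul, zero_mul] at this
    change ∫ x, gradInner g 0 h x ∂(riemVolume g) = _
    simp [e]
  smul_mem' := by
    rintro c ⟨⟨η, ζ⟩, f⟩ ⟨hf, hη, l, hl, hζ, h⟩
    refine ⟨contMDiff_const_smul hf c, ?_, c • l, contMDiff_const_smul hl c, ?_, fun k hk => ?_⟩
    · filter_upwards [Lp.coeFn_smul c η, hη] with x h1 h2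
      exact h1.trans (congrArg (c • ·) h2)
    · filter_upwards [Lp.coeFn_smul c ζ, hζ] with x h1 h2
      exact h1.trans (congrArg (c • ·) h2)
    · have e1 : ∀ x, gradInner g (c • f) k x = c * gradInner g f k x :=
        gradInner_smul_left g hf hk c
      change ∫ x, gradInner g (c • f) k x ∂(riemVolume g) = _
      simp only [e1, Pi.smul_apply, smul_eq_mul, mul_assoc]
      rw [integral_const_mul, integral_const_mul, ← h k hk]

/-- An eigenspace is defined as the span of the classes of eigenfunctions. Since `laplaceGraph` is a
linear space, a smooth representative together with its Laplacian exists for every linear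
combination. -/
lemma exists_mem_laplaceGraph_of_mem_eigenspace (g : Metric m S) {μ : ℝ} {η : L2 g}
    (hη : η ∈ eigenspace g μ) : ∃ f, ((η, (μ : ℂ) • η), f) ∈ laplaceGraph g := by
  let D : Submodule ℂ (L2 g) := ((laplaceGraph g).map (LinearMap.fst ℂ _ _)).comap
    (LinearMap.prod LinearMap.id ((μ : ℂ) • LinearMap.id))
  have hD : eigenspace g μ ≤ D := by
    refine Submodule.span_le.mpr ?_
    rintro η ⟨f, hf, hηf, hl⟩
    refine ⟨((η, (μ : ℂ) • η), f), ⟨hf, hηf, (μ : ℂ) • f, contMDiff_const_smul hf _, ?_, ?_⟩, rfl⟩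
    · filter_upwards [Lp.coeFn_smul (μ : ℂ) η, hηf] with x h1 h2
      exact h1.trans (congrArg ((μ : ℂ) • ·) h2)
    · intro h hh
      refine (hl h hh).trans ?_
      rw [← integral_neg]
      simp
  obtain ⟨⟨p, f⟩, hp, e⟩ := hD hη
  have e : p = (η, (μ : ℂ) • η) := e
  exact ⟨f, e ▸ hp⟩

lemma exists_mem_laplaceGraph (P : Params) (g : Metric m S) (η : H0 P g) :
    ∃ f, (((η : L2 g), (negLaplacian P g η : L2 g)), f) ∈ laplaceGraph g := by
  obtain ⟨s, v, h1, h2⟩ := SpectralOp.exists_sum (fun μ : LowEig P m => eigenspace g μ.1)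
    (ortho P g) (fun μ => μ.1) η
  have h3 : ((negLaplacian P g η : H0 P g) : L2 g) = ∑ μ ∈ s, ((μ.1 : ℝ) : ℂ) • (v μ : L2 g) := h2
  choose f hf using fun μ : LowEig P m => exists_mem_laplaceGraph_of_mem_eigenspace g (v μ).2
  have h4 := (laplaceGraph g).sum_mem fun μ (_ : μ ∈ s) => hf μ
  refine ⟨∑ μ ∈ s, f μ, ?_⟩
  rw [h1, h3]
  convert h4 using 1
  simp only [Prod.ext_iff, Prod.fst_sum, Prod.snd_sum]
  exact ⟨⟨trivial, trivial⟩, trivial⟩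

/-- Pairing `-Δ f` with `f` itself turns the energy into `⟨-Δ η, η⟩`, and every eigenvalue that
occurs in `H_0` is at most the stated constant. -/
lemma lintegral_energy (P : Params) (g : Metric m S) {η : H0 P g} {f : S → ℂ}
    (hf : (((η : L2 g), (negLaplacian P g η : L2 g)), f) ∈ laplaceGraph g) :
    ∫⁻ x, energy g f x ∂(riemVolume g)
      ≤ ENNReal.ofReal (((m : ℝ) - 1) ^ 2 / 4 / P.k * ‖η‖ ^ 2) := by
  obtain ⟨hfs, hη, l, hl, hζ, h⟩ := hf
  have _ := isFiniteMeasure_riemVolume g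
  have hi : Integrable (gradInner g f f) (riemVolume g) :=
    integrable_of_continuous (continuous_gradInner g hfs hfs)
  rw [show (fun x => energy g f x) = fun x => ENNReal.ofReal (gradInner g f f x).re from rfl]
  have hi' : Integrable (fun x => (gradInner g f f x).re) (riemVolume g) := hi.re
  rw [← ofReal_integral_eq_lintegral_ofReal hi'
    (Eventually.of_forall fun x => re_gradInner_nonneg g hfs x)]
  refine ENNReal.ofReal_le_ofReal ?_
  have e1 : ∫ x, (gradInner g f f x).re ∂(riemVolume g)
      = (∫ x, gradInner g f f x ∂(riemVolume g)).re := integral_re hi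
  have e2 : ∫ x, l x * conj (f x) ∂(riemVolume g)
      = inner ℂ (η : L2 g) (negLaplacian P g η : L2 g) := by
    rw [L2.inner_def]
    refine integral_congr_ae ?_
    filter_upwards [hη, hζ] with x h1 h2
    have h1 : (η : L2 g) x = f x := h1
    have h2 : (negLaplacian P g η : L2 g) x = l x := h2
    rw [h1, h2]
    rfl
  change ∫ x, (gradInner g f f x).re ∂(riemVolume g) ≤ _
  rw [e1, h f hfs, e2, ← inner_conj_symm, Complex.conj_re]
  exact SpectralOp.linOp_re_inner (fun μ : LowEig P m => eigenspace g μ.1) (ortho P g) _ _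
    (fun μ => μ.le) η

/-- If all the cube averages of a smooth representative vanish, Poincaré and the energy bound give
`‖η‖² ≤ ‖η‖² / 2`. Finitely many linear functionals therefore separate the elements of `H_0`. -/
theorem finiteDimensional_H0 (P : Params) (g : Metric m S) : FiniteDimensional ℂ (H0 P g) := by
  set c : ℝ := ((m : ℝ) - 1) ^ 2 / 4 / P.k
  have hc : 0 ≤ c := by have := P.k_pos; positivity
  -- This choice gives `ε c ≤ 1/2`, also in the case `c = 0`, which occurs for `m = 1`.
  obtain ⟨s, δ, h1, h2⟩ := poincare_finite g (ε := 1 / (2 * (c + 1))) (by positivity)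
  -- The averages are functionals of a smooth function, not of a class. Working with pairs `(η, f)`
  -- avoids a linear choice of representatives: `H_0` is a quotient of `Y / ker A`, which embeds
  -- into a finite dimensional space.
  let Y : Submodule ℂ (H0 P g × (S → ℂ)) := (laplaceGraph g).comap
    (LinearMap.prodMap (LinearMap.prod (H0 P g).subtype
      ((H0 P g).subtype ∘ₗ (negLaplacian P g).toLinearMap)) LinearMap.id)
  have hY : ∀ p : Y, ((((p : H0 P g × (S → ℂ)).1 : L2 g),
      (negLaplacian P g (p : H0 P g × (S → ℂ)).1 : L2 g)), (p : H0 P g × (S → ℂ)).2)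
        ∈ laplaceGraph g := fun p => p.2
  let π : Y →ₗ[ℂ] H0 P g := LinearMap.fst ℂ _ _ ∘ₗ Y.subtype
  have hπ : Function.Surjective π := fun η => by
    obtain ⟨f, hf⟩ := exists_mem_laplaceGraph P g η
    exact ⟨⟨(η, f), hf⟩, rfl⟩
  let A : Y →ₗ[ℂ] (s → ℂ) :=
    { toFun := fun p i => ∫ z in cube (δ i.1.1) i.1.2,
        ((p : H0 P g × (S → ℂ)).2 ∘ (chartAt (Eu m) i.1.1).symm) z
      map_add' := fun p q => funext fun i =>
        integral_add (h1 _ (hY p).1 i.1 i.2) (h1 _ (hY q).1 i.1 i.2)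
      map_smul' := fun a p => funext fun i => integral_smul a _ }
  have hker : A.ker ≤ π.ker := by
    intro p hp
    have hp0 : ∀ i ∈ s, ∫ z in cube (δ i.1) i.2,
        ((p : H0 P g × (S → ℂ)).2 ∘ (chartAt (Eu m) i.1).symm) z = 0 :=
      fun i hi => congrFun (show A p = 0 from hp) ⟨i, hi⟩
    have h3 := h2 _ (hY p).1 hp0
    rw [lintegral_enorm_sq (hY p).2.1] at h3
    have h4 := h3.trans (mul_le_mul_right (lintegral_energy P g (hY p)) _)
    rw [← ENNReal.ofReal_mul (by positivity), ENNReal.ofReal_le_ofReal_iff (by positivity)] at h4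
    have h5 : ‖(p : H0 P g × (S → ℂ)).1‖ ^ 2 ≤ 1 / (2 * (c + 1))
        * (c * ‖(p : H0 P g × (S → ℂ)).1‖ ^ 2) := h4
    have h6 : 1 / (2 * (c + 1)) * c ≤ 1 / 2 := by
      rw [div_mul_eq_mul_div, one_mul, div_le_div_iff₀ (by positivity) two_pos]
      linarith
    have h7 := mul_le_mul_of_nonneg_right h6 (sq_nonneg ‖(p : H0 P g × (S → ℂ)).1‖)
    have h8 : ‖(p : H0 P g × (S → ℂ)).1‖ ^ 2 ≤ 0 := by nlinarith
    have h9 : ‖(p : H0 P g × (S → ℂ)).1‖ = 0 := by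
      have := sq_nonneg ‖(p : H0 P g × (S → ℂ)).1‖
      exact pow_eq_zero_iff two_ne_zero |>.mp (le_antisymm h8 this)
    exact norm_eq_zero.mp h9
  have hfin : Module.Finite ℂ (Y ⧸ A.ker) := Module.Finite.equiv A.quotKerEquivRange.symm
  refine Module.Finite.of_surjective (A.ker.liftQ π hker) fun η => ?_
  obtain ⟨p, rfl⟩ := hπ η
  exact ⟨Submodule.Quotient.mk p, rfl⟩

/-- The constants lie in `H_0`. -/
lemma nontrivial_H0 [Nonempty S] (P : Params) (g : Metric m S) : Nontrivial (H0 P g) := by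
  have _ := isFiniteMeasure_riemVolume g
  have hsm : ContMDiff (𝓡 m) 𝓘(ℝ, ℂ) ∞ fun _ : S => (1 : ℂ) := contMDiff_const
  let η : L2 g := (memLp_const (1 : ℂ)).toLp fun _ => (1 : ℂ)
  have hη : (η : S → ℂ) =ᵐ[riemVolume g] fun _ => (1 : ℂ) := MemLp.coeFn_toLp _
  -- The eigenvalue `0` of the constants always qualifies, because its `μ̄` is `-(m - 1)² / 4`.
  have h0 : (0 : ℝ) ≤ 0 ∧ P.muBar m 0 ≤ 0 := by
    refine ⟨le_rfl, ?_⟩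
    unfold Params.muBar
    have := sq_nonneg ((m : ℝ) - 1)
    linarith
  have hmem : η ∈ eigenspace g 0 := by
    refine Submodule.subset_span ⟨_, hsm, hη, fun h hh => ?_⟩
    have e : ∀ x, gradInner g (fun _ => (1 : ℂ)) h x = 0 := fun x => by
      have e1 : ∀ i, partialDeriv (m := m) (fun _ : S => (1 : ℂ)) x i = 0 := fun i => by
        rw [partialDeriv, mfderiv_const]
        rfl
      simp [gradInner, e1]
    simp [e]
  have hmem' : η ∈ H0 P g := le_iSup (fun μ : LowEig P m => eigenspace g μ.1) ⟨0, h0⟩ hmem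
  refine ⟨⟨⟨η, hmem'⟩, 0, fun h => ?_⟩⟩
  have h1 : η = 0 := congrArg Subtype.val h
  have h2 := lintegral_enorm_sq hη
  rw [h1] at h2
  simp at h2
  exact riemVolume_ne_zero g h2

end Cosmo

/-! ### Radial Hilbert spaces: multiplication operators and integration by parts -/

namespace Radial

variable {F : Type*} [NormedAddCommGroup F] [InnerProductSpace ℂ F] {T : AngularOp F} {M : Model}

/-! ### Compactly supported functions in `H(I, 1)` -/

/-- The coefficients `r⁻¹` and `r⁻²` are continuous only for `r > 0`. Elsewhere the function
vanishes on a neighbourhood, the support of a test function being closed and contained in the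
interval. -/
lemma continuous_of_support {G : Type*} [NormedAddCommGroup G] (φ : TestSpace T M) {h : ℝ → G}
    (hc : ContinuousOn h (Ioi 0)) (h0 : ∀ r, r ∉ tsupport φ.fn → h r = 0) : Continuous h := by
  refine continuous_iff_continuousAt.mpr fun r => ?_
  by_cases hr : r ∈ tsupport φ.fn
  · exact hc.continuousAt (Ioi_mem_nhds (M.interval_subset (φ.tsupport_subset hr)))
  · have h1 : h =ᶠ[𝓝 r] fun _ => 0 := by
      filter_upwards [(isClosed_tsupport φ.fn).isOpen_compl.mem_nhds hr] with s hs using h0 s hs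
    exact continuousAt_const.congr h1.symm

lemma memLp_of_support (φ : TestSpace T M) {h : ℝ → F}
    (hc : ContinuousOn h (Ioi 0)) (h0 : ∀ r, r ∉ tsupport φ.fn → h r = 0) :
    MemLp h 2 (radialMeasure M) := by
  refine (continuous_of_support φ hc h0).memLp_of_hasCompactSupport (φ.compact.mono' ?_)
  intro r hr
  by_contra hne
  exact hr (h0 r hne)

lemma integral_inner_eq_inner_toLp {h : ℝ → F} (hh : MemLp h 2 (radialMeasure M))
    (u : WaveSpace F M) :
    ∫ r, inner ℂ (h r) (u r) ∂(radialMeasure M) = inner ℂ (hh.toLp h) u := by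
  rw [L2.inner_def]
  refine integral_congr_ae ?_
  filter_upwards [hh.coeFn_toLp] with r hr
  rw [hr]

lemma inner_toLp_toLp {h k : ℝ → F} (hh : MemLp h 2 (radialMeasure M))
    (hk : MemLp k 2 (radialMeasure M)) :
    inner ℂ (hh.toLp h) (hk.toLp k) = ∫ r in M.interval, (r : ℂ) * inner ℂ (h r) (k r) := by
  have : ∫ r in M.interval, (r : ℂ) * inner ℂ (h r) (k r)
      = ∫ r, inner ℂ (h r) (k r) ∂(radialMeasure M) := by
    rw [integral_radialMeasure]
    simp
  rw [this, L2.inner_def]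
  refine integral_congr_ae ?_
  filter_upwards [hh.coeFn_toLp, hk.coeFn_toLp] with r hr hr'
  rw [hr, hr']

lemma norm_toLp_sq {h : ℝ → F} (hh : MemLp h 2 (radialMeasure M)) :
    ‖hh.toLp h‖ ^ 2 = ∫ r in M.interval, r * ‖h r‖ ^ 2 := by
  have h1 := inner_toLp_toLp hh hh
  have h2 : ∀ r : ℝ, (r : ℂ) * inner ℂ (h r) (h r) = ((r * ‖h r‖ ^ 2 : ℝ) : ℂ) := fun r => by
    rw [inner_self_eq_norm_sq_to_K]; push_cast; rfl
  have h3 : ∫ r in M.interval, ((r * ‖h r‖ ^ 2 : ℝ) : ℂ)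
      = ((∫ r in M.interval, r * ‖h r‖ ^ 2 : ℝ) : ℂ) := integral_ofReal
  simp only [h2] at h1
  rw [h3, inner_self_eq_norm_sq_to_K] at h1
  refine Complex.ofReal_injective ?_
  rw [← h1]
  push_cast
  rfl

/-! ### Multiplication operators from `H_i(I_i)` to `H(I_i, 1)` -/

/-- A continuous function on the interval of a model that grows at most linearly, and not at all
for models whose scalar product has no `r³` term. -/
structure Multiplier (M : Model) where
  fn : ℝ → ℝ
  continuous : Continuous fn
  bound : ∃ C : ℝ, 0 ≤ C ∧ ∀ r ∈ M.interval, fn r ^ 2 ≤ C * (1 + M.weight * r ^ 2)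

lemma testIncl_apply (φ : TestSpace T M) : testIncl T M φ = φ.memLp.toLp φ.fn := rfl

lemma memLp_mul (p : ℝ → ℝ) (hp : Continuous p) (φ : TestSpace T M) :
    MemLp (fun r => p r • φ.fn r) 2 (radialMeasure M) :=
  memLp_of_support φ (hp.smul φ.contDiff.continuous).continuousOn
    fun r hr => by simp [φ.fn_zero_of hr]

/-- Multiplication of test functions by a multiplier. -/
def mulTest (T : AngularOp F) (M : Model) (p : Multiplier M) :
    TestSpace T M →ₗ[ℂ] WaveSpace F M where
  toFun φ := (memLp_mul p.fn p.continuous φ).toLp _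
  map_add' φ χ := by
    rw [← MemLp.toLp_add]
    congr 1
    funext r
    simp
  map_smul' c φ := by
    rw [RingHom.id_apply, ← MemLp.toLp_const_smul]
    congr 1
    funext r
    exact smul_comm (p.fn r) c (φ.fn r)

lemma mulTest_apply (p : Multiplier M) (φ : TestSpace T M) :
    mulTest T M p φ = (memLp_mul p.fn p.continuous φ).toLp _ := rfl

lemma norm_sq_mulTest (p : Multiplier M) (φ : TestSpace T M) :
    ‖mulTest T M p φ‖ ^ 2 = ∫ r in M.interval, r * p.fn r ^ 2 * ‖φ.fn r‖ ^ 2 := by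
  rw [mulTest_apply, norm_toLp_sq]
  simp [norm_smul, mul_pow, mul_assoc]

lemma integral_weight_le (φ : TestSpace T M) :
    ∫ r in M.interval, M.weight * r ^ 3 * ‖φ.fn r‖ ^ 2 ≤ ‖φ‖ ^ 2 := by
  refine le_trans ?_ (norm_sq_ge φ)
  refine setIntegral_mono_on (integrable_weight φ _ (by fun_prop)).integrableOn
    ((integrable_deriv φ).add (integrable_weight φ _ (by fun_prop))).integrableOn
    M.measurableSet_interval fun r hr => ?_
  have : 0 < r := M.interval_subset hr
  have : 0 ≤ r * ‖deriv φ.fn r‖ ^ 2 := by positivity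
  linarith

lemma integral_deriv_le (φ : TestSpace T M) :
    ∫ r in M.interval, r * ‖deriv φ.fn r‖ ^ 2 ≤ ‖φ‖ ^ 2 := by
  refine le_trans ?_ (norm_sq_ge φ)
  refine setIntegral_mono_on (integrable_deriv φ).integrableOn
    ((integrable_deriv φ).add (integrable_weight φ _ (by fun_prop))).integrableOn
    M.measurableSet_interval fun r hr => ?_
  have : 0 < r := M.interval_subset hr
  have := M.weight_nonneg
  have : 0 ≤ M.weight * r ^ 3 * ‖φ.fn r‖ ^ 2 := by positivity
  linarith

/-- The constant part of the growth bound is controlled by the embedding into `H(I, 1)`, the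
quadratic part by the `r³` term of the norm. -/
lemma mulTest_bound (T : AngularOp F) (M : Model) (p : Multiplier M) :
    ∃ C : ℝ, ∀ φ : TestSpace T M, ‖mulTest T M p φ‖ ≤ C * ‖φ‖ := by
  obtain ⟨K, hK⟩ := testIncl_bound T M
  obtain ⟨C, hC, h⟩ := p.bound
  refine ⟨Real.sqrt (C * (K ^ 2 + 1)), fun φ => ?_⟩
  have i1 := (integrable_weight φ _ continuous_id).integrableOn (s := M.interval)
  have i2 := (integrable_weight φ (fun r => M.weight * r ^ 3) (by fun_prop)).integrableOn
    (s := M.interval)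
  have h1 : ‖mulTest T M p φ‖ ^ 2
      ≤ C * (∫ r in M.interval, (id r * ‖φ.fn r‖ ^ 2 + M.weight * r ^ 3 * ‖φ.fn r‖ ^ 2)) := by
    rw [norm_sq_mulTest, ← integral_const_mul]
    refine setIntegral_mono_on (integrable_weight φ _ ?_).integrableOn
      ((i1.add i2).const_mul C) M.measurableSet_interval fun r hr => ?_
    · have := p.continuous
      fun_prop
    · have h0 : 0 < r := M.interval_subset hr
      have := mul_le_mul_of_nonneg_left (h r hr) (by positivity : 0 ≤ r * ‖φ.fn r‖ ^ 2)
      simp only [id]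
      linarith
  rw [integral_add i1 i2] at h1
  have h2 := norm_sq_testIncl φ
  have h3 : ‖testIncl T M φ‖ ^ 2 ≤ (K * ‖φ‖) ^ 2 := by
    gcongr
    exact hK φ
  have h4 := integral_weight_le φ
  refine le_of_sq_le_sq ?_ (by positivity)
  rw [mul_pow, Real.sq_sqrt (by positivity)]
  refine h1.trans ?_
  rw [mul_assoc]
  gcongr
  simp only [id]
  rw [← h2]
  linarith

lemma inner_mulTest (p s : Multiplier M) (φ χ : TestSpace T M) :
    inner ℂ (mulTest T M p φ) (mulTest T M s χ)
      = ∫ r in M.interval, ((r * (p.fn r * s.fn r) : ℝ) : ℂ) * inner ℂ (φ.fn r) (χ.fn r) := by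
  rw [mulTest_apply, mulTest_apply, inner_toLp_toLp]
  refine integral_congr_ae (Eventually.of_forall fun r => ?_)
  simp only [inner_smul_left_eq_smul, inner_smul_right_eq_smul, Complex.real_smul]
  push_cast
  ring

lemma denseRange_coe : DenseRange ((↑) : TestSpace T M → FormSpace T M) :=
  UniformSpace.Completion.denseRange_coe

section Complete

variable [CompleteSpace F]

/-- Multiplication by `p` from `H_i(I_i)` to `H(I_i, 1)`. -/
def mulOp (T : AngularOp F) (M : Model) (p : Multiplier M) : FormSpace T M →L[ℂ] WaveSpace F M :=
  ((mulTest T M p).mkContinuous _ (mulTest_bound T M p).choose_spec).extend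
    (UniformSpace.Completion.toComplL : TestSpace T M →L[ℂ] FormSpace T M)

@[simp] lemma mulOp_coe (p : Multiplier M) (φ : TestSpace T M) :
    mulOp T M p φ = mulTest T M p φ :=
  ContinuousLinearMap.extend_eq _ denseRange_coe
    (UniformSpace.Completion.isUniformInducing_coe _) φ

/-- The constant multiplier `1`. -/
def Multiplier.one (M : Model) : Multiplier M where
  fn _ := 1
  continuous := continuous_const
  bound := ⟨1, one_pos.le, fun r _ => by
    have := mul_nonneg M.weight_nonneg (sq_nonneg r)
    linarith⟩

/-- This makes the embedding, so far only a map between completions, available as a continuous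
linear operator. -/
lemma embed_eq_mulOp (ψ : FormSpace T M) : embed T M ψ = mulOp T M (.one M) ψ := by
  refine congrFun (denseRange_coe.equalizer (g := embed T M) (h := mulOp T M (.one M))
    UniformSpace.Completion.continuous_extension
    (mulOp T M (.one M)).continuous ?_) ψ
  funext φ
  simp only [Function.comp_apply, embed_coe, mulOp_coe]
  simp [testIncl_apply, mulTest_apply, Multiplier.one]

lemma continuous_embed : Continuous (embed T M) :=
  UniformSpace.Completion.continuous_extension

/-- The quadratic form `∫ r p² ⟨φ, ψ⟩` is given by pairing with `p² φ` in `H(I, 1)`. -/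
lemma integral_inner_sq_smul (p : Multiplier M) (φ : TestSpace T M) (ψ : FormSpace T M) :
    ∫ r, inner ℂ (p.fn r ^ 2 • φ.fn r) (embed T M ψ r) ∂(radialMeasure M)
      = inner ℂ (mulOp T M p φ) (mulOp T M p ψ) := by
  have hm := memLp_mul (fun r => p.fn r ^ 2) (p.continuous.pow 2) φ
  rw [integral_inner_eq_inner_toLp hm]
  refine congrFun (denseRange_coe.equalizer
    (g := fun ψ : FormSpace T M => inner ℂ (hm.toLp _) (embed T M ψ))
    (h := fun ψ : FormSpace T M => inner ℂ (mulOp T M p φ) (mulOp T M p ψ))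
    (continuous_const.inner continuous_embed)
    (continuous_const.inner (mulOp T M p).continuous) ?_) ψ
  funext χ
  simp only [Function.comp_apply, embed_coe, mulOp_coe, inner_mulTest]
  rw [testIncl_apply, inner_toLp_toLp]
  refine integral_congr_ae (Eventually.of_forall fun r => ?_)
  simp only [inner_smul_left_eq_smul, Complex.real_smul]
  push_cast
  ring

end Complete

/-! ### Integration by parts -/

lemma continuous_radialDeriv (φ : TestSpace T M) :
    Continuous (deriv fun s : ℝ => s • deriv φ.fn s) := by
  have h : ContDiff ℝ 1 fun s : ℝ => s • deriv φ.fn s :=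
    contDiff_id.smul ((contDiff_infty_iff_deriv.mp φ.contDiff).2.of_le (by simp))
  exact h.continuous_deriv le_rfl

lemma radialDeriv_zero_of (φ : TestSpace T M) {r : ℝ} (hr : r ∉ tsupport φ.fn) :
    deriv (fun s : ℝ => s • deriv φ.fn s) r = 0 := by
  have : (fun s : ℝ => s • deriv φ.fn s) =ᶠ[𝓝 r] fun _ => 0 := by
    filter_upwards [(isClosed_tsupport φ.fn).isOpen_compl.mem_nhds hr] with s hs
    rw [φ.deriv_zero_of hs, smul_zero]
  rw [this.deriv_eq, deriv_const]

/-- The integrand is the derivative of `⟨r φ', χ⟩`, which has compact support. -/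
lemma integral_radialDeriv (φ χ : TestSpace T M) :
    ∫ r in M.interval, (inner ℂ (deriv (fun s : ℝ => s • deriv φ.fn s) r) (χ.fn r)
      + (r : ℂ) * inner ℂ (deriv φ.fn r) (deriv χ.fn r)) = 0 := by
  have c1 := continuous_radialDeriv φ
  have c2 := φ.continuous_deriv
  have c3 := χ.continuous_deriv
  have c4 := χ.contDiff.continuous
  rw [setIntegral_eq_integral_of_forall_compl_eq_zero]
  · refine integral_eq_zero_of_hasDerivAt_of_integrable
      (f := fun r => inner ℂ (r • deriv φ.fn r) (χ.fn r)) ?_ ?_ ?_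
    · intro r
      have h1 : HasDerivAt (fun s : ℝ => s • deriv φ.fn s)
          (deriv (fun s : ℝ => s • deriv φ.fn s) r) r := by
        have h : ContDiff ℝ 1 fun s : ℝ => s • deriv φ.fn s :=
          contDiff_id.smul ((contDiff_infty_iff_deriv.mp φ.contDiff).2.of_le (by simp))
        exact (h.differentiable one_ne_zero r).hasDerivAt
      have h2 := h1.inner ℂ (χ.diff r).hasDerivAt
      rw [inner_smul_left_eq_smul, Complex.real_smul, add_comm] at h2
      exact h2
    · refine integrable_of_support χ _ ?_ fun r hr => ?_
      · exact ((c1.inner c4).add (Complex.continuous_ofReal.mul (c2.inner c3))).continuousOn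
      · simp [χ.fn_zero_of hr, χ.deriv_zero_of hr]
    · refine integrable_of_support χ _ ?_ fun r hr => ?_
      · exact ((continuous_id.smul c2).inner c4).continuousOn
      · simp [χ.fn_zero_of hr]
  · intro r hr
    have h : r ∉ tsupport χ.fn := fun h => hr (χ.tsupport_subset h)
    simp [χ.fn_zero_of h, χ.deriv_zero_of h]

lemma hamiltonian_zero_of (q : ℝ → ℝ) (φ : TestSpace T M) {r : ℝ} (hr : r ∉ tsupport φ.fn) :
    hamiltonian q φ r = 0 := by
  simp [hamiltonian, radialDeriv_zero_of φ hr, φ.fn_zero_of hr]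

lemma continuousOn_hamiltonian {q : ℝ → ℝ} (hq : Continuous q) (φ : TestSpace T M) :
    ContinuousOn (hamiltonian q φ) (Ioi 0) := by
  have c1 := continuous_radialDeriv φ
  have c2 := φ.contDiff.continuous
  have c3 : ContinuousOn (fun r : ℝ => r⁻¹) (Ioi 0) :=
    continuousOn_inv₀.mono fun r hr => ne_of_gt hr
  have c4 : ContinuousOn (fun r : ℝ => (r ^ 2)⁻¹) (Ioi 0) :=
    (continuousOn_pow 2).inv₀ fun r hr => pow_ne_zero 2 (ne_of_gt hr)
  exact (((c3.smul c1.continuousOn).neg).sub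
    (c4.smul (T.op.continuous.comp c2).continuousOn)).add (hq.smul c2).continuousOn

/-- The operator that belongs to the scalar product of `H_i(I_i)`. -/
abbrev formHamiltonian (φ : TestSpace T M) : ℝ → F := hamiltonian (fun r => M.weight * r ^ 2) φ

lemma memLp_formHamiltonian (φ : TestSpace T M) :
    MemLp (formHamiltonian φ) 2 (radialMeasure M) :=
  memLp_of_support φ (continuousOn_hamiltonian (by fun_prop) φ)
    fun _ hr => hamiltonian_zero_of _ φ hr

/-- The factor `r` of the measure cancels the `r⁻¹` of the operator, and the two densities differ by
the total derivative of `integral_radialDeriv`. -/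
lemma integral_formHamiltonian_testIncl (φ χ : TestSpace T M) :
    inner ℂ ((memLp_formHamiltonian φ).toLp _) (testIncl T M χ) = inner ℂ φ χ := by
  rw [testIncl_apply, inner_toLp_toLp, TestSpace.inner_def, ← sub_eq_zero, ← integral_sub,
    ← neg_eq_zero, ← integral_neg, ← integral_radialDeriv φ χ]
  · refine setIntegral_congr_fun M.measurableSet_interval fun r hr => ?_
    have h0 : (r : ℂ) ≠ 0 := by exact_mod_cast (M.interval_subset hr : 0 < r).ne'
    simp only [hamiltonian, formDensity, inner_add_left, inner_sub_left, inner_neg_left,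
      inner_smul_left_eq_smul, Complex.real_smul]
    push_cast
    field_simp
    ring
  · refine (integrable_of_support χ _ ?_ fun r hr => ?_).integrableOn
    · exact Complex.continuous_ofReal.continuousOn.mul
        ((continuousOn_hamiltonian (by fun_prop) φ).inner χ.contDiff.continuous.continuousOn)
    · simp [χ.fn_zero_of hr]
  · exact (integrable_formDensity φ χ).integrableOn

/-- For a fixed test function `φ` the function `formHamiltonian φ` is square integrable, so both
sides are continuous in `ψ` and the identity extends from test functions by density. -/
lemma integral_formHamiltonian [CompleteSpace F] (φ : TestSpace T M) (ψ : FormSpace T M) :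
    ∫ r, inner ℂ (formHamiltonian φ r) (embed T M ψ r) ∂(radialMeasure M)
      = inner ℂ (φ : FormSpace T M) ψ := by
  rw [integral_inner_eq_inner_toLp (memLp_formHamiltonian φ)]
  refine congrFun (denseRange_coe.equalizer
    (g := fun ψ : FormSpace T M => inner ℂ ((memLp_formHamiltonian φ).toLp _) (embed T M ψ))
    (h := fun ψ : FormSpace T M => inner ℂ (φ : FormSpace T M) ψ)
    (continuous_const.inner continuous_embed) (continuous_const.inner continuous_id) ?_) ψ
  funext χ
  simp only [Function.comp_apply, embed_coe, UniformSpace.Completion.inner_coe]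
  exact integral_formHamiltonian_testIncl φ χ

end Radial

/-! ### The weak equation as an operator pencil, density, and point evaluations -/

namespace Radial

variable {F : Type*} [NormedAddCommGroup F] [InnerProductSpace ℂ F] {T : AngularOp F} {M : Model}

lemma Model.isOpen_interval (M : Model) : IsOpen M.interval := by
  cases M with
  | bounded r₀ => exact isOpen_Ioo
  | unbounded => exact isOpen_Ioi

lemma ae_mem_interval (M : Model) : ∀ᵐ r ∂(radialMeasure M), r ∈ M.interval :=
  (withDensity_absolutelyContinuous _ _).ae_le (ae_restrict_mem M.measurableSet_interval)

lemma setIntegral_interval_eq {G : Type*} [NormedAddCommGroup G] [NormedSpace ℝ G]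
    (φ : TestSpace T M) {h : ℝ → G} (h0 : ∀ r, r ∉ tsupport φ.fn → h r = 0) :
    ∫ r in M.interval, h r = ∫ r, h r :=
  setIntegral_eq_integral_of_forall_compl_eq_zero
    fun r hr => h0 r fun h => hr (φ.tsupport_subset h)

lemma integrable_inner_toLp {h : ℝ → F} (hh : MemLp h 2 (radialMeasure M)) (u : WaveSpace F M) :
    Integrable (fun r => inner ℂ (h r) (u r)) (radialMeasure M) := by
  refine (L2.integrable_inner (𝕜 := ℂ) (hh.toLp h) u).congr ?_
  filter_upwards [hh.coeFn_toLp] with r hr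
  rw [hr]

/-! ### The eigenvalue problem as an operator pencil -/

section Complete

variable [CompleteSpace F]

/-- The operator of the quadratic form `∫ r p² ‖ψ‖²` on `H_i(I_i)`. -/
def gram (T : AngularOp F) (M : Model) (p : Multiplier M) : FormSpace T M →L[ℂ] FormSpace T M :=
  ContinuousLinearMap.adjoint (mulOp T M p) ∘L mulOp T M p

lemma inner_gram (p : Multiplier M) (ψ χ : FormSpace T M) :
    inner ℂ ψ (gram T M p χ) = inner ℂ (mulOp T M p ψ) (mulOp T M p χ) := by
  rw [gram, ContinuousLinearMap.comp_apply, ContinuousLinearMap.adjoint_inner_right]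

lemma isPositive_gram (p : Multiplier M) : (gram T M p).IsPositive :=
  ContinuousLinearMap.isPositive_adjoint_comp_self _

lemma re_inner_gram_self (p : Multiplier M) (ψ : FormSpace T M) :
    (inner ℂ (gram T M p ψ) ψ).re = ‖mulOp T M p ψ‖ ^ 2 := by
  rw [gram, ContinuousLinearMap.comp_apply, ContinuousLinearMap.adjoint_inner_left]
  exact inner_self_eq_norm_sq (𝕜 := ℂ) _

/-- The part `M.weight * r ^ 2` of the potential belongs to the scalar product of `H_i(I_i)`; the
multiples of `p²` and `s²` turn into `gram`. Testing against the dense set of test functions then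
determines the operator equation. -/
lemma isEigenpair_iff (p s : Multiplier M) {q w : ℝ → ℝ} {α β γ l : ℝ}
    (hq : ∀ r ∈ M.interval, q r = M.weight * r ^ 2 + α * p.fn r ^ 2 + β * s.fn r ^ 2)
    (hw : ∀ r ∈ M.interval, w r = γ * p.fn r ^ 2) (ψ : FormSpace T M) :
    IsEigenpair q w l ψ ↔
      ψ + (α : ℂ) • gram T M p ψ + (β : ℂ) • gram T M s ψ
        = (l : ℂ) • (γ : ℂ) • gram T M p ψ := by
  have e1 (φ : TestSpace T M) :
      ∫ r, inner ℂ (hamiltonian q φ r) (embed T M ψ r) ∂(radialMeasure M)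
        = inner ℂ (φ : FormSpace T M)
          (ψ + (α : ℂ) • gram T M p ψ + (β : ℂ) • gram T M s ψ) := by
    have h1 : (fun r => inner ℂ (hamiltonian q φ r) (embed T M ψ r)) =ᵐ[radialMeasure M] fun r =>
        inner ℂ (formHamiltonian φ r) (embed T M ψ r)
        + (α : ℂ) * inner ℂ (p.fn r ^ 2 • φ.fn r) (embed T M ψ r)
        + (β : ℂ) * inner ℂ (s.fn r ^ 2 • φ.fn r) (embed T M ψ r) := by
      filter_upwards [ae_mem_interval M] with r hr
      simp only [hamiltonian, hq r hr, inner_add_left, inner_smul_left_eq_smul, Complex.real_smul,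
        add_smul, mul_smul]
      ring
    have i1 := integrable_inner_toLp (memLp_formHamiltonian φ) (embed T M ψ)
    have i2 := integrable_inner_toLp (memLp_mul (fun r => p.fn r ^ 2) (p.continuous.pow 2) φ)
      (embed T M ψ)
    have i3 := integrable_inner_toLp (memLp_mul (fun r => s.fn r ^ 2) (s.continuous.pow 2) φ)
      (embed T M ψ)
    have i12 : Integrable (fun r => inner ℂ (formHamiltonian φ r) (embed T M ψ r)
        + (α : ℂ) * inner ℂ (p.fn r ^ 2 • φ.fn r) (embed T M ψ r)) (radialMeasure M) :=
      i1.add (i2.const_mul _)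
    rw [integral_congr_ae h1, integral_add i12 (i3.const_mul _),
      integral_add i1 (i2.const_mul _), integral_const_mul, integral_const_mul,
      integral_formHamiltonian, integral_inner_sq_smul, integral_inner_sq_smul]
    simp only [inner_add_right, inner_smul_right, inner_gram]
  have e2 (φ : TestSpace T M) :
      (l : ℂ) * ∫ r, inner ℂ (w r • φ.fn r) (embed T M ψ r) ∂(radialMeasure M)
        = inner ℂ (φ : FormSpace T M) ((l : ℂ) • (γ : ℂ) • gram T M p ψ) := by
    have h1 : (fun r => inner ℂ (w r • φ.fn r) (embed T M ψ r)) =ᵐ[radialMeasure M] fun r =>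
        (γ : ℂ) * inner ℂ (p.fn r ^ 2 • φ.fn r) (embed T M ψ r) := by
      filter_upwards [ae_mem_interval M] with r hr
      simp only [hw r hr, inner_smul_left_eq_smul, Complex.real_smul, mul_smul]
    rw [integral_congr_ae h1, integral_const_mul, integral_inner_sq_smul]
    simp only [inner_smul_right, inner_gram]
  unfold IsEigenpair
  simp only [e1, e2]
  refine ⟨fun h => ext_inner_left ℂ fun χ => ?_, fun h φ => by rw [h]⟩
  exact congrFun (denseRange_coe.equalizer (continuous_id.inner continuous_const)
    (continuous_id.inner continuous_const) (funext h)) χ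

/-- A multiplier without zeros acts injectively. -/
lemma mulOp_injective (p : Multiplier M) (hp : ∀ r, 0 < r → 0 < p.fn r) :
    Function.Injective (mulOp T M p) := by
  refine (injective_iff_map_eq_zero _).mpr fun ψ hψ => ext_inner_left ℂ fun χ => ?_
  refine congrFun (denseRange_coe.equalizer (continuous_id.inner continuous_const)
    (continuous_id.inner continuous_const) (funext fun φ : TestSpace T M => ?_)) χ
  -- Division by `p` is harmless on the compact support of `φ`. Thus `⟨φ, ψ⟩` is the pairing of this
  -- function with `p ψ` and vanishes if `p ψ` does. An argument of this kind is needed because `ψ`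
  -- is an element of an abstract completion.
  have hm : MemLp (fun r => (p.fn r)⁻¹ • formHamiltonian φ r) 2 (radialMeasure M) :=
    memLp_of_support φ ((p.continuous.continuousOn.inv₀ fun r hr => (hp r hr).ne').smul
      (continuousOn_hamiltonian (by fun_prop) φ)) fun r hr => by
        rw [formHamiltonian, hamiltonian_zero_of _ φ hr, smul_zero]
  have key : inner ℂ (hm.toLp _) (mulOp T M p ψ) = inner ℂ (φ : FormSpace T M) ψ := by
    refine congrFun (denseRange_coe.equalizer
      (g := fun ψ : FormSpace T M => inner ℂ (hm.toLp _) (mulOp T M p ψ))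
      (h := fun ψ : FormSpace T M => inner ℂ (φ : FormSpace T M) ψ)
      (continuous_const.inner (mulOp T M p).continuous)
      (continuous_const.inner continuous_id) ?_) ψ
    funext χ
    simp only [Function.comp_apply, mulOp_coe, UniformSpace.Completion.inner_coe]
    rw [← integral_formHamiltonian_testIncl φ χ, mulTest_apply, testIncl_apply, inner_toLp_toLp,
      inner_toLp_toLp]
    refine setIntegral_congr_fun M.measurableSet_interval fun r hr => ?_
    have h0 : (p.fn r : ℂ) ≠ 0 := by exact_mod_cast (hp r (M.interval_subset hr)).ne'
    simp only [inner_smul_left_eq_smul, inner_smul_right_eq_smul, Complex.real_smul]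
    push_cast
    field_simp
  simp only [Function.comp_apply, id, inner_zero_right]
  rw [← key, hψ, inner_zero_right]

lemma gram_injective (p : Multiplier M) (hp : ∀ r, 0 < r → 0 < p.fn r) :
    Function.Injective (gram T M p) := by
  refine (injective_iff_map_eq_zero _).mpr fun ψ hψ => ?_
  refine (injective_iff_map_eq_zero _).mp (mulOp_injective p hp) ψ ?_
  have h := re_inner_gram_self p ψ
  rw [hψ, inner_zero_left, Complex.zero_re] at h
  exact norm_eq_zero.mp (pow_eq_zero_iff two_ne_zero |>.mp h.symm)

/-! ### `H_i(I_i)` is dense in `H(I_i, 1)` -/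

/-- An element orthogonal to all products of a scalar test function with a fixed vector vanishes
almost everywhere, by the fundamental lemma of the calculus of variations. -/
lemma denseRange_mulOp_one : DenseRange (mulOp T M (.one M)) := by
  have h : ((mulOp T M (.one M)).range).topologicalClosure = ⊤ := by
    rw [Submodule.topologicalClosure_eq_top_iff, Submodule.eq_bot_iff]
    intro u hu
    have h1 : ∀ᵐ r ∂(radialMeasure M), r ∈ M.interval → (u : ℝ → F) r = 0 := by
      refine M.isOpen_interval.ae_eq_zero_of_integral_contDiff_smul_eq_zero
        (((Lp.memLp u).locallyIntegrable one_le_two).locallyIntegrableOn _) fun f hf hc hs => ?_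
      refine ext_inner_left ℂ fun v => ?_
      have hi : Integrable (fun r => f r • (u : ℝ → F) r) (radialMeasure M) :=
        ((Lp.memLp u).locallyIntegrable one_le_two).integrable_smul_left_of_hasCompactSupport
          hf.continuous hc
      let φ : TestSpace T M := ⟨fun r => f r • v, hf.smul contDiff_const, hc.smul_right,
        (tsupport_smul_subset_left f _).trans hs⟩
      have h2 : inner ℂ (mulOp T M (.one M) φ) u = 0 := hu _ ⟨φ, rfl⟩
      rw [← embed_eq_mulOp, embed_coe, testIncl_apply, ← integral_inner_eq_inner_toLp] at h2
      rw [inner_zero_right, ← integral_inner hi, ← h2]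
      refine integral_congr_ae (Eventually.of_forall fun r => ?_)
      change inner ℂ v (f r • (u : ℝ → F) r) = inner ℂ (f r • v) ((u : ℝ → F) r)
      rw [inner_smul_left_eq_smul, inner_smul_right_eq_smul]
    refine (Lp.eq_zero_iff_ae_eq_zero).mpr ?_
    filter_upwards [h1, ae_mem_interval M] with r hr hr' using hr hr'
  have h2 := congrArg (fun K : Submodule ℂ (WaveSpace F M) => (K : Set (WaveSpace F M))) h
  rw [DenseRange, dense_iff_closure_eq]
  exact h2

/-! ### Evaluation at points -/

end Complete

lemma hasDerivAt_norm_sq (φ : TestSpace T M) (r : ℝ) :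
    HasDerivAt (fun r => ‖φ.fn r‖ ^ 2) (2 * (inner ℂ (φ.fn r) (deriv φ.fn r)).re) r := by
  have h1 := (Complex.reCLM.hasFDerivAt.comp_hasDerivAt r
    ((φ.diff r).hasDerivAt.inner ℂ (φ.diff r).hasDerivAt))
  have h4 : (Complex.reCLM ∘ fun r => inner ℂ (φ.fn r) (φ.fn r)) = fun r => ‖φ.fn r‖ ^ 2 :=
    funext fun r => inner_self_eq_norm_sq (𝕜 := ℂ) _
  rw [h4, Complex.reCLM_apply, Complex.add_re, ← inner_conj_symm (deriv φ.fn r) (φ.fn r),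
    Complex.conj_re, ← two_mul] at h1
  exact h1

lemma continuous_re_inner_deriv (φ : TestSpace T M) :
    Continuous fun r => (inner ℂ (φ.fn r) (deriv φ.fn r)).re :=
  Complex.continuous_re.comp (φ.contDiff.continuous.inner φ.continuous_deriv)

lemma abs_re_inner_deriv_le (φ : TestSpace T M) (r : ℝ) :
    |(inner ℂ (φ.fn r) (deriv φ.fn r)).re| ≤ ‖φ.fn r‖ * ‖deriv φ.fn r‖ :=
  (Complex.abs_re_le_norm _).trans (norm_inner_le_norm _ _)

lemma mul_norm_sq_nonneg {G : Type*} [NormedAddCommGroup G] (φ : TestSpace T M) {h : ℝ → G}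
    (h0 : ∀ r, r ∉ tsupport φ.fn → h r = 0) (r : ℝ) : 0 ≤ r * ‖h r‖ ^ 2 := by
  rcases le_or_gt r 0 with hr | hr
  · have : r ∉ tsupport φ.fn := fun h => absurd (M.interval_subset (φ.tsupport_subset h)) hr.not_gt
    simp [h0 r this]
  · positivity

/-- The derivative of `‖φ‖²` is integrated from `x` to a point beyond the support. On this range `1
≤ r / x`, which supplies the weight `r`, and `2 |⟨φ, φ'⟩| ≤ ‖φ‖² + ‖φ'‖²`. -/
lemma norm_sq_le_of_pos {x : ℝ} (hx : 0 < x) (φ : TestSpace T M) :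
    ‖φ.fn x‖ ^ 2 ≤ x⁻¹ * (‖testIncl T M φ‖ ^ 2 + ‖φ‖ ^ 2) := by
  obtain ⟨b, hb⟩ := φ.compact.isCompact.bddAbove
  have hy : max x (b + 1) ∉ tsupport φ.fn := fun h =>
    absurd ((le_max_right x (b + 1)).trans (hb h)) (by linarith)
  have hxy : x ≤ max x (b + 1) := le_max_left _ _
  set y := max x (b + 1)
  have c0 := continuous_re_inner_deriv φ
  have c1 := φ.contDiff.continuous
  have c2 := φ.continuous_deriv
  have h1 : ∫ r in x..y, 2 * (inner ℂ (φ.fn r) (deriv φ.fn r)).re = -‖φ.fn x‖ ^ 2 := by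
    rw [intervalIntegral.integral_eq_sub_of_hasDerivAt (fun r _ => hasDerivAt_norm_sq φ r)
      (Continuous.intervalIntegrable (by fun_prop) _ _), φ.fn_zero_of hy]
    simp
  have h2 : ‖φ.fn x‖ ^ 2
      ≤ ∫ r in x..y, x⁻¹ * (r * ‖φ.fn r‖ ^ 2 + r * ‖deriv φ.fn r‖ ^ 2) := by
    rw [← neg_neg (‖φ.fn x‖ ^ 2), ← h1, ← intervalIntegral.integral_neg]
    refine intervalIntegral.integral_mono_on hxy (Continuous.intervalIntegrable (by fun_prop) _ _)
      (Continuous.intervalIntegrable (by fun_prop) _ _) fun r hr => ?_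
    have h3 := (abs_le.mp (abs_re_inner_deriv_le φ r)).1
    have h4 : 1 ≤ x⁻¹ * r := by
      rw [inv_mul_eq_div, le_div_iff₀ hx, one_mul]
      exact hr.1
    have h5 := mul_le_mul_of_nonneg_right h4
      (by positivity : 0 ≤ ‖φ.fn r‖ ^ 2 + ‖deriv φ.fn r‖ ^ 2)
    nlinarith [sq_nonneg (‖φ.fn r‖ - ‖deriv φ.fn r‖)]
  refine h2.trans ?_
  have i1 := integrable_weight φ _ continuous_id
  have i2 := integrable_deriv φ
  rw [intervalIntegral.integral_const_mul, intervalIntegral.integral_of_le hxy]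
  refine mul_le_mul_of_nonneg_left ?_ (inv_nonneg.mpr hx.le)
  refine (setIntegral_le_integral (i1.add i2) (Eventually.of_forall fun r => ?_)).trans ?_
  · exact add_nonneg (mul_norm_sq_nonneg φ (fun _ => φ.fn_zero_of) r)
      (mul_norm_sq_nonneg φ (fun _ => φ.deriv_zero_of) r)
  · refine (integral_add i1 i2).trans_le ?_
    rw [norm_sq_testIncl, setIntegral_interval_eq φ fun r hr => by simp [φ.fn_zero_of hr]]
    refine add_le_add le_rfl ?_
    rw [← setIntegral_interval_eq φ fun r hr => by simp [φ.deriv_zero_of hr]]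
    exact integral_deriv_le φ

/-- The evaluation of test functions. -/
def evalTest (T : AngularOp F) (M : Model) (x : ℝ) : TestSpace T M →ₗ[ℂ] F where
  toFun φ := φ.fn x
  map_add' _ _ := rfl
  map_smul' _ _ := rfl

lemma evalTest_bound (T : AngularOp F) (M : Model) {x : ℝ} (hx : 0 < x) :
    ∃ C : ℝ, ∀ φ : TestSpace T M, ‖evalTest T M x φ‖ ≤ C * ‖φ‖ := by
  obtain ⟨K, hK⟩ := testIncl_bound T M
  refine ⟨Real.sqrt (x⁻¹ * (K ^ 2 + 1)), fun φ => le_of_sq_le_sq ?_ (by positivity)⟩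
  rw [mul_pow, Real.sq_sqrt (by positivity)]
  refine (norm_sq_le_of_pos hx φ).trans ?_
  have h : ‖testIncl T M φ‖ ^ 2 ≤ (K * ‖φ‖) ^ 2 := by
    gcongr
    exact hK φ
  rw [mul_assoc]
  gcongr
  linarith

section Complete

variable [CompleteSpace F]

/-- The evaluation of elements of `H_i(I_i)` at a point `x > 0`. -/
def eval (T : AngularOp F) (M : Model) {x : ℝ} (hx : 0 < x) : FormSpace T M →L[ℂ] F :=
  ((evalTest T M x).mkContinuous _ (evalTest_bound T M hx).choose_spec).extend
    (UniformSpace.Completion.toComplL : TestSpace T M →L[ℂ] FormSpace T M)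

@[simp] lemma eval_coe {x : ℝ} (hx : 0 < x) (φ : TestSpace T M) : eval T M hx φ = φ.fn x :=
  ContinuousLinearMap.extend_eq _ denseRange_coe
    (UniformSpace.Completion.isUniformInducing_coe _) φ

/-- Polynomials times a bump function times a fixed vector form an infinite dimensional space of
test functions. Continuous point evaluations show that it injects into the completion: a polynomial
in the kernel has infinitely many roots where the bump function does not vanish. -/
lemma not_finiteDimensional_formSpace [Nontrivial F] (T : AngularOp F)
    (hM : M.interval.Nonempty) : ¬ FiniteDimensional ℂ (FormSpace T M) := by
  obtain ⟨v, hv⟩ := exists_ne (0 : F)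
  obtain ⟨x, hx⟩ := hM
  obtain ⟨f, hfs, hfc, hf, -, hfx⟩ :=
    exists_contDiff_tsupport_subset (n := ⊤) (M.isOpen_interval.mem_nhds hx)
  have hp (P : Polynomial ℂ) : ContDiff ℝ ∞ fun r : ℝ => P.eval (r : ℂ) :=
    ((Polynomial.contDiff_aeval P ∞).restrict_scalars ℝ).comp Complex.ofRealCLM.contDiff
  let A : Polynomial ℂ →ₗ[ℂ] TestSpace T M :=
    { toFun P := ⟨fun r => f r • P.eval (r : ℂ) • v,
        hf.smul ((hp P).smul contDiff_const), hfc.smul_right,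
        (tsupport_smul_subset_left f _).trans hfs⟩
      map_add' P Q := by
        refine Subtype.ext (funext fun r => ?_)
        change f r • (P + Q).eval (r : ℂ) • v = f r • P.eval (r : ℂ) • v + f r • Q.eval (r : ℂ) • v
        rw [Polynomial.eval_add, add_smul, smul_add]
      map_smul' c P := by
        refine Subtype.ext (funext fun r => ?_)
        change f r • (c • P).eval (r : ℂ) • v = c • f r • P.eval (r : ℂ) • v
        rw [Polynomial.eval_smul, smul_eq_mul, mul_smul, smul_comm] }
  intro hfin
  refine Polynomial.not_finite (R := ℂ) (Module.Finite.of_injective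
    ((UniformSpace.Completion.toComplL : TestSpace T M →L[ℂ] FormSpace T M).toLinearMap ∘ₗ A) ?_)
  refine (injective_iff_map_eq_zero _).mpr fun P hP => ?_
  have hP' : ((A P : TestSpace T M) : FormSpace T M) = 0 := hP
  refine Polynomial.eq_zero_of_infinite_isRoot P ?_
  have hU : {r : ℝ | 0 < r ∧ f r ≠ 0} ∈ 𝓝 x :=
    inter_mem (Ioi_mem_nhds (M.interval_subset hx))
      (hf.continuous.continuousAt.eventually_ne (by simp [hfx]))
  refine ((infinite_of_mem_nhds x hU).image Complex.ofReal_injective.injOn).mono ?_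
  rintro _ ⟨r, ⟨hr, hfr⟩, rfl⟩
  have h1 := eval_coe hr (A P)
  rw [hP', map_zero] at h1
  have h2 : f r • P.eval (r : ℂ) • v = 0 := h1.symm
  simpa [hfr, hv] using h2

end Complete

end Radial

/-! ### Compactness, the radial spectral theorem, and coercivity -/

namespace Radial

variable {F : Type*} [NormedAddCommGroup F] [InnerProductSpace ℂ F] {T : AngularOp F} {M : Model}

/-! ### Compactness of multiplication operators -/

/-- The primitive `r² - x²` of `2 r` vanishes at `x`, so integration by parts leaves only the
boundary term at `y`. Since `r² - x² ≤ 2 r (y - x)`, Young's inequality absorbs half of `2 r ‖φ‖²`;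
this also works for `x = 0`. -/
lemma intervalIntegral_mul_norm_sq_le (φ : TestSpace T M) {x y : ℝ} (hx : 0 ≤ x) (hxy : x ≤ y) :
    ∫ r in x..y, r * ‖φ.fn r‖ ^ 2 ≤ 4 * (y - x) ^ 2 * (∫ r in x..y, r * ‖deriv φ.fn r‖ ^ 2)
      + (y ^ 2 - x ^ 2) * ‖φ.fn y‖ ^ 2 := by
  have c0 := continuous_re_inner_deriv φ
  have c1 := φ.contDiff.continuous
  have c2 := φ.continuous_deriv
  have h1 : ∫ r in x..y, (2 * r * ‖φ.fn r‖ ^ 2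
      + (r ^ 2 - x ^ 2) * (2 * (inner ℂ (φ.fn r) (deriv φ.fn r)).re))
        = (y ^ 2 - x ^ 2) * ‖φ.fn y‖ ^ 2 := by
    rw [intervalIntegral.integral_eq_sub_of_hasDerivAt
      (f := fun r => (r ^ 2 - x ^ 2) * ‖φ.fn r‖ ^ 2)]
    · ring
    · intro r _
      have h := (((hasDerivAt_pow 2 r).sub_const (x ^ 2))).mul (hasDerivAt_norm_sq φ r)
      exact h.congr_deriv (by norm_num)
    · exact Continuous.intervalIntegrable (by fun_prop) _ _
  rw [← h1, ← intervalIntegral.integral_const_mul, ← intervalIntegral.integral_add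
    (Continuous.intervalIntegrable (by fun_prop) _ _)
    (Continuous.intervalIntegrable (by fun_prop) _ _)]
  refine intervalIntegral.integral_mono_on hxy (Continuous.intervalIntegrable (by fun_prop) _ _)
    (Continuous.intervalIntegrable (by fun_prop) _ _) fun r hr => ?_
  obtain ⟨hr1, hr2⟩ := hr
  have hr0 : 0 ≤ r := hx.trans hr1
  have h3 := (abs_le.mp (abs_re_inner_deriv_le φ r)).1
  have h4 : r ^ 2 - x ^ 2 ≤ 2 * r * (y - x) := by nlinarith
  have h5 : 0 ≤ r ^ 2 - x ^ 2 := by nlinarith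
  have h6 := mul_le_mul_of_nonneg_left h3 h5
  have h7 := mul_le_mul_of_nonneg_right h4
    (by positivity : 0 ≤ ‖φ.fn r‖ * ‖deriv φ.fn r‖)
  have h8 := mul_nonneg hr0 (sq_nonneg (‖φ.fn r‖ - 2 * (y - x) * ‖deriv φ.fn r‖))
  nlinarith

/-- The previous estimate is summed over `N` equal pieces. Only right end points enter, so the point
`0`, where `eval` is not defined, is avoided. -/
lemma intervalIntegral_le_sum_eval (φ : TestSpace T M) {R : ℝ} (hR : 0 < R) {N : ℕ} (hN : 0 < N) :
    ∫ r in (0 : ℝ)..R, r * ‖φ.fn r‖ ^ 2 ≤ 4 * (R / N) ^ 2 * ‖φ‖ ^ 2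
      + R ^ 2 * ∑ k : Fin N, ‖φ.fn ((k + 1 : ℕ) * (R / N))‖ ^ 2 := by
  have c1 := φ.contDiff.continuous
  have c2 := φ.continuous_deriv
  have hN' : (0 : ℝ) < N := by exact_mod_cast hN
  set x : ℕ → ℝ := fun k => k * (R / N) with hx
  have hx0 : x 0 = 0 := by simp [hx]
  have hxN : x N = R := by simp only [hx]; field_simp
  have hxs (k : ℕ) : x (k + 1) - x k = R / N := by simp only [hx]; push_cast; ring
  have hxm (k : ℕ) : x k ≤ x (k + 1) := by
    have : 0 ≤ R / N := by positivity
    linarith [hxs k]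
  have hxp (k : ℕ) : 0 ≤ x k := by positivity
  have hxR {k : ℕ} (hk : k < N) : x (k + 1) ≤ R := by
    rw [← hxN]
    exact monotone_nat_of_le_succ hxm hk
  have s1 := intervalIntegral.sum_integral_adjacent_intervals (f := fun r => r * ‖φ.fn r‖ ^ 2)
    (μ := volume) (a := x) (n := N) fun k _ => Continuous.intervalIntegrable (by fun_prop) _ _
  have s2 := intervalIntegral.sum_integral_adjacent_intervals
    (f := fun r => r * ‖deriv φ.fn r‖ ^ 2) (μ := volume) (a := x) (n := N)
    fun k _ => Continuous.intervalIntegrable (by fun_prop) _ _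
  rw [hx0, hxN] at s1 s2
  have h1 : ∫ r in (0 : ℝ)..R, r * ‖deriv φ.fn r‖ ^ 2 ≤ ‖φ‖ ^ 2 := by
    refine le_trans ?_ (integral_deriv_le φ)
    rw [intervalIntegral.integral_of_le hR.le,
      setIntegral_interval_eq φ fun r hr => by simp [φ.deriv_zero_of hr]]
    exact setIntegral_le_integral (integrable_deriv φ)
      (Eventually.of_forall (mul_norm_sq_nonneg φ fun _ => φ.deriv_zero_of))
  refine le_trans ?_ (add_le_add_left (mul_le_mul_of_nonneg_left h1 (by positivity)) _)
  rw [← s1, ← s2, Finset.mul_sum, Finset.mul_sum, ← Fin.sum_univ_eq_sum_range,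
    ← Fin.sum_univ_eq_sum_range, ← Finset.sum_add_distrib]
  refine Finset.sum_le_sum fun k _ => ?_
  refine (intervalIntegral_mul_norm_sq_le φ (hxp k) (hxm k)).trans ?_
  rw [hxs]
  refine add_le_add le_rfl (mul_le_mul_of_nonneg_right ?_ (sq_nonneg _))
  have := hxR k.2
  have := hxp (k + 1)
  nlinarith [sq_nonneg (x k)]

lemma norm_sq_mulTest_le (p : Multiplier M) {R P ε : ℝ} (hR : 0 < R)
    (h1 : ∀ r ∈ Icc 0 R, p.fn r ^ 2 ≤ P) (hε : 0 ≤ ε)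
    (h2 : ∀ r ∈ M.interval, R < r → p.fn r ^ 2 ≤ ε * (M.weight * r ^ 2)) (φ : TestSpace T M) :
    ‖mulTest T M p φ‖ ^ 2 ≤ P * (∫ r in (0 : ℝ)..R, r * ‖φ.fn r‖ ^ 2) + ε * ‖φ‖ ^ 2 := by
  have i1 : Integrable fun r => P * (r * ‖φ.fn r‖ ^ 2) :=
    (integrable_weight φ _ continuous_id).const_mul P
  have i2 : Integrable fun r => ε * (M.weight * r ^ 3 * ‖φ.fn r‖ ^ 2) :=
    (integrable_weight φ _ (by fun_prop)).const_mul ε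
  have h3 : ‖mulTest T M p φ‖ ^ 2 ≤ ∫ r in M.interval,
      ((Ioc 0 R).indicator (fun r => P * (r * ‖φ.fn r‖ ^ 2)) r
        + ε * (M.weight * r ^ 3 * ‖φ.fn r‖ ^ 2)) := by
    rw [norm_sq_mulTest]
    refine setIntegral_mono_on (integrable_weight φ _ ?_).integrableOn
      ((i1.indicator measurableSet_Ioc).add i2).integrableOn M.measurableSet_interval
      fun r hr => ?_
    · have := p.continuous
      fun_prop
    · have hr0 : 0 < r := M.interval_subset hr
      have hw := M.weight_nonneg
      have hn : 0 ≤ r * ‖φ.fn r‖ ^ 2 := by positivity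
      rcases le_or_gt r R with hrR | hrR
      · rw [indicator_of_mem (show r ∈ Ioc 0 R from ⟨hr0, hrR⟩)]
        have h4 := mul_le_mul_of_nonneg_right (h1 r ⟨hr0.le, hrR⟩) hn
        have h5 : 0 ≤ ε * (M.weight * r ^ 3 * ‖φ.fn r‖ ^ 2) := by positivity
        linarith
      · rw [indicator_of_notMem fun h => absurd h.2 hrR.not_ge]
        have h4 := mul_le_mul_of_nonneg_right (h2 r hr hrR) hn
        linarith
  refine h3.trans ?_
  rw [integral_add (i1.indicator measurableSet_Ioc).integrableOn i2.integrableOn,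
    integral_const_mul,
    setIntegral_interval_eq φ fun r hr => by simp [indicator_apply, φ.fn_zero_of hr],
    integral_indicator measurableSet_Ioc, integral_const_mul,
    ← intervalIntegral.integral_of_le hR.le]
  have := integral_weight_le φ
  gcongr

section Complete

variable [CompleteSpace F]

/-- Multiplication by a function that is small in comparison with the density of the norm of
`H_i(I_i)` near the upper end of the interval is a compact operator. -/
theorem isCompactOperator_mulOp [FiniteDimensional ℂ F] (p : Multiplier M)
    (hp : ∀ ε : ℝ, 0 < ε → ∃ R : ℝ, 0 < R ∧
      ∀ r ∈ M.interval, R < r → p.fn r ^ 2 ≤ ε * (M.weight * r ^ 2)) :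
    IsCompactOperator (mulOp T M p) := by
  refine Pencil.isCompactOperator_of_small (G := F) _ fun ε hε => ?_
  -- Half of `ε²` is spent on the part beyond `R`, the other half on the mesh of the partition of
  -- `(0, R]`.
  obtain ⟨R, hR, h2⟩ := hp (ε ^ 2 / 2) (by positivity)
  obtain ⟨P, hP⟩ := (isCompact_Icc (a := (0 : ℝ)) (b := R)).bddAbove_image
    (f := fun r => p.fn r ^ 2) (p.continuous.pow 2).continuousOn
  have hP1 : ∀ r ∈ Icc 0 R, p.fn r ^ 2 ≤ P := fun r hr => hP (mem_image_of_mem _ hr)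
  have hP0 : 0 ≤ P := (sq_nonneg _).trans (hP1 0 ⟨le_rfl, hR.le⟩)
  -- The second bound gives `4 P R² / N ≤ ε² / 2`; the first gives `N ≤ N²`, which passes to the
  -- required `4 P R² / N²`.
  obtain ⟨N, hN⟩ := exists_nat_gt (max 1 (8 * P * R ^ 2 / ε ^ 2))
  have hN1 : (1 : ℝ) < N := (le_max_left _ _).trans_lt hN
  have hN0 : 0 < N := by exact_mod_cast one_pos.trans hN1
  have hNb : P * (4 * (R / N) ^ 2) ≤ ε ^ 2 / 2 := by
    have h3 := (le_max_right _ _).trans hN.le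
    rw [div_le_iff₀ (by positivity)] at h3
    have h4 : (N : ℝ) ≤ N ^ 2 := by nlinarith
    have h5 : 8 * P * R ^ 2 ≤ N ^ 2 * ε ^ 2 := h3.trans (by gcongr)
    rw [div_pow, ← mul_div_assoc, ← mul_div_assoc, div_le_div_iff₀ (by positivity) (by positivity)]
    linarith
  have hx (k : Fin N) : 0 < ((k + 1 : ℕ) : ℝ) * (R / N) := by positivity
  refine ⟨N, fun k => eval T M (hx k), fun ψ hψ => ?_⟩
  have key : ‖mulOp T M p ψ‖ ^ 2
      ≤ ε ^ 2 * ‖ψ‖ ^ 2 + P * R ^ 2 * ∑ k : Fin N, ‖eval T M (hx k) ψ‖ ^ 2 := by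
    -- An inequality without side conditions extends from test functions to `H_i(I_i)`; test
    -- functions with the prescribed zeros need not be dense among the elements with these zeros, so
    -- the zeros are imposed only afterwards.
    refine denseRange_coe.induction_on (p := fun ψ : FormSpace T M => ‖mulOp T M p ψ‖ ^ 2
      ≤ ε ^ 2 * ‖ψ‖ ^ 2 + P * R ^ 2 * ∑ k : Fin N, ‖eval T M (hx k) ψ‖ ^ 2) ψ
      (isClosed_le (by fun_prop) (by fun_prop)) fun φ => ?_
    simp only [mulOp_coe, eval_coe, UniformSpace.Completion.norm_coe]
    have h5 := norm_sq_mulTest_le p hR hP1 (by positivity) h2 φ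
    have h6 := mul_le_mul_of_nonneg_left (intervalIntegral_le_sum_eval φ hR hN0) hP0
    have h7 := mul_le_mul_of_nonneg_right hNb (sq_nonneg ‖φ‖)
    linarith
  simp only [hψ, norm_zero, zero_pow two_ne_zero, Finset.sum_const_zero, mul_zero, add_zero] at key
  rw [← mul_pow] at key
  exact le_of_sq_le_sq key (by positivity)

/-! ### The eigenvalue problem -/

/-- The spectral theorem for the radial eigenvalue problems: the right-hand side is a compact
operator and the form of the operator is coercive after a shift. -/
theorem exists_eigenbasis [FiniteDimensional ℂ F] [Nontrivial F] (hM : M.interval.Nonempty)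
    (p s : Multiplier M) {q w : ℝ → ℝ} {α β γ : ℝ} (hγ : 0 < γ)
    (hq : ∀ r ∈ M.interval, q r = M.weight * r ^ 2 + α * p.fn r ^ 2 + β * s.fn r ^ 2)
    (hw : ∀ r ∈ M.interval, w r = γ * p.fn r ^ 2)
    (hp0 : ∀ r, 0 < r → 0 < p.fn r)
    (hp : ∀ ε : ℝ, 0 < ε → ∃ R : ℝ, 0 < R ∧
      ∀ r ∈ M.interval, R < r → p.fn r ^ 2 ≤ ε * (M.weight * r ^ 2))
    {b c : ℝ} (hc : 0 < c)
    (hb : ∀ φ : TestSpace T M, c * ‖φ‖ ^ 2 ≤ ‖φ‖ ^ 2 + (α + b * γ) * ‖mulTest T M p φ‖ ^ 2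
      + β * ‖mulTest T M s φ‖ ^ 2) :
    ∃ (Λ : ℕ → ℝ) (ψ : ℕ → FormSpace T M),
      (∀ j, ψ j ≠ 0 ∧ IsEigenpair q w (Λ j) (ψ j)) ∧
      LinearIndependent ℂ ψ ∧
      (∀ (l : ℝ) (χ : FormSpace T M), IsEigenpair q w l χ →
        χ ∈ Submodule.span ℂ (ψ '' {j | Λ j = l})) ∧
      (∀ j, Λ j ≤ Λ (j + 1)) ∧
      Tendsto Λ atTop atTop ∧
      (Submodule.span ℂ (range ψ)).topologicalClosure = ⊤ ∧
      (Submodule.span ℂ (range fun j => embed T M (ψ j))).topologicalClosure = ⊤ := by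
  set K : FormSpace T M →L[ℂ] FormSpace T M := (γ : ℂ) • gram T M p with hK
  set S : FormSpace T M →L[ℂ] FormSpace T M :=
    ContinuousLinearMap.id ℂ _ + ((α + b * γ : ℝ) : ℂ) • gram T M p + (β : ℂ) • gram T M s with hS
  -- Adding `b K` to both sides makes the left-hand operator coercive and replaces the eigenvalue
  -- `l` by `l + b`; the shift is undone in the final sequence.
  have hpair (l : ℝ) (ψ : FormSpace T M) :
      IsEigenpair q w l ψ ↔ S ψ = ((l + b : ℝ) : ℂ) • K ψ := by
    rw [isEigenpair_iff p s hq hw]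
    simp only [hS, hK, add_apply, smul_apply,
      ContinuousLinearMap.id_apply]
    rw [← sub_eq_zero, ← sub_eq_zero (b := ((l + b : ℝ) : ℂ) • _)]
    push_cast
    refine Eq.congr ?_ rfl
    module
  have hSsa : IsSelfAdjoint S :=
    ((IsSelfAdjoint.one _).add
      (IsSelfAdjoint.smul (r := ((α + b * γ : ℝ) : ℂ)) (Complex.conj_ofReal _)
        (isPositive_gram p).isSelfAdjoint)).add
      (IsSelfAdjoint.smul (r := (β : ℂ)) (Complex.conj_ofReal _)
        (isPositive_gram s).isSelfAdjoint)
  have hSc (ψ : FormSpace T M) : c * ‖ψ‖ ^ 2 ≤ (inner ℂ (S ψ) ψ).re := by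
    have h1 : (inner ℂ (S ψ) ψ).re = ‖ψ‖ ^ 2 + (α + b * γ) * ‖mulOp T M p ψ‖ ^ 2
        + β * ‖mulOp T M s ψ‖ ^ 2 := by
      have e : (inner ℂ ψ ψ : ℂ).re = ‖ψ‖ ^ 2 := inner_self_eq_norm_sq (𝕜 := ℂ) ψ
      simp only [hS, add_apply, smul_apply,
        ContinuousLinearMap.id_apply, inner_add_left, inner_smul_left, Complex.conj_ofReal,
        Complex.add_re, Complex.re_ofReal_mul, re_inner_gram_self, e]
    rw [h1]
    refine denseRange_coe.induction_on (p := fun ψ : FormSpace T M => c * ‖ψ‖ ^ 2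
      ≤ ‖ψ‖ ^ 2 + (α + b * γ) * ‖mulOp T M p ψ‖ ^ 2 + β * ‖mulOp T M s ψ‖ ^ 2) ψ
      (isClosed_le (by fun_prop) (by fun_prop)) fun φ => ?_
    simpa only [mulOp_coe, UniformSpace.Completion.norm_coe] using hb φ
  have hKp : K.IsPositive :=
    (isPositive_gram p).smul_of_nonneg (by exact_mod_cast hγ.le)
  have hKc : IsCompactOperator K :=
    ((isCompactOperator_mulOp p hp).clm_comp (ContinuousLinearMap.adjoint (mulOp T M p))).smul
      (γ : ℂ)
  have hKi : Function.Injective K := fun x y h =>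
    gram_injective p hp0 (smul_right_injective _ (by exact_mod_cast hγ.ne' : (γ : ℂ) ≠ 0) h)
  obtain ⟨Λ, ψ, h1, h2, h3, h4, h5, h6⟩ := Pencil.exists_eigenbasis
    (not_finiteDimensional_formSpace T hM) S K hSsa hc hSc hKp hKc hKi
  refine ⟨fun j => Λ j - b, ψ, fun j => ⟨(h1 j).1, (hpair _ _).mpr ?_⟩, h2, fun l χ h => ?_,
    fun j => sub_le_sub_right (h4 j.le_succ) b, tendsto_atTop_add_const_right _ (-b) h5, h6, ?_⟩
  · rw [sub_add_cancel]
    exact (h1 j).2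
  · have h7 := h3 (l + b) χ ((hpair _ _).mp h)
    simpa only [sub_eq_iff_eq_add] using h7
  · have h7 := denseRange_mulOp_one.topologicalClosure_map_submodule h6
    rw [Submodule.map_span, ← range_comp] at h7
    convert h7 using 4
    funext j
    exact embed_eq_mulOp (ψ j)

end Complete

/-! ### Interpolation -/

/-- The multiplier `r`. -/
def Multiplier.radius (M : Model) : Multiplier M where
  fn r := r
  continuous := continuous_id
  bound := by
    cases M with
    | bounded r₀ =>
      refine ⟨r₀ ^ 2, by positivity, fun r hr => ?_⟩
      have h : r ^ 2 ≤ r₀ ^ 2 := pow_le_pow_left₀ hr.1.le hr.2.le 2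
      simpa [Model.weight] using h
    | unbounded => exact ⟨1, one_pos.le, fun r _ => by simp [Model.weight]⟩

lemma rpow_sq_le {r a : ℝ} (hr0 : 0 < r) (h0 : 0 ≤ a) (h1 : a ≤ 1) : (r ^ a) ^ 2 ≤ 1 + r ^ 2 := by
  rcases le_total r 1 with hr1 | hr1
  · have := pow_le_one₀ (n := 2) (by positivity) (Real.rpow_le_one hr0.le hr1 h0)
    nlinarith
  · have h4 := Real.rpow_le_rpow_of_exponent_le hr1 h1
    rw [Real.rpow_one] at h4
    have := pow_le_pow_left₀ (by positivity) h4 2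
    linarith

/-- The multiplier `r ^ a`. -/
def Multiplier.rpow (M : Model) (a : ℝ) (h0 : 0 ≤ a) (h1 : a ≤ 1) : Multiplier M where
  fn r := r ^ a
  continuous := Real.continuous_rpow_const h0
  bound := by
    obtain ⟨C, hC, h⟩ := (Multiplier.radius M).bound
    refine ⟨1 + C, by positivity, fun r hr => ?_⟩
    have hr0 : 0 < r := M.interval_subset hr
    have hw := mul_nonneg M.weight_nonneg (sq_nonneg r)
    have h2 := h r hr
    change r ^ 2 ≤ _ at h2
    have h3 := rpow_sq_le hr0 h0 h1
    linarith

/-- By parts, `∫ r ‖φ‖²` equals `-∫ r² Re ⟨φ, φ'⟩`, and `r² ‖φ‖ ‖φ'‖ ≤ ε r ‖φ'‖² + r³ ‖φ‖² / (4 ε)`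
since the difference is a square. -/
lemma norm_sq_testIncl_le (φ : TestSpace T M) {ε : ℝ} (hε : 0 < ε) :
    ‖testIncl T M φ‖ ^ 2
      ≤ ε * ‖φ‖ ^ 2 + 1 / (4 * ε) * ‖mulTest T M (.radius M) φ‖ ^ 2 := by
  have c0 := continuous_re_inner_deriv φ
  have i1 := (integrable_weight φ _ continuous_id).integrableOn (s := M.interval)
  have i2 := (integrable_weight φ (fun r => r * r ^ 2) (by fun_prop)).integrableOn
    (s := M.interval)
  have i3 := (integrable_deriv φ).integrableOn (s := M.interval)
  have i4 : IntegrableOn (fun r => r * ‖φ.fn r‖ ^ 2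
      + r ^ 2 * (inner ℂ (φ.fn r) (deriv φ.fn r)).re) M.interval :=
    i1.add (integrable_of_support φ _ (by fun_prop)
      fun r hr => by simp [φ.fn_zero_of hr]).integrableOn
  have i5 : IntegrableOn (fun r => ε * (r * ‖deriv φ.fn r‖ ^ 2)
      + 1 / (4 * ε) * (r * r ^ 2 * ‖φ.fn r‖ ^ 2)) M.interval := (i3.const_mul _).add (i2.const_mul _)
  have h1 : ∫ r in M.interval, r * ‖φ.fn r‖ ^ 2 ≤ ∫ r in M.interval,
      ((r * ‖φ.fn r‖ ^ 2 + r ^ 2 * (inner ℂ (φ.fn r) (deriv φ.fn r)).re)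
        + (ε * (r * ‖deriv φ.fn r‖ ^ 2) + 1 / (4 * ε) * (r * r ^ 2 * ‖φ.fn r‖ ^ 2))) := by
    refine setIntegral_mono_on i1 (i4.add i5)
      M.measurableSet_interval fun r hr => ?_
    have hr0 : 0 < r := M.interval_subset hr
    have h2 := mul_le_mul_of_nonneg_left (abs_le.mp (abs_re_inner_deriv_le φ r)).1 (sq_nonneg r)
    have h3 : ε * (r * ‖deriv φ.fn r‖ ^ 2) + 1 / (4 * ε) * (r * r ^ 2 * ‖φ.fn r‖ ^ 2)
        - r ^ 2 * (‖φ.fn r‖ * ‖deriv φ.fn r‖)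
          = r / ε * (ε * ‖deriv φ.fn r‖ - r * ‖φ.fn r‖ / 2) ^ 2 := by
      field_simp
      ring
    have h4 : 0 ≤ r / ε * (ε * ‖deriv φ.fn r‖ - r * ‖φ.fn r‖ / 2) ^ 2 := by positivity
    linarith
  rw [integral_add i4 i5, integral_by_parts, zero_add,
    integral_add (i3.const_mul _) (i2.const_mul _), integral_const_mul, integral_const_mul] at h1
  rw [norm_sq_testIncl, norm_sq_mulTest]
  refine h1.trans (add_le_add (mul_le_mul_of_nonneg_left (integral_deriv_le φ) hε.le) le_rfl)

lemma norm_sq_mulTest_rpow_le (φ : TestSpace T M) {a : ℝ} (h0 : 0 ≤ a) (h1 : a ≤ 1) :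
    ‖mulTest T M (.rpow M a h0 h1) φ‖ ^ 2
      ≤ ‖testIncl T M φ‖ ^ 2 + ‖mulTest T M (.radius M) φ‖ ^ 2 := by
  have i1 := (integrable_weight φ _ continuous_id).integrableOn (s := M.interval)
  have i2 := (integrable_weight φ (fun r => r * r ^ 2) (by fun_prop)).integrableOn
    (s := M.interval)
  rw [norm_sq_testIncl, norm_sq_mulTest, norm_sq_mulTest]
  refine le_trans ?_ (integral_add i1 i2).le
  refine setIntegral_mono_on (integrable_weight φ _ ?_).integrableOn (i1.add i2)
    M.measurableSet_interval fun r hr => ?_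
  · have := (Multiplier.rpow M a h0 h1).continuous
    fun_prop
  · have hr0 : 0 < r := M.interval_subset hr
    have := mul_le_mul_of_nonneg_left (rpow_sq_le hr0 h0 h1)
      (by positivity : 0 ≤ r * ‖φ.fn r‖ ^ 2)
    simp only [Multiplier.rpow, id]
    linarith

/-- The form `‖φ‖² + α ∫ r³ ‖φ‖² + β ∫ r^(1 + 2a) ‖φ‖²` is coercive after a shift by a multiple of
`∫ r³ ‖φ‖²`. -/
lemma exists_coercive_shift (T : AngularOp F) (M : Model) {a : ℝ} (h0 : 0 ≤ a) (h1 : a ≤ 1)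
    (α β : ℝ) {γ : ℝ} (hγ : 0 < γ) : ∃ b : ℝ, ∀ φ : TestSpace T M, 1 / 2 * ‖φ‖ ^ 2
      ≤ ‖φ‖ ^ 2 + (α + b * γ) * ‖mulTest T M (.radius M) φ‖ ^ 2
        + β * ‖mulTest T M (.rpow M a h0 h1) φ‖ ^ 2 := by
  -- With `|β| ε ≤ 1/2` at most half of the norm is lost, and `b` is chosen such that `α + b γ = |β|
  -- (1 / (4 ε) + 1)`, the coefficient of `∫ r³ ‖φ‖²` that is needed.
  set ε : ℝ := 1 / (2 * (|β| + 1)) with hε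
  have hε0 : 0 < ε := by positivity
  refine ⟨(|β| * (1 / (4 * ε) + 1) - α) / γ, fun φ => ?_⟩
  rw [div_mul_cancel₀ _ hγ.ne']
  have h2 := mul_le_mul_of_nonneg_left (norm_sq_mulTest_rpow_le φ h0 h1) (abs_nonneg β)
  have h3 := mul_le_mul_of_nonneg_left (norm_sq_testIncl_le φ hε0) (abs_nonneg β)
  have h4 := mul_le_mul_of_nonneg_right (neg_abs_le β)
    (sq_nonneg ‖mulTest T M (.rpow M a h0 h1) φ‖)
  have h5 : |β| * ε ≤ 1 / 2 := by
    rw [hε, mul_one_div, div_le_div_iff₀ (by positivity) two_pos]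
    linarith
  have h6 := mul_le_mul_of_nonneg_right h5 (sq_nonneg ‖φ‖)
  linarith

lemma norm_sq_mulTest_radius_le (φ : TestSpace T .unbounded) :
    ‖mulTest T .unbounded (.radius .unbounded) φ‖ ^ 2 ≤ ‖φ‖ ^ 2 := by
  refine le_trans (le_of_eq ?_) (integral_weight_le φ)
  rw [norm_sq_mulTest]
  refine integral_congr_ae (Eventually.of_forall fun r => ?_)
  simp only [Multiplier.radius, Model.weight]
  ring

end Radial

/-! ### The two cosmological eigenvalue problems -/

namespace Cosmo

open Radial

/-- The exponent `(n - 2) / n`. -/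
def Params.exponent (P : Params) : ℝ := ((P.n : ℝ) - 2) / P.n

lemma Params.two_le_cast (P : Params) : (2 : ℝ) ≤ P.n := by exact_mod_cast P.two_le_n

lemma Params.exponent_nonneg (P : Params) : 0 ≤ P.exponent :=
  div_nonneg (sub_nonneg.mpr P.two_le_cast) (Nat.cast_nonneg _)

lemma Params.exponent_lt_one (P : Params) : P.exponent < 1 := by
  have := P.two_le_cast
  rw [exponent, div_lt_one (by linarith)]
  linarith

/-- The multiplier `r ^ ((n - 2) / n)`. -/
abbrev Params.power (P : Params) (M : Model) : Multiplier M :=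
  .rpow M P.exponent P.exponent_nonneg P.exponent_lt_one.le

lemma Params.power_sq (P : Params) (M : Model) {r : ℝ} (hr : 0 < r) :
    (P.power M).fn r ^ 2 = r ^ (2 * ((P.n : ℝ) - 2) / P.n) := by
  change (r ^ P.exponent) ^ 2 = _
  rw [← Real.rpow_natCast, ← Real.rpow_mul hr.le, exponent]
  congr 1
  push_cast
  ring

variable {F : Type*} [NormedAddCommGroup F] [InnerProductSpace ℂ F] [CompleteSpace F]
  [FiniteDimensional ℂ F] [Nontrivial F]

/-- The right-hand side has the multiplier `r`, so the `V̄` term of the potential is a multiple of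
it and the `κ` term is dominated after a shift. -/
theorem exists_eigenbasis_bounded (P : Params) (T : AngularOp F) {r₀ : ℝ} (hr₀ : 0 < r₀) :
    ∃ (Λ : ℕ → ℝ) (ψ : ℕ → FormSpace T (.bounded r₀)),
      (∀ j, ψ j ≠ 0 ∧ IsEigenpair P.q1 P.w1 (Λ j) (ψ j)) ∧
      LinearIndependent ℂ ψ ∧
      (∀ (l : ℝ) (χ : FormSpace T (.bounded r₀)), IsEigenpair P.q1 P.w1 l χ →
        χ ∈ Submodule.span ℂ (ψ '' {j | Λ j = l})) ∧
      (∀ j, Λ j ≤ Λ (j + 1)) ∧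
      Tendsto Λ atTop atTop ∧
      (Submodule.span ℂ (range ψ)).topologicalClosure = ⊤ ∧
      (Submodule.span ℂ (range fun j => embed T (.bounded r₀) (ψ j))).topologicalClosure = ⊤ := by
  have hn := P.two_le_cast
  have hγ : 0 < 16 / (P.n : ℝ) ^ 2 := by positivity
  obtain ⟨b, hb⟩ := exists_coercive_shift T (.bounded r₀) P.exponent_nonneg P.exponent_lt_one.le
    (-(16 / (P.n : ℝ) ^ 2 * P.Vbar)) (16 / (P.n : ℝ) ^ 2 * P.κ) hγ
  refine exists_eigenbasis (M := .bounded r₀)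
    ⟨r₀ / 2, show r₀ / 2 ∈ Ioo 0 r₀ from ⟨by positivity, by linarith⟩⟩ (.radius _) (P.power _) hγ
    (fun r hr => ?_) (fun r _ => rfl) (fun r hr => hr)
    -- For `R = r₀` no point of the interval lies beyond `R`.
    (fun ε _ => ⟨r₀, hr₀, fun r hr h => absurd hr.2 h.not_gt⟩) one_half_pos hb
  rw [P.power_sq _ hr.1]
  simp only [Params.q1, Model.weight, Multiplier.radius]
  ring

/-- The roles of the multipliers are exchanged: the power of `r` stands on the right and `r²` is the
potential. As the scalar product contains `r²` with coefficient `1`, the coefficient `16 / n² - 1`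
remains, and the form is bounded below by `min 1 (16 / n²)` without a shift. -/
theorem exists_eigenbasis_unbounded (P : Params) (hκ : P.κ < 0) (T : AngularOp F) :
    ∃ (Λ : ℕ → ℝ) (ψ : ℕ → FormSpace T .unbounded),
      (∀ j, ψ j ≠ 0 ∧ IsEigenpair P.q2 P.w2 (Λ j) (ψ j)) ∧
      LinearIndependent ℂ ψ ∧
      (∀ (l : ℝ) (χ : FormSpace T .unbounded), IsEigenpair P.q2 P.w2 l χ →
        χ ∈ Submodule.span ℂ (ψ '' {j | Λ j = l})) ∧
      (∀ j, Λ j ≤ Λ (j + 1)) ∧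
      Tendsto Λ atTop atTop ∧
      (Submodule.span ℂ (range ψ)).topologicalClosure = ⊤ ∧
      (Submodule.span ℂ (range fun j => embed T .unbounded (ψ j))).topologicalClosure = ⊤ := by
  have hn := P.two_le_cast
  have h16 : 0 < 16 / (P.n : ℝ) ^ 2 := by positivity
  refine exists_eigenbasis (M := .unbounded) (α := 0) (β := 16 / (P.n : ℝ) ^ 2 - 1) (b := 0)
    ⟨1, mem_Ioi.mpr one_pos⟩
    (P.power _) (.radius _) (mul_pos (neg_pos.mpr hκ) h16) (fun r _ => ?_)
    (fun r hr => by rw [P.power_sq _ hr, Params.w2]) (fun r hr => Real.rpow_pos_of_pos hr _)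
    (fun ε hε => ?_) (lt_min one_pos h16) fun φ => ?_
  · simp only [Params.q2, Model.weight, Multiplier.radius]
    ring
  -- The quotient of `r ^ (n - 2) / n` by `r` is a negative power of `r`, since the exponent is less
  -- than `1`; this is the decay that compactness requires.
  · have ht : Tendsto (fun r : ℝ => (r ^ (-(1 - P.exponent))) ^ 2) atTop (𝓝 (0 ^ 2)) :=
      (tendsto_rpow_neg_atTop (sub_pos.mpr P.exponent_lt_one)).pow 2
    rw [zero_pow two_ne_zero] at ht
    obtain ⟨R, hR⟩ := (ht.eventually (ge_mem_nhds hε)).exists_forall_of_atTop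
    refine ⟨max R 1, by positivity, fun r hr h => ?_⟩
    have hr0 : 0 < r := hr
    have h1 := hR r ((le_max_left _ _).trans h.le)
    have h2 : (P.power .unbounded).fn r = r ^ (-(1 - P.exponent)) * r := by
      rw [← Real.rpow_add_one hr0.ne']
      change r ^ P.exponent = _
      congr 1
      ring
    rw [h2, mul_pow, Model.weight, one_mul]
    gcongr
  · have h1 := norm_sq_mulTest_radius_le φ
    have h2 := sq_nonneg ‖mulTest T .unbounded (.radius .unbounded) φ‖
    rcases le_total 1 (16 / (P.n : ℝ) ^ 2) with h | h
    · rw [min_eq_left h]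
      have := mul_nonneg (sub_nonneg.mpr h) h2
      linarith
    · rw [min_eq_right h]
      have := mul_le_mul_of_nonneg_left h1 (sub_nonneg.mpr h)
      linarith

end Cosmo

end

theorem theorem7p2p1 (P : Cosmo.Params) (m : ℕ) (hm : 1 ≤ m)
    (S : Type*) [TopologicalSpace S] [T2Space S] [CompactSpace S] [Nonempty S]
    [ChartedSpace (EuclideanSpace ℝ (Fin m)) S] [IsManifold (𝓡 m) ∞ S]
    [MeasurableSpace S] [BorelSpace S] (g : RiemGeom.Metric m S) :
    -- the bounded model
    (∀ r₀ : ℝ, 0 < r₀ →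
      ∃ (Λ : ℕ → ℝ) (ψ : ℕ → Radial.FormSpace (Cosmo.angularOp P g) (.bounded r₀)),
        (∀ j, ψ j ≠ 0 ∧ Radial.IsEigenpair P.q1 P.w1 (Λ j) (ψ j)) ∧
        LinearIndependent ℂ ψ ∧
        (∀ (l : ℝ) (χ : Radial.FormSpace (Cosmo.angularOp P g) (.bounded r₀)),
          Radial.IsEigenpair P.q1 P.w1 l χ → χ ∈ Submodule.span ℂ (ψ '' {j | Λ j = l})) ∧
        (∀ j, Λ j ≤ Λ (j + 1)) ∧
        Tendsto Λ atTop atTop ∧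
        (Submodule.span ℂ (Set.range ψ)).topologicalClosure = ⊤ ∧
        (Submodule.span ℂ (Set.range fun j =>
          Radial.embed (Cosmo.angularOp P g) (.bounded r₀) (ψ j))).topologicalClosure = ⊤) ∧
    -- the unbounded model
    (P.κ < 0 →
      ∃ (lam : ℕ → ℝ) (ψ : ℕ → Radial.FormSpace (Cosmo.angularOp P g) .unbounded),
        (∀ j, ψ j ≠ 0 ∧ Radial.IsEigenpair P.q2 P.w2 (lam j) (ψ j)) ∧
        LinearIndependent ℂ ψ ∧
        (∀ (l : ℝ) (χ : Radial.FormSpace (Cosmo.angularOp P g) .unbounded),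
          Radial.IsEigenpair P.q2 P.w2 l χ → χ ∈ Submodule.span ℂ (ψ '' {j | lam j = l})) ∧
        (∀ j, lam j ≤ lam (j + 1)) ∧
        Tendsto lam atTop atTop ∧
        (Submodule.span ℂ (Set.range ψ)).topologicalClosure = ⊤ ∧
        (Submodule.span ℂ (Set.range fun j =>
          Radial.embed (Cosmo.angularOp P g) .unbounded (ψ j))).topologicalClosure = ⊤) := by
  -- Finite dimension yields completeness of the angular space and compactness; nontriviality makes
  -- the radial Hilbert spaces infinite dimensional, so that the eigenvalues form an infinite
  -- sequence.
  have := Cosmo.finiteDimensional_H0 P g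
  have := Cosmo.nontrivial_H0 P g
  have := FiniteDimensional.complete ℂ (Cosmo.H0 P g)
  exact ⟨fun _ hr₀ => Cosmo.exists_eigenbasis_bounded P _ hr₀,
    fun hκ => Cosmo.exists_eigenbasis_unbounded P hκ _⟩
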